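/- Let $\mathcal C$ be one of the following two categories. * $\mathcal{LRF}$: objects are finite rooted forests (including the empty forest $\emptyset$), and isomorphisms preserve roots and incidences. The subobjects $N\subset F$ are the forests $P_C(F)$ cut off by the admissible cuts $C$ of $F$ (at most one cut edge on each path from a leaf to the root, the full cut of a tree being allowed), and $F/P_C(F)=R_C(F)$ is the remaining forest, which contains the roots of the trees that are not fully cut. * $\mathcal{LFG}$: objects are Feynman graphs of $\phi^3$-theory, that is, finite graphs given by half-edges (including the empty graph $\emptyset$) in which every vertex is incident to exactly three half-edges and every connected component is one-particle irreducible, has two or three external edges and has at least one loop; isomorphisms are pairs of bijections on vertices and half-edges that preserve all incidences. The subobjects $\gamma\subset\Gamma$ are the Feynman graphs consisting of some vertices of $\Gamma$, all half-edges incident to them, and some of the adjacencies between these half-edges. In $\Gamma/\gamma$ each component of $\gamma$ with three external edges is contracted to a trivalent vertex, and each component with two external edges is removed and the half-edges to which its external edges were attached are joined; a component of $\gamma$ that is a whole connected component of $\Gamma$ is removed. In both cases $\oplus$ denotes disjoint union. Let $\mathrm H_{\mathcal C}$ be the space of finitely supported $\mathbb Q$-valued functions on the set $\mathrm{Iso}(\mathcal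 C)$ of isomorphism classes, with $(f\times g)(M)=\sum_{N\subset M}f(N)\,g(M/N)$ and $\Delta(f)(M,N)=f(M\oplus N)$. Then $\times$ makes $\mathrm H_{\mathcal C}$ an associative algebra with unit $\delta_\emptyset$, the space $\mathfrak n_{\mathcal C}=\{X: \Delta(X)=X\otimes 1+1\otimes X\}$ is a Lie subalgebra for the commutator bracket, and the inclusion $\mathfrak n_{\mathcal C}\subset \mathrm H_{\mathcal C}$ extends to an isomorphism of algebras $U(\mathfrak n_{\mathcal C})\simeq \mathrm H_{\mathcal C}$. Let $\mathrm H_{ins}$ be $\mathrm H_{\mathcal C}$ with the left action $X\cdot f=X\times f$ of $\mathfrak n_{\mathcal C}$, and let $\mathrm H_{top\text{-}ins}$ be $\mathrm H_{\mathcal C}$ with the right action $f\cdot X = f\times X$, regarded as a left module through the transpose $X^t=-X$, that is, with $X\cdot f=f\times X^t=-f\times X$. Let $\mathrm H^*_{\mathcal C}$ be the restricted dual of $\mathrm H_{\mathcal C}$, spanned by the functionals $\phi_A: f\mapsto f(A)$, $A\in\mathrm{Iso}(\mathcal C)$; it is stable under the dual actions $(X\cdot\phi)(f)=-\phi(X\cdot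 f)$ of $\mathfrak n_{\mathcal C}$ on the duals of $\mathrm H_{ins}$ and $\mathrm H_{top\text{-}ins}$, and the resulting modules are denoted $\mathrm H^*_{elim}$ and $\mathrm H^*_{top\text{-}elim}$. Then the transpose ${}^t:U(\mathfrak n_{\mathcal C})\to U(\mathfrak n_{\mathcal C})^{op}$, the algebra homomorphism that extends $X\mapsto -X$, is under $U(\mathfrak n_{\mathcal C})\simeq\mathrm H_{\mathcal C}$ an isomorphism of $\mathfrak n_{\mathcal C}$-modules $$\mathrm H_{ins}\;\simeq\;\mathrm H_{top\text{-}ins},$$ and there is an isomorphism of $\mathfrak n_{\mathcal C}$-modules $$\mathrm H^*_{elim}\;\simeq\;\mathrm H^*_{top\text{-}elim},\qquad \phi\mapsto \phi\circ ({}^t)^{-1}.$$ -/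

import Mathlib

/- The bracket of an associative ring is its commutator. -/
attribute [local instance 100] LieRing.ofAssociativeRing

namespace HallCK

/-! ### Ringel-Hall data

The part of a category that enters its Ringel-Hall algebra: objects, isomorphism, the zero object,
the direct sum, and, for every object `M`, the finite set of subobjects `N ⊂ M`, with the objects
`N` and `M/N`. -/

structure HallData where
  Obj : Type 1
  iso : Setoid Obj
  zero : Obj
  sum : Obj → Obj → Obj
  Sub : Obj → Type
  subFinite : ∀ M, Finite (Sub M)
  sub : ∀ M, Sub M → Obj
  quot : ∀ M, Sub M → Obj

namespace HallData

variable (C : HallData)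

/-- The set of isomorphism classes of objects. -/
def Iso : Type 1 := Quotient C.iso

/-- The isomorphism class of an object. -/
def cls (M : C.Obj) : C.Iso := Quotient.mk C.iso M

/-- The finitely supported `ℚ`-valued functions on isomorphism classes. No algebraic structure is
put on this type here; see `IsHallAlgebra`. -/
def Hall : Type 1 := C.Iso →₀ ℚ

instance : FunLike C.Hall C.Iso ℚ := inferInstanceAs (FunLike (C.Iso →₀ ℚ) C.Iso ℚ)

open Classical in
/-- The function `δ_∅`, as a function on isomorphism classes. -/
noncomputable def deltaZero (M : C.Iso) : ℚ := if M = C.cls C.zero then 1 else 0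

/-- A `ℚ`-algebra structure on `C.Hall` is that of the Ringel-Hall algebra: the vector space
structure is pointwise, the unit is `δ_∅`, and `(f × g)(M) = ∑_{N ⊂ M} f(N) g(M/N)`. At most one
algebra structure has these properties. -/
structure IsHallAlgebra [Ring C.Hall] [Algebra ℚ C.Hall] : Prop where
  add_apply : ∀ (f g : C.Hall) (M : C.Iso), (f + g) M = f M + g M
  smul_apply : ∀ (c : ℚ) (f : C.Hall) (M : C.Iso), (c • f) M = c * f M
  one_apply : ∀ M : C.Iso, (1 : C.Hall) M = C.deltaZero M
  mul_apply : ∀ (f g : C.Hall) (M : C.Obj),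
    (f * g) (C.cls M) = ∑ᶠ N : C.Sub M, f (C.cls (C.sub M N)) * g (C.cls (C.quot M N))

/-- `f` is primitive, `Δ f = f ⊗ 1 + 1 ⊗ f`, for the coproduct `(Δ f)(M, N) = f(M ⊕ N)`. -/
def IsPrimitive (f : C.Hall) : Prop :=
  ∀ M N : C.Obj, f (C.cls (C.sum M N)) =
    f (C.cls M) * C.deltaZero (C.cls N) + C.deltaZero (C.cls M) * f (C.cls N)

/-- The restricted (graded) dual: the span of the functionals `φ_M : f ↦ f(M)`. -/
def restrictedDual [Ring C.Hall] [Algebra ℚ C.Hall] : Submodule ℚ (Module.Dual ℚ C.Hall) :=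
  Submodule.span ℚ {φ | ∃ M : C.Iso, ∀ f : C.Hall, φ f = f M}

end HallData

/-! ### The transpose of an enveloping algebra, and the two regular modules -/

section Transpose

variable (L : Type*) [LieRing L] [LieAlgebra ℚ L]

open UniversalEnvelopingAlgebra in
/-- `X ↦ -X` as a Lie algebra homomorphism from `L` to the opposite of `U(L)`. -/
def negOp : L →ₗ⁅ℚ⁆ (UniversalEnvelopingAlgebra ℚ L)ᵐᵒᵖ :=
  { toFun := fun X => MulOpposite.op (-(ι ℚ X))
    map_add' := fun X Y => by simp [add_comm]
    map_smul' := fun c X => by simp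
    map_lie' := fun {X Y} => by
      simp only [LieHom.map_lie, LieRing.of_associative_ring_bracket]
      rw [← MulOpposite.op_mul, ← MulOpposite.op_mul, ← MulOpposite.op_sub]
      congr 1
      noncomm_ring }

/-- The extension of `X ↦ -X` to an algebra homomorphism `U(L) → U(L)ᵒᵖ`. -/
def transpose : UniversalEnvelopingAlgebra ℚ L →ₐ[ℚ] (UniversalEnvelopingAlgebra ℚ L)ᵐᵒᵖ :=
  UniversalEnvelopingAlgebra.lift ℚ (negOp L)

end Transpose

section Regular

variable {A : Type*} [Ring A] [Algebra ℚ A]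

/-- The algebra `A` as a left module over a Lie subalgebra `n`, through `X · f = X f`. -/
def Ins (_n : LieSubalgebra ℚ A) : Type _ := A

/-- The algebra `A` as a left module over a Lie subalgebra `n`, through the right action of `n`
twisted by the transpose, `X · f = f Xᵗ = f (-X)`. -/
def TopIns (_n : LieSubalgebra ℚ A) : Type _ := A

variable (n : LieSubalgebra ℚ A)

instance : AddCommGroup (Ins n) := inferInstanceAs (AddCommGroup A)
instance : Module ℚ (Ins n) := inferInstanceAs (Module ℚ A)
instance : AddCommGroup (TopIns n) := inferInstanceAs (AddCommGroup A)
instance : Module ℚ (TopIns n) := inferInstanceAs (Module ℚ A)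

/-- The identity of `A`, viewed as a map into `Ins n`. -/
def toIns : A ≃ₗ[ℚ] Ins n := LinearEquiv.refl ℚ A

/-- The identity of `A`, viewed as a map into `TopIns n`. -/
def toTopIns : A ≃ₗ[ℚ] TopIns n := LinearEquiv.refl ℚ A

instance : LieRingModule n (Ins n) where
  bracket X f := toIns n ((X : A) * (toIns n).symm f)
  add_lie X Y f := by simp [add_mul]
  lie_add X f g := by simp [mul_add]
  leibniz_lie X Y f := by
    rw [← map_add]
    simp only [LinearEquiv.symm_apply_apply, LieSubalgebra.coe_bracket,
      LieRing.of_associative_ring_bracket]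
    congr 1
    noncomm_ring

instance : LieModule ℚ n (Ins n) where
  smul_lie c X f := by
    change toIns n _ = c • toIns n _
    rw [← map_smul]; simp
  lie_smul c X f := by
    change toIns n _ = c • toIns n _
    rw [← map_smul]; simp

instance : LieRingModule n (TopIns n) where
  bracket X f := toTopIns n ((toTopIns n).symm f * (-(X : A)))
  add_lie X Y f := by
    rw [← map_add]
    congr 1
    push_cast
    noncomm_ring
  lie_add X f g := by simp [add_mul, add_comm]
  leibniz_lie X Y f := by
    rw [← map_add]
    simp only [LinearEquiv.symm_apply_apply, LieSubalgebra.coe_bracket,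
      LieRing.of_associative_ring_bracket]
    congr 1
    noncomm_ring

instance : LieModule ℚ n (TopIns n) where
  smul_lie c X f := by
    change toTopIns n _ = c • toTopIns n _
    rw [← map_smul]; simp
  lie_smul c X f := by
    change toTopIns n _ = c • toTopIns n _
    rw [← map_smul]; simp

end Regular

/-! ### Rooted forests -/

/-- A finite rooted forest: every vertex has a parent or is a root, and following parents never
returns to the starting point. The edges join the non-root vertices with their parents. -/
structure Forest where
  V : Type
  finite : Finite V
  parent : V → Option V
  acyclic : ∀ v, ¬ Relation.TransGen (fun x y => parent x = some y) v v

namespace Forest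

/-- `F.Below v w`: the vertex `w` lies on the path from `v` to its root. -/
def Below (F : Forest) : F.V → F.V → Prop :=
  Relation.ReflTransGen (fun x y => F.parent x = some y)

/-- An isomorphism of forests preserves roots and incidences. -/
def isoSetoid : Setoid Forest where
  r F G := ∃ e : F.V ≃ G.V, ∀ v, G.parent (e v) = (F.parent v).map e
  iseqv :=
    { refl := fun F => ⟨Equiv.refl _, fun v => by simp⟩
      symm := by
        rintro F G ⟨e, he⟩
        refine ⟨e.symm, fun v => ?_⟩
        have h := he (e.symm v)
        rw [Equiv.apply_symm_apply] at h
        rw [h, Option.map_map]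
        simp
      trans := by
        rintro F G K ⟨e, he⟩ ⟨d, hd⟩
        refine ⟨e.trans d, fun v => ?_⟩
        simp [hd, he, Option.map_map] }

/-- The empty forest. -/
abbrev empty : Forest where
  V := Empty
  finite := inferInstance
  parent := fun v => v.elim
  acyclic := fun v => v.elim

/-- The disjoint union of two forests. -/
abbrev sum (F G : Forest) : Forest where
  V := F.V ⊕ G.V
  finite := by
    have := F.finite
    have := G.finite
    infer_instance
  parent := Sum.elim (fun v => (F.parent v).map Sum.inl) (fun v => (G.parent v).map Sum.inr)
  acyclic := by
    have base : ∀ a b : F.V ⊕ G.V,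
        Sum.elim (fun v => (F.parent v).map Sum.inl) (fun v => (G.parent v).map Sum.inr) a
          = some b →
        Sum.LiftRel (fun x y => F.parent x = some y) (fun x y => G.parent x = some y) a b := by
      rintro (a | a) (b | b) h <;> simp_all
    have key : ∀ a b : F.V ⊕ G.V, Relation.TransGen (fun x y =>
        Sum.elim (fun v => (F.parent v).map Sum.inl) (fun v => (G.parent v).map Sum.inr) x
          = some y) a b →
        Sum.LiftRel (Relation.TransGen (fun x y => F.parent x = some y))
          (Relation.TransGen (fun x y => G.parent x = some y)) a b := by
      intro a b h
      induction h with
      | single h =>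
        cases base _ _ h with
        | inl h' => exact .inl (.single h')
        | inr h' => exact .inr (.single h')
      | tail _ h ih =>
        cases base _ _ h with
        | inl h' => cases ih with | inl ih => exact .inl (ih.tail h')
        | inr h' => cases ih with | inr ih => exact .inr (ih.tail h')
    intro v h
    have := key v v h
    cases this with
    | inl h => exact F.acyclic _ h
    | inr h => exact G.acyclic _ h

open Classical in
/-- The forest on a set `S` of vertices, with all the edges of `F` that join two vertices of `S`;
a vertex of `S` whose parent is not in `S` becomes a root. -/
noncomputable abbrev restrict (F : Forest) (S : Set F.V) : Forest where
  V := S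
  finite := by
    have := F.finite
    infer_instance
  parent := fun v => (F.parent v).bind fun w => if h : w ∈ S then some ⟨w, h⟩ else none
  acyclic := by
    intro v h
    refine F.acyclic v (h.lift Subtype.val ?_)
    intro a b hab
    obtain ⟨w, hw, hb⟩ := Option.bind_eq_some_iff.mp hab
    split_ifs at hb with hS
    · change F.parent a = some b.1
      rw [hw, ← Option.some.inj hb]

/-- Admissible cuts of a forest. A non-root vertex in `marks` stands for the cut edge that joins it
with its parent, and a root in `marks` stands for the full cut of its tree. Along a path from a leaf
to a root at most one mark is met, that is, no mark is a proper ancestor of another one. -/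
structure Cut (F : Forest) where
  marks : Set F.V
  admissible : ∀ a ∈ marks, ∀ b ∈ marks, F.Below a b → a = b

theorem Cut.finite (F : Forest) : Finite F.Cut := by
  have := F.finite
  refine Finite.of_injective (fun c : F.Cut => c.marks) ?_
  rintro ⟨a, _⟩ ⟨b, _⟩ h
  cases h
  rfl

/-- The vertices that an admissible cut separates from the root. -/
def Cut.pruned {F : Forest} (c : F.Cut) : Set F.V := {v | ∃ a ∈ c.marks, F.Below v a}

end Forest

/-- The category of labeled rooted forests. The subobjects of `F` are the `P_C(F)`, the quotients
are the `R_C(F)`, for the admissible cuts `C` of `F`. Labels are ignored by isomorphisms, and every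
finite forest can be labeled by an infinite set, so they are not recorded. -/
noncomputable def LRF : HallData where
  Obj := Forest
  iso := Forest.isoSetoid
  zero := Forest.empty
  sum := Forest.sum
  Sub := Forest.Cut
  subFinite := Forest.Cut.finite
  sub := fun F c => F.restrict c.pruned
  quot := fun F c => F.restrict c.prunedᶜ

/-! ### Feynman graphs -/

/-- Finite vertices and half-edges; `vert h` is the vertex of the half-edge `h`, and `adj` is the
adjacency of half-edges. -/
structure Graph where
  V : Type
  H : Type
  finiteV : Finite V
  finiteH : Finite H
  vert : H → V
  adj : H → H → Prop

namespace Graph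

/-- Two vertices are joined by an internal edge. -/
def Link (G : Graph) (v w : G.V) : Prop := ∃ h k, G.adj h k ∧ G.vert h = v ∧ G.vert k = w

/-- The connected components. -/
def Comp (G : Graph) : Type := Quot G.Link

/-- The connected component of a vertex. -/
def comp (G : Graph) (v : G.V) : G.Comp := Quot.mk _ v

/-- The half-edges of a component that are not adjacent to another half-edge (external edges). -/
def legs (G : Graph) (c : G.Comp) : Set G.H := {h | G.comp (G.vert h) = c ∧ ∀ k, ¬ G.adj h k}

/-- The half-edges of a component that belong to internal edges. -/
def inner (G : Graph) (c : G.Comp) : Set G.H := {h | G.comp (G.vert h) = c ∧ ∃ k, G.adj h k}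

/-- The graph without the internal edge `{h, k}`. -/
abbrev deleteEdge (G : Graph) (h k : G.H) : Graph :=
  { G with adj := fun a b => G.adj a b ∧ (a ≠ h ∧ a ≠ k) ∧ (b ≠ h ∧ b ≠ k) }

/-- Feynman graphs of `φ³` theory, all of whose connected components are one-particle irreducible.
A component `c` has first Betti number `#internal edges - #vertices + 1`. -/
structure IsFeynman (G : Graph) : Prop where
  adj_symm : ∀ h k, G.adj h k → G.adj k h
  adj_irrefl : ∀ h, ¬ G.adj h h
  adj_unique : ∀ h k l, G.adj h k → G.adj h l → k = l
  trivalent : ∀ v, {h | G.vert h = v}.ncard = 3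
  legs_card : ∀ c, (G.legs c).ncard = 2 ∨ (G.legs c).ncard = 3
  loop : ∀ c, 2 * {v | G.comp v = c}.ncard ≤ (G.inner c).ncard
  irreducible : ∀ h k, G.adj h k → ∀ v w, G.comp v = G.comp w →
    (G.deleteEdge h k).comp v = (G.deleteEdge h k).comp w

/-- An isomorphism is a pair of bijections that induce bijections on all incidences. -/
def isoSetoid : Setoid Graph where
  r G K := ∃ (e : G.V ≃ K.V) (d : G.H ≃ K.H),
    (∀ h, K.vert (d h) = e (G.vert h)) ∧ ∀ h k, K.adj (d h) (d k) ↔ G.adj h k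
  iseqv :=
    { refl := fun G => ⟨Equiv.refl _, Equiv.refl _, fun _ => rfl, fun _ _ => Iff.rfl⟩
      symm := by
        rintro G K ⟨e, d, h1, h2⟩
        refine ⟨e.symm, d.symm, fun h => ?_, fun h k => ?_⟩
        · rw [Equiv.eq_symm_apply, ← h1, Equiv.apply_symm_apply]
        · rw [← h2, Equiv.apply_symm_apply, Equiv.apply_symm_apply]
      trans := by
        rintro G K L ⟨e, d, h1, h2⟩ ⟨e', d', h1', h2'⟩
        refine ⟨e.trans e', d.trans d', fun h => ?_, fun h k => ?_⟩
        · simp [h1, h1']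
        · simp [h2, h2'] }

/-- The empty graph. -/
abbrev empty : Graph where
  V := Empty
  H := Empty
  finiteV := inferInstance
  finiteH := inferInstance
  vert := fun h => h.elim
  adj := fun h => h.elim

theorem empty_isFeynman : empty.IsFeynman where
  adj_symm h := h.elim
  adj_irrefl h := h.elim
  adj_unique h := h.elim
  trivalent v := v.elim
  legs_card c := by
    induction c using Quot.ind with | mk v => ?_
    exact v.elim
  loop c := by
    induction c using Quot.ind with | mk v => ?_
    exact v.elim
  irreducible h := h.elim

/-- The disjoint union of two graphs. -/
abbrev sum (G K : Graph) : Graph where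
  V := G.V ⊕ K.V
  H := G.H ⊕ K.H
  finiteV := by
    have := G.finiteV
    have := K.finiteV
    infer_instance
  finiteH := by
    have := G.finiteH
    have := K.finiteH
    infer_instance
  vert := Sum.map G.vert K.vert
  adj := Sum.LiftRel G.adj K.adj

theorem comp_map {G K : Graph} (f : G.V → K.V) (hf : ∀ v w, G.Link v w → K.Link (f v) (f w))
    {v w : G.V} (h : G.comp v = G.comp w) : K.comp (f v) = K.comp (f w) :=
  congrArg (Quot.map f hf) h

theorem sum_comp_iff (G K : Graph) (v w : G.V ⊕ K.V) :
    (G.sum K).comp v = (G.sum K).comp w ↔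
      Sum.LiftRel (fun a b => G.comp a = G.comp b) (fun a b => K.comp a = K.comp b) v w := by
  constructor
  · intro h
    have hres : ∀ a b : G.V ⊕ K.V, (G.sum K).Link a b →
        Sum.map G.comp K.comp a = Sum.map G.comp K.comp b := by
      rintro a b ⟨h, k, hadj, rfl, rfl⟩
      cases hadj with
      | inl hadj => exact congrArg Sum.inl (Quot.sound ⟨_, _, hadj, rfl, rfl⟩)
      | inr hadj => exact congrArg Sum.inr (Quot.sound ⟨_, _, hadj, rfl, rfl⟩)
    have h' : Sum.map G.comp K.comp v = Sum.map G.comp K.comp w :=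
      congrArg (Quot.lift (r := (G.sum K).Link) (Sum.map G.comp K.comp) hres) h
    rcases v with v | v <;> rcases w with w | w <;> simp at h' ⊢ <;> exact h'
  · intro h
    cases h with
    | inl h =>
      refine comp_map (K := G.sum K) Sum.inl ?_ h
      rintro a b ⟨h, k, hadj, rfl, rfl⟩
      exact ⟨_, _, .inl hadj, rfl, rfl⟩
    | inr h =>
      refine comp_map (K := G.sum K) Sum.inr ?_ h
      rintro a b ⟨h, k, hadj, rfl, rfl⟩
      exact ⟨_, _, .inr hadj, rfl, rfl⟩

theorem sum_legs_inl (G K : Graph) (v : G.V) :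
    (G.sum K).legs ((G.sum K).comp (.inl v)) = Sum.inl '' G.legs (G.comp v) := by
  ext (h | h)
  · have h1 := sum_comp_iff G K (.inl (G.vert h)) (.inl v)
    simp [legs, sum] at h1 ⊢
    simp [h1]
  · have h1 := sum_comp_iff G K (.inr (K.vert h)) (.inl v)
    simp [legs, sum] at h1 ⊢
    simp [h1]

theorem sum_legs_inr (G K : Graph) (v : K.V) :
    (G.sum K).legs ((G.sum K).comp (.inr v)) = Sum.inr '' K.legs (K.comp v) := by
  ext (h | h)
  · have h1 := sum_comp_iff G K (.inl (G.vert h)) (.inr v)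
    simp [legs, sum] at h1 ⊢
    simp [h1]
  · have h1 := sum_comp_iff G K (.inr (K.vert h)) (.inr v)
    simp [legs, sum] at h1 ⊢
    simp [h1]

theorem sum_inner_inl (G K : Graph) (v : G.V) :
    (G.sum K).inner ((G.sum K).comp (.inl v)) = Sum.inl '' G.inner (G.comp v) := by
  ext (h | h)
  · have h1 := sum_comp_iff G K (.inl (G.vert h)) (.inl v)
    simp [inner, sum] at h1 ⊢
    simp [h1]
  · have h1 := sum_comp_iff G K (.inr (K.vert h)) (.inl v)
    simp [inner, sum] at h1 ⊢
    simp [h1]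

theorem sum_inner_inr (G K : Graph) (v : K.V) :
    (G.sum K).inner ((G.sum K).comp (.inr v)) = Sum.inr '' K.inner (K.comp v) := by
  ext (h | h)
  · have h1 := sum_comp_iff G K (.inl (G.vert h)) (.inr v)
    simp [inner, sum] at h1 ⊢
    simp [h1]
  · have h1 := sum_comp_iff G K (.inr (K.vert h)) (.inr v)
    simp [inner, sum] at h1 ⊢
    simp [h1]

theorem sum_isFeynman {G K : Graph} (hG : G.IsFeynman) (hK : K.IsFeynman) :
    (G.sum K).IsFeynman where
  adj_symm h k hadj := by
    cases hadj with
    | inl h => exact .inl (hG.adj_symm _ _ h)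
    | inr h => exact .inr (hK.adj_symm _ _ h)
  adj_irrefl h hadj := by
    cases hadj with
    | inl h => exact hG.adj_irrefl _ h
    | inr h => exact hK.adj_irrefl _ h
  adj_unique h k l h1 h2 := by
    cases h1 with
    | inl h1 => cases h2 with | inl h2 => exact congrArg _ (hG.adj_unique _ _ _ h1 h2)
    | inr h1 => cases h2 with | inr h2 => exact congrArg _ (hK.adj_unique _ _ _ h1 h2)
  trivalent v := by
    rcases v with v | v
    · have h : {h | (G.sum K).vert h = .inl v} = Sum.inl '' {h | G.vert h = v} := by
        ext (h | h) <;> simp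
      rw [h, Set.ncard_image_of_injective _ Sum.inl_injective]
      exact hG.trivalent v
    · have h : {h | (G.sum K).vert h = .inr v} = Sum.inr '' {h | K.vert h = v} := by
        ext (h | h) <;> simp
      rw [h, Set.ncard_image_of_injective _ Sum.inr_injective]
      exact hK.trivalent v
  legs_card c := by
    induction c using Quot.ind with | mk v => ?_
    rcases v with v | v
    · change ((G.sum K).legs ((G.sum K).comp (.inl v))).ncard = 2 ∨
        ((G.sum K).legs ((G.sum K).comp (.inl v))).ncard = 3
      rw [sum_legs_inl, Set.ncard_image_of_injective _ Sum.inl_injective]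
      exact hG.legs_card _
    · change ((G.sum K).legs ((G.sum K).comp (.inr v))).ncard = 2 ∨
        ((G.sum K).legs ((G.sum K).comp (.inr v))).ncard = 3
      rw [sum_legs_inr, Set.ncard_image_of_injective _ Sum.inr_injective]
      exact hK.legs_card _
  loop c := by
    induction c using Quot.ind with | mk v => ?_
    rcases v with v | v
    · change 2 * {w | (G.sum K).comp w = (G.sum K).comp (.inl v)}.ncard ≤
        ((G.sum K).inner ((G.sum K).comp (.inl v))).ncard
      have h : {w | (G.sum K).comp w = (G.sum K).comp (.inl v)} =
          Sum.inl '' {w | G.comp w = G.comp v} := by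
        ext (w | w) <;> simp [sum_comp_iff]
      rw [h, sum_inner_inl, Set.ncard_image_of_injective _ Sum.inl_injective,
        Set.ncard_image_of_injective _ Sum.inl_injective]
      exact hG.loop _
    · change 2 * {w | (G.sum K).comp w = (G.sum K).comp (.inr v)}.ncard ≤
        ((G.sum K).inner ((G.sum K).comp (.inr v))).ncard
      have h : {w | (G.sum K).comp w = (G.sum K).comp (.inr v)} =
          Sum.inr '' {w | K.comp w = K.comp v} := by
        ext (w | w) <;> simp [sum_comp_iff]
      rw [h, sum_inner_inr, Set.ncard_image_of_injective _ Sum.inr_injective,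
        Set.ncard_image_of_injective _ Sum.inr_injective]
      exact hK.loop _
  irreducible h k hadj v w hvw := by
    have hvw' := (sum_comp_iff G K v w).1 hvw
    cases hadj with
    | @inl h k hadj =>
      cases hvw' with
      | inl e =>
        refine comp_map (G := G.deleteEdge h k)
          (K := (G.sum K).deleteEdge (.inl h) (.inl k)) Sum.inl ?_
          (hG.irreducible h k hadj _ _ e)
        rintro a b ⟨x, y, ⟨hxy, hx, hy⟩, rfl, rfl⟩
        exact ⟨.inl x, .inl y, ⟨.inl hxy, by simpa using hx, by simpa using hy⟩, rfl, rfl⟩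
      | inr e =>
        refine comp_map (K := (G.sum K).deleteEdge (.inl h) (.inl k)) Sum.inr ?_ e
        rintro a b ⟨x, y, hxy, rfl, rfl⟩
        exact ⟨.inr x, .inr y, ⟨.inr hxy, by simp, by simp⟩, rfl, rfl⟩
    | @inr h k hadj =>
      cases hvw' with
      | inl e =>
        refine comp_map (K := (G.sum K).deleteEdge (.inr h) (.inr k)) Sum.inl ?_ e
        rintro a b ⟨x, y, hxy, rfl, rfl⟩
        exact ⟨.inl x, .inl y, ⟨.inl hxy, by simp, by simp⟩, rfl, rfl⟩
      | inr e =>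
        refine comp_map (G := K.deleteEdge h k)
          (K := (G.sum K).deleteEdge (.inr h) (.inr k)) Sum.inr ?_
          (hK.irreducible h k hadj _ _ e)
        rintro a b ⟨x, y, ⟨hxy, hx, hy⟩, rfl, rfl⟩
        exact ⟨.inr x, .inr y, ⟨.inr hxy, by simpa using hx, by simpa using hy⟩, rfl, rfl⟩

/-! Subgraphs and contraction. -/

/-- Part of a graph: some of its vertices, with all the half-edges at these vertices, and some of
the adjacencies between these half-edges. -/
structure Part (G : Graph) where
  verts : Set G.V
  adj : G.H → G.H → Prop
  adj_sub : ∀ h k, adj h k → G.adj h k ∧ G.vert h ∈ verts ∧ G.vert k ∈ verts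

namespace Part

variable {G : Graph} (P : G.Part)

/-- A part of a graph as a graph. -/
abbrev toGraph : Graph where
  V := P.verts
  H := {h : G.H // G.vert h ∈ P.verts}
  finiteV := by
    have := G.finiteV
    infer_instance
  finiteH := by
    have := G.finiteH
    infer_instance
  vert := fun h => ⟨G.vert h.1, h.2⟩
  adj := fun h k => P.adj h.1 k.1

/-- The components of a part with three external edges that contract to a new vertex. A component
of the part that is a whole component of the ambient graph (so that none of its external edges is
adjacent to another half-edge there) contracts to the empty graph instead. -/
def NewVertex : Type :=
  {c : P.toGraph.Comp // (P.toGraph.legs c).ncard = 3 ∧ ∃ h ∈ P.toGraph.legs c, ∃ k, G.adj h.1 k}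

/-- `P.Thread h k`: starting at `h` along its internal edge in `G`, and passing through any number
of components of `P` with two external edges, entering at one and leaving at the other external
edge, one arrives at `k`. -/
inductive Thread : G.H → G.H → Prop
  | edge {h k : G.H} : G.adj h k → Thread h k
  | through {h k : G.H} (c : P.toGraph.Comp) (x y : P.toGraph.H) : Thread h x.1 →
      (P.toGraph.legs c).ncard = 2 → x ∈ P.toGraph.legs c → y ∈ P.toGraph.legs c → x ≠ y →
      G.adj y.1 k → Thread h k

/-- The half-edges of the contraction: those at vertices outside the part, and the external edges
of the components that become new vertices. -/
def QuotH : Type :=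
  {h : G.H // G.vert h ∉ P.verts} ⊕ (Σ c : P.NewVertex, P.toGraph.legs c.1)

/-- The half-edges of the contraction as half-edges of the ambient graph. -/
def QuotH.val {P : G.Part} : P.QuotH → G.H
  | .inl h => h.1
  | .inr p => p.2.1.1

/-- The contraction `G/P` of every component of `P`: a component with three external edges becomes
a vertex; a component with two external edges is removed, and the half-edges to which its external
edges were adjacent become adjacent to each other. -/
abbrev contract : Graph where
  V := {v : G.V // v ∉ P.verts} ⊕ P.NewVertex
  H := P.QuotH
  finiteV := by
    have := G.finiteV
    have : Finite P.toGraph.V := P.toGraph.finiteV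
    have : Finite P.toGraph.Comp := Finite.of_surjective (Quot.mk P.toGraph.Link) Quot.mk_surjective
    have : Finite P.NewVertex := inferInstanceAs (Finite {c : P.toGraph.Comp // _})
    infer_instance
  finiteH := by
    have := G.finiteV
    have := G.finiteH
    have : Finite P.toGraph.V := P.toGraph.finiteV
    have : Finite P.toGraph.Comp := Finite.of_surjective (Quot.mk P.toGraph.Link) Quot.mk_surjective
    have : Finite P.NewVertex := inferInstanceAs (Finite {c : P.toGraph.Comp // _})
    have : Finite P.toGraph.H := P.toGraph.finiteH
    exact inferInstanceAs (Finite (_ ⊕ (Σ c : P.NewVertex, P.toGraph.legs c.1)))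
  vert := Sum.map (fun h => ⟨G.vert h.1, h.2⟩) Sigma.fst
  adj := fun h k => P.Thread h.val k.val

end Part

/-- Feynman subgraphs. That the contraction is again a Feynman graph is automatic when the ambient
graph is one; it is recorded here in order to have the quotient as an object. -/
def FeynmanSub (G : Graph) : Type := {P : G.Part // P.toGraph.IsFeynman ∧ P.contract.IsFeynman}

theorem FeynmanSub.finite (G : Graph) : Finite G.FeynmanSub := by
  have := G.finiteV
  have := G.finiteH
  refine Finite.of_injective (fun P : G.FeynmanSub => (P.1.verts, P.1.adj)) ?_
  rintro ⟨⟨a, b, _⟩, _⟩ ⟨⟨c, d, _⟩, _⟩ h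
  cases h
  rfl

end Graph

/-- The category of labeled Feynman graphs. The subobjects of `Γ` are its Feynman subgraphs `γ`,
the quotients are the contractions `Γ/γ`. Labels of half-edges are ignored by isomorphisms and are
not recorded. -/
def LFG : HallData where
  Obj := {G : Graph // G.IsFeynman}
  iso := Graph.isoSetoid.comap Subtype.val
  zero := ⟨Graph.empty, Graph.empty_isFeynman⟩
  sum := fun G K => ⟨G.1.sum K.1, Graph.sum_isFeynman G.2 K.2⟩
  Sub := fun G => G.1.FeynmanSub
  subFinite := fun G => Graph.FeynmanSub.finite G.1
  sub := fun _ P => ⟨P.1.toGraph, P.2.1⟩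
  quot := fun _ P => ⟨P.1.contract, P.2.2⟩

end HallCK

namespace HallCK

namespace HallData

/-! ### Graded Hall data -/

/-! Once `H_C` is identified with `U(n)`, the module statements are formal. The transpose is an
involutive anti-automorphism with `X ↦ -X`, so `(X × f)ᵗ = fᵗ × (-X)`: it carries left
multiplication to the twisted right multiplication. Composition with its inverse gives the
isomorphism of duals, provided that the span of the functionals `φ_A` is preserved. It is, because
the transpose commutes with the automorphism that scales degree `d` by `2 ^ d`, hence preserves
degrees, and each degree contains finitely many classes (`hallTranspose_delta_apply`).

The substance is `toHall_bijective`, a Milnor-Moore theorem proved by hand. `IsGraded` collects what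
is needed of the category: a commutative monoid of classes with a degree of finite fibres; flags of
subobjects matched with subobjects of quotients (associativity); subobjects of a sum as pairs
(compatibility of product and coproduct); a unique zero subobject and a unique subobject with zero
quotient (unit, leading terms). On the associated graded of the coradical filtration, functions
behave like polynomials in the indecomposable classes `T`, and the translation `f ↦ f(T ⊕ ·)` like
the partial derivative in the variable `δ_T`. Euler's formula `∑ x_T ∂_T f = k f` expresses `f`
through products of primitive elements up to lower terms (`euler_sub_smul_mem`, `corad_le_map`).
Iterating the Euler operator with values in `U(n)`, and dividing by `k!`, gives `symm`, which
inverts `toHall` up to shorter products (`symm_toHall_sub_mem`).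

It remains to check `IsGraded`. For forests an admissible cut is the same as a set of vertices
closed under descendants, and flags are nested pairs of such sets. For Feynman graphs everything is
encoded by two relations on one fixed set of half-edges (`Diagram`), so that contractions live on
the same set and `(X/Z)/(Y/Z) = X/Y` is an equality (`contract_contract`). The difficulty is the
removal of components with two legs, which joins edges into threads. Threads are deterministic
because adjacency is a matching; irreducibility keeps them from ending inside the contracted part,
and the presence of legs keeps them from closing up. Irreducibility of contractions is proved by
lifting sets of half-edges to the original graph (`liftSet_boundary`), and `insertion` inverts `Y ↦
Y/Z`. -/

noncomputable instance (C : HallData) (M : C.Obj) : Fintype (C.Sub M) :=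
  @Fintype.ofFinite _ (C.subFinite M)

/-- The properties of a category that make its Ringel-Hall algebra a graded connected cocommutative
bialgebra. -/
structure IsGraded (C : HallData) [AddCommMonoid C.Iso] (deg : C.Iso →+ ℕ) : Prop where
  cls_zero : C.cls C.zero = 0
  cls_sum : ∀ M N, C.cls (C.sum M N) = C.cls M + C.cls N
  finite_deg : ∀ d, {A : C.Iso | deg A = d}.Finite
  eq_zero : ∀ A, deg A = 0 → A = 0
  deg_sub : ∀ M (N : C.Sub M), deg (C.cls (C.sub M N)) + deg (C.cls (C.quot M N)) = deg (C.cls M)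
  sub_congr : ∀ M M', C.cls M = C.cls M' → ∃ e : C.Sub M ≃ C.Sub M', ∀ N,
    C.cls (C.sub M N) = C.cls (C.sub M' (e N)) ∧ C.cls (C.quot M N) = C.cls (C.quot M' (e N))
  sub_sub : ∀ M, ∃ e : (Σ N : C.Sub M, C.Sub (C.sub M N)) ≃ Σ N : C.Sub M, C.Sub (C.quot M N),
    ∀ p, C.cls (C.sub _ p.2) = C.cls (C.sub M (e p).1) ∧
      C.cls (C.quot _ p.2) = C.cls (C.sub _ (e p).2) ∧
      C.cls (C.quot M p.1) = C.cls (C.quot _ (e p).2)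
  sub_sum : ∀ M M', ∃ e : C.Sub (C.sum M M') ≃ C.Sub M × C.Sub M', ∀ N,
    C.cls (C.sub _ N) = C.cls (C.sub _ (e N).1) + C.cls (C.sub _ (e N).2) ∧
      C.cls (C.quot _ N) = C.cls (C.quot _ (e N).1) + C.cls (C.quot _ (e N).2)
  sub_bot : ∀ M, ∃ N₀ : C.Sub M, C.cls (C.sub M N₀) = 0 ∧ C.cls (C.quot M N₀) = C.cls M ∧
    ∀ N, C.cls (C.sub M N) = 0 → N = N₀
  sub_top : ∀ M, ∃ N₀ : C.Sub M, C.cls (C.quot M N₀) = 0 ∧ C.cls (C.sub M N₀) = C.cls M ∧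
    ∀ N, C.cls (C.quot M N) = 0 → N = N₀

variable {C : HallData}

theorem cls_out (A : C.Iso) : C.cls (Quotient.out A) = A := Quotient.out_eq A

theorem exists_cls (A : C.Iso) : ∃ M, C.cls M = A := ⟨_, cls_out A⟩

/-- The sum of `F N (A/N)` over the subobjects `N` of `A`. -/
noncomputable def conv (F : C.Iso → C.Iso → ℚ) (A : C.Iso) : ℚ :=
  ∑ N : C.Sub (Quotient.out A), F (C.cls (C.sub _ N)) (C.cls (C.quot _ N))

theorem conv_add_fun (F G : C.Iso → C.Iso → ℚ) (A : C.Iso) :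
    conv (fun a b => F a b + G a b) A = conv F A + conv G A :=
  Finset.sum_add_distrib

theorem mul_conv (c : ℚ) (F : C.Iso → C.Iso → ℚ) (A : C.Iso) :
    c * conv F A = conv (fun a b => c * F a b) A :=
  Finset.mul_sum _ _ _

theorem conv_mul (c : ℚ) (F : C.Iso → C.Iso → ℚ) (A : C.Iso) :
    conv F A * c = conv (fun a b => F a b * c) A :=
  Finset.sum_mul _ _ _

namespace IsGraded

variable [AddCommMonoid C.Iso] {deg : C.Iso →+ ℕ} (h : C.IsGraded deg)
include h

theorem conv_cls (F : C.Iso → C.Iso → ℚ) (M : C.Obj) :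
    conv F (C.cls M) = ∑ N : C.Sub M, F (C.cls (C.sub _ N)) (C.cls (C.quot _ N)) := by
  obtain ⟨e, he⟩ := h.sub_congr _ M (cls_out (C.cls M))
  exact Fintype.sum_equiv e _ _ fun N => by rw [(he N).1, (he N).2]

theorem conv_congr {F G : C.Iso → C.Iso → ℚ} {A : C.Iso}
    (hFG : ∀ a b, deg a + deg b = deg A → F a b = G a b) : conv F A = conv G A := by
  refine Finset.sum_congr rfl fun N _ => hFG _ _ ?_
  rw [h.deg_sub, cls_out]

/-- Both iterated sums run over two-step flags in the same object, matched by `sub_sub`. -/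
theorem conv_assoc (F : C.Iso → C.Iso → C.Iso → ℚ) (A : C.Iso) :
    conv (fun p c => conv (fun a b => F a b c) p) A =
      conv (fun a q => conv (fun b c => F a b c) q) A := by
  obtain ⟨M, rfl⟩ := exists_cls A
  obtain ⟨e, he⟩ := h.sub_sub M
  simp only [h.conv_cls]
  rw [← Fintype.sum_sigma', ← Fintype.sum_sigma']
  exact Fintype.sum_equiv e _ _ fun p => by rw [(he p).1, (he p).2.1, (he p).2.2]

/-- Subobjects of a direct sum are pairs of subobjects. This is the compatibility of the product
with the coproduct, and the only place where `sub_sum` enters. -/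
theorem conv_add (F : C.Iso → C.Iso → ℚ) (A B : C.Iso) :
    conv F (A + B) = conv (fun a c => conv (fun b d => F (a + b) (c + d)) B) A := by
  obtain ⟨M, rfl⟩ := exists_cls A
  obtain ⟨M', rfl⟩ := exists_cls B
  obtain ⟨e, he⟩ := h.sub_sum M M'
  rw [← h.cls_sum]
  simp only [h.conv_cls]
  rw [← Fintype.sum_prod_type']
  exact Fintype.sum_equiv e _ _ fun p => by rw [(he p).1, (he p).2]

theorem conv_zero_left (F : C.Iso → C.Iso → ℚ) (A : C.Iso) (hF : ∀ a b, a ≠ 0 → F a b = 0) :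
    conv F A = F 0 A := by
  obtain ⟨M, rfl⟩ := exists_cls A
  obtain ⟨N₀, h1, h2, h3⟩ := h.sub_bot M
  rw [h.conv_cls, Fintype.sum_eq_single N₀ fun N hN => hF _ _ fun h0 => hN (h3 N h0), h1, h2]

theorem conv_zero_right (F : C.Iso → C.Iso → ℚ) (A : C.Iso) (hF : ∀ a b, b ≠ 0 → F a b = 0) :
    conv F A = F A 0 := by
  obtain ⟨M, rfl⟩ := exists_cls A
  obtain ⟨N₀, h1, h2, h3⟩ := h.sub_top M
  rw [h.conv_cls, Fintype.sum_eq_single N₀ fun N hN => hF _ _ fun h0 => hN (h3 N h0), h1, h2]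

theorem deltaZero_eq [DecidableEq C.Iso] (A : C.Iso) :
    C.deltaZero A = if A = 0 then 1 else 0 := by
  simp only [deltaZero, h.cls_zero]

theorem deltaZero_of_ne {A : C.Iso} (hA : A ≠ 0) : C.deltaZero A = 0 := by
  classical simp [h.deltaZero_eq, hA]

theorem deltaZero_zero : C.deltaZero (0 : C.Iso) = 1 := by
  classical simp [h.deltaZero_eq]

theorem finite_deg_le (d : ℕ) : {A : C.Iso | deg A ≤ d}.Finite := by
  have : {A : C.Iso | deg A ≤ d} = ⋃ i ∈ Set.Iic d, {A | deg A = i} := by ext; simp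
  rw [this]
  exact (Set.finite_Iic d).biUnion fun i _ => h.finite_deg i

omit h in
theorem exists_deg_bound (deg : C.Iso →+ ℕ) (f : C.Hall) : ∃ d, ∀ A, f A ≠ 0 → deg A ≤ d := by
  refine ⟨(show C.Iso →₀ ℚ from f).support.sup deg, fun A hA => ?_⟩
  exact Finset.le_sup (f := deg) (Finsupp.mem_support_iff.2 hA)

/-- A function that vanishes in large degrees, as an element of `C.Hall`. -/
noncomputable def ofBounded (f : C.Iso → ℚ) (d : ℕ) (hf : ∀ A, f A ≠ 0 → deg A ≤ d) : C.Hall :=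
  Finsupp.ofSupportFinite f ((h.finite_deg_le d).subset hf)

@[simp]
theorem ofBounded_apply (f : C.Iso → ℚ) (d : ℕ) (hf : ∀ A, f A ≠ 0 → deg A ≤ d) (A : C.Iso) :
    h.ofBounded f d hf A = f A := rfl

/-- Degrees of subobject and quotient add up, so the product vanishes above the sum of the two
degree bounds, and finitely many classes remain. -/
theorem exists_mul (f g : C.Hall) :
    ∃ k : C.Hall, ∀ A, k A = conv (fun a b => f a * g b) A := by
  obtain ⟨d, hd⟩ := exists_deg_bound deg f
  obtain ⟨e, he⟩ := exists_deg_bound deg g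
  refine ⟨h.ofBounded (conv fun a b => f a * g b) (d + e) fun A hA => ?_, fun A => rfl⟩
  by_contra hlt
  refine hA ((h.conv_congr (G := fun _ _ => 0) fun a b hab => ?_).trans (by simp [conv]))
  by_contra hne
  have := hd a (left_ne_zero_of_mul hne)
  have := he b (right_ne_zero_of_mul hne)
  omega

/-- The product of the Ringel-Hall algebra. -/
noncomputable def hallMul (f g : C.Hall) : C.Hall := (h.exists_mul f g).choose

theorem hallMul_apply (f g : C.Hall) (A : C.Iso) :
    h.hallMul f g A = conv (fun a b => f a * g b) A := (h.exists_mul f g).choose_spec A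

omit [AddCommMonoid C.Iso] h in
theorem hall_ext {f g : C.Hall} (hfg : ∀ A, f A = g A) : f = g := DFunLike.ext _ _ hfg

/-- The unit of the Ringel-Hall algebra. -/
noncomputable def hallOne : C.Hall :=
  h.ofBounded C.deltaZero 0 fun A hA => by
    by_contra h0
    exact hA (h.deltaZero_of_ne fun h => h0 (by simp [h]))

/-- The Ringel-Hall algebra of graded Hall data is a ring. -/
noncomputable abbrev hallRing : Ring C.Hall :=
  let _ : AddCommGroup C.Hall := inferInstanceAs (AddCommGroup (C.Iso →₀ ℚ))
  have add_apply (f g : C.Hall) (A : C.Iso) : (f + g) A = f A + g A := Finsupp.add_apply _ _ _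
  { (inferInstanceAs (AddCommGroup (C.Iso →₀ ℚ)) : AddCommGroup C.Hall) with
    mul := h.hallMul
    one := h.hallOne
    zero_mul := fun f => hall_ext fun A => (h.hallMul_apply _ _ A).trans <| by
      change conv (fun a b => (0 : ℚ) * _) A = 0
      simp [conv]
    mul_zero := fun f => hall_ext fun A => (h.hallMul_apply _ _ A).trans <| by
      change conv (fun a b => _ * (0 : ℚ)) A = 0
      simp [conv]
    one_mul := fun f => hall_ext fun A => (h.hallMul_apply _ _ A).trans <| by
      rw [h.conv_zero_left]
      · change C.deltaZero 0 * _ = _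
        rw [h.deltaZero_zero, one_mul]
      · intro a b ha
        change C.deltaZero a * _ = _
        rw [h.deltaZero_of_ne ha, zero_mul]
    mul_one := fun f => hall_ext fun A => (h.hallMul_apply _ _ A).trans <| by
      rw [h.conv_zero_right]
      · change _ * C.deltaZero 0 = _
        rw [h.deltaZero_zero, mul_one]
      · intro a b ha
        change _ * C.deltaZero b = _
        rw [h.deltaZero_of_ne ha, mul_zero]
    mul_assoc := fun f g k => hall_ext fun A => by
      change h.hallMul (h.hallMul f g) k A = h.hallMul f (h.hallMul g k) A
      simp only [hallMul_apply, conv_mul, mul_conv, h.conv_assoc, mul_assoc]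
    left_distrib := fun f g k => hall_ext fun A => by
      rw [add_apply]
      change h.hallMul f (g + k) A = h.hallMul f g A + h.hallMul f k A
      simp only [hallMul_apply, add_apply, mul_add, conv_add_fun]
    right_distrib := fun f g k => hall_ext fun A => by
      rw [add_apply]
      change h.hallMul (f + g) k A = h.hallMul f k A + h.hallMul g k A
      simp only [hallMul_apply, add_apply, add_mul, conv_add_fun] }

/-- The Ringel-Hall algebra of graded Hall data is a `ℚ`-algebra. -/
noncomputable abbrev hallAlgebra : @Algebra ℚ C.Hall _ h.hallRing.toSemiring :=
  let _ := h.hallRing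
  let _ : Module ℚ C.Hall := inferInstanceAs (Module ℚ (C.Iso →₀ ℚ))
  have smul_apply (c : ℚ) (f : C.Hall) (A : C.Iso) : (c • f) A = c * f A :=
    Finsupp.smul_apply _ _ _
  Algebra.ofModule
    (fun c f g => hall_ext fun A => by
      rw [smul_apply]
      change h.hallMul (c • f) g A = c * h.hallMul f g A
      simp only [hallMul_apply, smul_apply, mul_conv, mul_assoc])
    (fun c f g => hall_ext fun A => by
      rw [smul_apply]
      change h.hallMul f (c • g) A = c * h.hallMul f g A
      simp only [hallMul_apply, smul_apply, mul_conv, mul_left_comm])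

theorem isHallAlgebra :
    @IsHallAlgebra C h.hallRing h.hallAlgebra :=
  let _ := h.hallRing
  let _ := h.hallAlgebra
  { add_apply := fun _ _ _ => Finsupp.add_apply _ _ _
    smul_apply := fun _ _ _ => Finsupp.smul_apply _ _ _
    one_apply := fun _ => rfl
    mul_apply := fun f g M => by
      rw [finsum_eq_sum_of_fintype]
      exact (h.hallMul_apply f g _).trans (h.conv_cls _ M) }

end IsGraded

end HallData

/-! ### Indicator functions, evaluations and translations -/

namespace HallData

variable {C : HallData}

/-- The indicator function of an isomorphism class. -/
noncomputable def delta (A : C.Iso) : C.Hall := (Finsupp.single A 1 : C.Iso →₀ ℚ)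

theorem delta_apply [DecidableEq C.Iso] (A B : C.Iso) :
    (delta A : C.Hall) B = if A = B then 1 else 0 :=
  Finsupp.single_apply

namespace IsHallAlgebra

variable [Ring C.Hall] [Algebra ℚ C.Hall] (H : C.IsHallAlgebra)

/-- Evaluation at an isomorphism class. -/
def eval (A : C.Iso) : C.Hall →ₗ[ℚ] ℚ where
  toFun f := f A
  map_add' f g := H.add_apply f g A
  map_smul' c f := H.smul_apply c f A

include H

theorem zero_apply (A : C.Iso) : (0 : C.Hall) A = 0 := (H.eval A).map_zero

theorem sub_apply (f g : C.Hall) (A : C.Iso) : (f - g) A = f A - g A := (H.eval A).map_sub f g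

theorem sum_apply {ι : Type*} (s : Finset ι) (f : ι → C.Hall) (A : C.Iso) :
    (∑ i ∈ s, f i) A = ∑ i ∈ s, f i A := map_sum (H.eval A) f s

theorem eq_sum_delta (f : C.Hall) :
    f = ∑ A ∈ (show C.Iso →₀ ℚ from f).support, f A • (delta A : C.Hall) := by
  classical
  refine IsGraded.hall_ext fun B => ?_
  simp only [H.sum_apply, H.smul_apply, delta_apply, mul_ite, mul_one, mul_zero,
    Finset.sum_ite_eq']
  split_ifs with hB
  · rfl
  · exact Finsupp.notMem_support_iff.1 hB

theorem hom_ext {M : Type*} [AddCommGroup M] [Module ℚ M] {φ ψ : C.Hall →ₗ[ℚ] M}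
    (hφ : ∀ A, φ (delta A) = ψ (delta A)) : φ = ψ := by
  ext f
  rw [H.eq_sum_delta f]
  simp [hφ]

end IsHallAlgebra

namespace IsGraded

variable [AddCommMonoid C.Iso] {deg : C.Iso →+ ℕ} (h : C.IsGraded deg)
variable [Ring C.Hall] [Algebra ℚ C.Hall] (H : C.IsHallAlgebra)

include h H in
theorem mul_apply (f g : C.Hall) (A : C.Iso) : (f * g) A = conv (fun a b => f a * g b) A := by
  obtain ⟨M, rfl⟩ := exists_cls A
  rw [H.mul_apply, finsum_eq_sum_of_fintype, h.conv_cls]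

/-! ### Translations -/

/-- The translation `f ↦ f(A ⊕ ·)`. -/
noncomputable def shift (A : C.Iso) : C.Hall →ₗ[ℚ] C.Hall where
  toFun f := h.ofBounded (fun B => f (A + B)) (exists_deg_bound deg f).choose fun B hB => by
    have := (exists_deg_bound deg f).choose_spec _ hB
    rw [map_add] at this
    omega
  map_add' f g := hall_ext fun B => by
    rw [H.add_apply]
    exact H.add_apply f g _
  map_smul' c f := hall_ext fun B => by
    rw [H.smul_apply]
    exact H.smul_apply c f _

@[simp]
theorem shift_apply (A B : C.Iso) (f : C.Hall) : h.shift H A f B = f (A + B) := rfl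

theorem shift_zero (f : C.Hall) : h.shift H 0 f = f := hall_ext fun B => by simp

theorem shift_shift (A B : C.Iso) (f : C.Hall) :
    h.shift H A (h.shift H B f) = h.shift H (A + B) f := hall_ext fun D => by
  simp only [shift_apply]
  congr 1
  abel

theorem shift_comm (A B : C.Iso) (f : C.Hall) :
    h.shift H A (h.shift H B f) = h.shift H B (h.shift H A f) := by
  rw [shift_shift, shift_shift, add_comm]

/-- A translate by a class of degree above the support of `f` vanishes. All sums over classes `T`
below are finite for this reason. -/
theorem exists_finset (f : C.Hall) : ∃ F : Finset C.Iso, ∀ T ∉ F, h.shift H T f = 0 := by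
  obtain ⟨d, hd⟩ := exists_deg_bound deg f
  refine ⟨(h.finite_deg_le d).toFinset, fun T hT => hall_ext fun B => ?_⟩
  rw [H.zero_apply, shift_apply]
  by_contra h0
  have := hd _ h0
  rw [map_add] at this
  simp at hT
  omega

include h in
omit [Ring C.Hall] [Algebra ℚ C.Hall] in
theorem isPrimitive_iff (X : C.Hall) : C.IsPrimitive X ↔
    ∀ A B : C.Iso, X (A + B) = X A * C.deltaZero B + C.deltaZero A * X B := by
  constructor
  · intro hX A B
    obtain ⟨M, rfl⟩ := exists_cls A
    obtain ⟨N, rfl⟩ := exists_cls B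
    rw [← h.cls_sum]
    exact hX M N
  · intro hX M N
    rw [h.cls_sum]
    exact hX _ _

include h H in
-- Since `X` is primitive, a pair of subobjects of `A` and `B` contributes only if one of them is
-- zero. Left multiplication by `X` is thus a coderivation.
theorem mul_add_apply {X : C.Hall} (hX : C.IsPrimitive X) (f : C.Hall) (A B : C.Iso) :
    (X * f) (A + B) = conv (fun a c => X a * f (c + B)) A + conv (fun b d => X b * f (A + d)) B := by
  rw [h.isPrimitive_iff] at hX
  rw [h.mul_apply H, h.conv_add]
  simp only [hX, add_mul, conv_add_fun]
  congr 1
  · congr 1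
    ext a c
    rw [h.conv_zero_left, h.deltaZero_zero, mul_one]
    intro b d hb
    simp [h.deltaZero_of_ne hb]
  · simp only [mul_assoc, ← mul_conv]
    rw [h.conv_zero_left, h.deltaZero_zero, one_mul]
    intro a c ha
    simp [h.deltaZero_of_ne ha]

include h in
omit [Ring C.Hall] [Algebra ℚ C.Hall] in
theorem conv_mul_deltaZero (f : C.Iso → ℚ) (A : C.Iso) :
    conv (fun a c => f a * C.deltaZero c) A = f A := by
  rw [h.conv_zero_right, h.deltaZero_zero, mul_one]
  intro a b hb
  simp [h.deltaZero_of_ne hb]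

include h H in
-- The mixed terms `X A * Y B + X B * Y A` are symmetric in `X` and `Y`, so they cancel in the
-- commutator.
theorem primitive_mul_apply {X Y : C.Hall} (hX : C.IsPrimitive X) (hY : C.IsPrimitive Y)
    (A B : C.Iso) : (X * Y) (A + B) =
      (X * Y) A * C.deltaZero B + X A * Y B + (X B * Y A + C.deltaZero A * (X * Y) B) := by
  rw [h.mul_add_apply H hX]
  rw [h.isPrimitive_iff] at hX hY
  simp only [hY, mul_add, conv_add_fun, h.mul_apply H, ← mul_assoc, ← conv_mul]
  rw [h.conv_mul_deltaZero X, h.conv_mul_deltaZero fun a => X a * Y A]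
  congr 2
  rw [mul_conv]
  congr 1
  ext a b
  ring

/-- The primitive elements form a Lie subalgebra. -/
def primitives : LieSubalgebra ℚ C.Hall where
  carrier := {X | C.IsPrimitive X}
  add_mem' := fun {X Y} hX hY => (h.isPrimitive_iff _).2 fun A B => by
    replace hX := (h.isPrimitive_iff X).1 hX
    replace hY := (h.isPrimitive_iff Y).1 hY
    simp only [H.add_apply, hX, hY]
    ring
  zero_mem' := (h.isPrimitive_iff _).2 fun A B => by simp [H.zero_apply]
  smul_mem' := fun c X hX => (h.isPrimitive_iff _).2 fun A B => by
    replace hX := (h.isPrimitive_iff X).1 hX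
    simp only [H.smul_apply, hX]
    ring
  lie_mem' := fun {X Y} hX hY => (h.isPrimitive_iff _).2 fun A B => by
    rw [LieRing.of_associative_ring_bracket]
    simp only [H.sub_apply, h.primitive_mul_apply H hX hY, h.primitive_mul_apply H hY hX]
    ring

/-! ### The coradical filtration -/

/-- The functions that vanish on all sums of at least `k` nonzero objects. -/
noncomputable def corad : ℕ → Submodule ℚ C.Hall
  | 0 => ⊥
  | k + 1 => ⨅ (A : C.Iso) (_ : A ≠ 0), (corad k).comap (h.shift H A)

theorem mem_corad_succ {k : ℕ} {f : C.Hall} :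
    f ∈ h.corad H (k + 1) ↔ ∀ A ≠ 0, h.shift H A f ∈ h.corad H k := by
  simp [corad]

theorem corad_mono_succ (k : ℕ) : h.corad H k ≤ h.corad H (k + 1) := by
  induction k with
  | zero => simp [corad]
  | succ k ih =>
    exact fun f hf => (h.mem_corad_succ H).2 fun A hA => ih ((h.mem_corad_succ H).1 hf A hA)

theorem shift_mem_corad {k : ℕ} {f : C.Hall} (hf : f ∈ h.corad H k) (A : C.Iso) :
    h.shift H A f ∈ h.corad H k := by
  by_cases hA : A = 0
  · rwa [hA, shift_zero]
  · exact (h.mem_corad_succ H).1 (h.corad_mono_succ H k hf) A hA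

/-- Nonzero classes have positive degree, so a sum of `d` of them has degree at least `d`. Hence the
coradical filtration is exhaustive. -/
theorem mem_corad_of_bound {d : ℕ} {f : C.Hall} (hf : ∀ A, f A ≠ 0 → deg A < d) :
    f ∈ h.corad H d := by
  induction d generalizing f with
  | zero =>
    have : f = 0 := hall_ext fun A => by
      rw [H.zero_apply]
      by_contra h0
      exact absurd (hf A h0) (by omega)
    rw [this]
    exact zero_mem _
  | succ d ih =>
    refine (h.mem_corad_succ H).2 fun A hA => ih fun B hB => ?_
    have h1 := hf _ hB
    have h2 : deg A ≠ 0 := fun h0 => hA (h.eq_zero A h0)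
    rw [map_add] at h1
    omega

theorem exists_mem_corad (f : C.Hall) : ∃ k, f ∈ h.corad H k := by
  obtain ⟨d, hd⟩ := exists_deg_bound deg f
  exact ⟨d + 1, h.mem_corad_of_bound H fun A hA => Nat.lt_succ_of_le (hd A hA)⟩

theorem one_mem_corad : (1 : C.Hall) ∈ h.corad H 1 := by
  refine (h.mem_corad_succ H).2 fun A hA => ?_
  have : h.shift H A (1 : C.Hall) = 0 := hall_ext fun B => by
    rw [H.zero_apply, shift_apply, H.one_apply, h.deltaZero_of_ne]
    intro h0
    refine hA (h.eq_zero A ?_)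
    have := congrArg deg h0
    rw [map_add, map_zero] at this
    omega
  rw [this]
  exact zero_mem _

theorem corad_one_eq {f : C.Hall} (hf : f ∈ h.corad H 1) : f = f 0 • (1 : C.Hall) := by
  refine hall_ext fun A => ?_
  rw [H.smul_apply, H.one_apply]
  by_cases hA : A = 0
  · rw [hA, h.deltaZero_zero, mul_one]
  · have h1 : h.shift H A f = 0 := (h.mem_corad_succ H).1 hf A hA
    rw [h.deltaZero_of_ne hA, mul_zero]
    have h2 : h.shift H A f 0 = 0 := by rw [h1, H.zero_apply]
    simpa using h2

/-- The Leibniz rule for translations: either the subobject avoids `M`, or it lies in `M` and leaves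
the quotient behind as a smaller translation. -/
theorem shift_mul {X : C.Hall} (hX : C.IsPrimitive X) (f : C.Hall) (M : C.Obj) :
    h.shift H (C.cls M) (X * f) = X * h.shift H (C.cls M) f +
      ∑ N : C.Sub M, X (C.cls (C.sub M N)) • h.shift H (C.cls (C.quot M N)) f := by
  refine hall_ext fun B => ?_
  simp only [shift_apply, h.mul_add_apply H hX, H.add_apply, h.mul_apply H, H.sum_apply,
    H.smul_apply, h.conv_cls]
  exact add_comm _ _

/-- In the Leibniz rule one term is a product with a function one level lower, and the others are
multiples of translates of `f`, which stay at the level of `f`. -/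
theorem mul_mem_corad {X : C.Hall} (hX : C.IsPrimitive X) {k : ℕ} {f : C.Hall}
    (hf : f ∈ h.corad H k) : X * f ∈ h.corad H (k + 1) := by
  induction k generalizing f with
  | zero =>
    have : f = 0 := hf
    simp [this]
  | succ k ih =>
    refine (h.mem_corad_succ H).2 fun A hA => ?_
    obtain ⟨M, rfl⟩ := exists_cls A
    rw [h.shift_mul H hX]
    exact add_mem (ih ((h.mem_corad_succ H).1 hf _ hA))
      (sum_mem fun N _ => Submodule.smul_mem _ _ (h.shift_mem_corad H hf _))

/-- Among the terms of `shift_mul` only the full subobject leaves `f` untranslated; every other one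
translates by a nonzero quotient and drops a level. Modulo lower terms, translation is therefore a
derivation that sends `X` to the scalar `X A`. -/
theorem shift_mul_congr {X : C.Hall} (hX : C.IsPrimitive X) {k : ℕ} {f : C.Hall}
    (hf : f ∈ h.corad H (k + 1)) (A : C.Iso) :
    h.shift H A (X * f) - (X A • f + X * h.shift H A f) ∈ h.corad H k := by
  classical
  obtain ⟨M, rfl⟩ := exists_cls A
  obtain ⟨N₀, h1, h2, h3⟩ := h.sub_top M
  rw [h.shift_mul H hX, ← Finset.add_sum_erase _ _ (Finset.mem_univ N₀), h1, h2, shift_zero]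
  rw [show ∀ a b c : C.Hall, a + (b + c) - (b + a) = c from fun a b c => by abel]
  exact sum_mem fun N hN => Submodule.smul_mem _ _
    ((h.mem_corad_succ H).1 hf _ fun h0 => Finset.ne_of_mem_erase hN (h3 N h0))

/-- The sum `∑ g T (f(T ⊕ ·))` over all isomorphism classes `T`. -/
noncomputable def shiftSum {M : Type*} [AddCommGroup M] [Module ℚ M]
    (g : C.Iso → C.Hall →ₗ[ℚ] M) : C.Hall →ₗ[ℚ] M :=
  have fin (f : C.Hall) : (Function.support fun T => g T (h.shift H T f)).Finite := by
    obtain ⟨F, hF⟩ := h.exists_finset H f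
    refine F.finite_toSet.subset fun T hT => ?_
    by_contra h0
    exact hT (by simp [hF T h0])
  { toFun := fun f => ∑ᶠ T, g T (h.shift H T f)
    map_add' := fun f f' => by
      simp only [map_add]
      exact finsum_add_distrib (fin f) (fin f')
    map_smul' := fun c f => by
      simp only [map_smul, RingHom.id_apply]
      exact (smul_finsum' c (fin f)).symm }

theorem shiftSum_eq {M : Type*} [AddCommGroup M] [Module ℚ M] (g : C.Iso → C.Hall →ₗ[ℚ] M)
    {f : C.Hall} {F : Finset C.Iso} (hF : ∀ T ∉ F, h.shift H T f = 0) :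
    h.shiftSum H g f = ∑ T ∈ F, g T (h.shift H T f) := by
  refine finsum_eq_sum_of_support_subset _ fun T hT => ?_
  by_contra h0
  exact hT (by simp [hF T h0])

end IsGraded

end HallData

/-! ### Induction in enveloping algebras -/

open UniversalEnvelopingAlgebra in
-- The elements that preserve `P` under left multiplication form a subalgebra `S` containing the
-- generators. By the universal property the identity factors through `S`, so `S` is everything, and
-- it is applied to `1 ∈ P`.
theorem envelopingAlgebra_induction {L : Type*} [LieRing L] [LieAlgebra ℚ L]
    (P : Submodule ℚ (UniversalEnvelopingAlgebra ℚ L)) (h1 : 1 ∈ P)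
    (hP : ∀ (X : L), ∀ u ∈ P, ι ℚ X * u ∈ P) (u : UniversalEnvelopingAlgebra ℚ L) : u ∈ P := by
  let S : Subalgebra ℚ (UniversalEnvelopingAlgebra ℚ L) :=
    { carrier := {a | ∀ u ∈ P, a * u ∈ P}
      mul_mem' := fun {a b} ha hb u hu => by
        rw [mul_assoc]
        exact ha _ (hb _ hu)
      add_mem' := fun {a b} ha hb u hu => by
        rw [add_mul]
        exact add_mem (ha _ hu) (hb _ hu)
      algebraMap_mem' := fun r u hu => by
        rw [← Algebra.smul_def]
        exact P.smul_mem r hu }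
  let f : L →ₗ⁅ℚ⁆ S :=
    { toFun := fun X => ⟨ι ℚ X, hP X⟩
      map_add' := fun X Y => Subtype.ext (map_add (ι ℚ) X Y)
      map_smul' := fun c X => Subtype.ext (map_smul (ι ℚ) c X)
      map_lie' := fun {X Y} => Subtype.ext (LieHom.map_lie (ι ℚ) X Y) }
  have key : S.val.comp (lift ℚ f) = AlgHom.id ℚ (UniversalEnvelopingAlgebra ℚ L) := by
    refine UniversalEnvelopingAlgebra.hom_ext ℚ ?_
    ext X
    simp only [LieHom.coe_comp, Function.comp_apply, AlgHom.coe_toLieHom, AlgHom.coe_comp,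
      AlgHom.coe_id, id_eq]
    rw [lift_ι_apply]
    rfl
  have hu : u ∈ S := by
    have := DFunLike.congr_fun key u
    simp only [AlgHom.coe_comp, Function.comp_apply, AlgHom.coe_id, id_eq] at this
    rw [← this]
    exact (lift ℚ f u).2
  simpa using hu 1 h1

namespace HallData.IsGraded

variable {C : HallData}
variable [AddCommMonoid C.Iso] {deg : C.Iso →+ ℕ} (h : C.IsGraded deg)
variable [Ring C.Hall] [Algebra ℚ C.Hall] (H : C.IsHallAlgebra)

/-! ### The enveloping algebra of the primitive elements -/

variable {n : LieSubalgebra ℚ C.Hall} (hn : ∀ X, X ∈ n ↔ C.IsPrimitive X)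

include h in
omit [Ring C.Hall] [Algebra ℚ C.Hall] in
-- Primitivity of `δ_T` means that `T` is nonzero and indecomposable, and a primitive function
-- vanishes at `0` and on sums of two nonzero classes.
theorem delta_isPrimitive {X : C.Hall} (hX : C.IsPrimitive X) {T : C.Iso} (hT : X T ≠ 0) :
    C.IsPrimitive (delta T) := by
  classical
  rw [h.isPrimitive_iff] at hX ⊢
  have h0 : T ≠ 0 := by
    rintro rfl
    have := hX 0 0
    rw [add_zero, h.deltaZero_zero] at this
    exact hT (by linarith)
  intro A B
  by_cases hA : A = 0
  · subst hA
    simp [h.deltaZero_zero, delta_apply, h0]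
  by_cases hB : B = 0
  · subst hB
    simp [h.deltaZero_zero, delta_apply, h0]
  have hne : T ≠ A + B := by
    rintro rfl
    exact hT (by rw [hX, h.deltaZero_of_ne hA, h.deltaZero_of_ne hB]; simp)
  simp [delta_apply, hne, h.deltaZero_of_ne hA, h.deltaZero_of_ne hB]

open Classical in
/-- The indicator function of `T` if it is primitive, and zero otherwise. -/
noncomputable def prim (n : LieSubalgebra ℚ C.Hall) (T : C.Iso) : n :=
  if hT : delta T ∈ n then ⟨delta T, hT⟩ else 0

include h H hn in
-- The indicators of the indecomposable classes span the Lie algebra; they serve as the variables of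
-- the Euler operator.
theorem eq_sum_prim {F : Finset C.Iso} {X : n} (hF : ∀ T ∉ F, (X : C.Hall) T = 0) :
    X = ∑ T ∈ F, (X : C.Hall) T • prim n T := by
  classical
  refine Subtype.ext (hall_ext fun A => ?_)
  have h1 : ∀ T, (((X : C.Hall) T • prim n T : n) : C.Hall) = (X : C.Hall) T • delta T := by
    intro T
    by_cases hT : (X : C.Hall) T = 0
    · rw [hT, zero_smul, zero_smul]
      rfl
    · have := (hn _).2 (h.delta_isPrimitive ((hn _).1 X.2) hT)
      simp [prim, this]
  rw [AddSubmonoidClass.coe_finsetSum]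
  simp only [h1, H.sum_apply, H.smul_apply, delta_apply, mul_ite, mul_one, mul_zero,
    Finset.sum_ite_eq']
  split_ifs with hA
  · rfl
  · exact hF A hA

omit [AddCommMonoid C.Iso] in
theorem prim_cases (n : LieSubalgebra ℚ C.Hall) (T : C.Iso) :
    prim n T = 0 ∨ (prim n T : C.Hall) = delta T := by
  unfold prim
  split_ifs with hT
  · exact Or.inr rfl
  · exact Or.inl rfl

include h hn in
-- This removes `T = 0` from the Euler sums, the one translation that does not lower the coradical
-- level.
theorem prim_zero : prim n (0 : C.Iso) = 0 := by
  classical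
  rcases prim_cases n 0 with h0 | h0
  · exact h0
  have h1 := (h.isPrimitive_iff _).1 ((hn _).1 (prim n (0 : C.Iso)).2) 0 0
  rw [h0] at h1
  simp [delta_apply, h.deltaZero_zero] at h1

variable (n) in
/-- The canonical algebra homomorphism from the enveloping algebra to the Ringel-Hall algebra. -/
noncomputable def toHall : UniversalEnvelopingAlgebra ℚ n →ₐ[ℚ] C.Hall :=
  UniversalEnvelopingAlgebra.lift ℚ n.incl

open UniversalEnvelopingAlgebra

omit [AddCommMonoid C.Iso] in
@[simp]
theorem toHall_ι (X : n) : toHall n (ι ℚ X) = X := lift_ι_apply ℚ n.incl X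

variable (n) in
/-- The span of the products of fewer than `k` elements of the Lie algebra. -/
noncomputable def lenFilt : ℕ → Submodule ℚ (UniversalEnvelopingAlgebra ℚ n)
  | 0 => ⊥
  | k + 1 => Submodule.span ℚ {1} ⊔
      Submodule.span ℚ {u | ∃ (X : n), ∃ v ∈ lenFilt k, u = ι ℚ X * v}

omit [AddCommMonoid C.Iso] in
theorem one_mem_lenFilt (k : ℕ) : 1 ∈ lenFilt n (k + 1) :=
  Submodule.mem_sup_left (Submodule.mem_span_singleton_self 1)

omit [AddCommMonoid C.Iso] in
theorem ι_mul_mem_lenFilt {k : ℕ} (X : n) {v : UniversalEnvelopingAlgebra ℚ n}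
    (hv : v ∈ lenFilt n k) : ι ℚ X * v ∈ lenFilt n (k + 1) :=
  Submodule.mem_sup_right (Submodule.subset_span ⟨X, v, hv, rfl⟩)

omit [AddCommMonoid C.Iso] in
theorem lenFilt_succ_le {k : ℕ} {P : Submodule ℚ (UniversalEnvelopingAlgebra ℚ n)} (h1 : 1 ∈ P)
    (hP : ∀ (X : n), ∀ v ∈ lenFilt n k, ι ℚ X * v ∈ P) : lenFilt n (k + 1) ≤ P := by
  refine sup_le ?_ (Submodule.span_le.2 ?_)
  · rwa [Submodule.span_singleton_le_iff_mem]
  · rintro _ ⟨X, v, hv, rfl⟩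
    exact hP X v hv

omit [AddCommMonoid C.Iso] in
theorem lenFilt_mono_succ (k : ℕ) : lenFilt n k ≤ lenFilt n (k + 1) := by
  induction k with
  | zero => simp [lenFilt]
  | succ k ih =>
    exact lenFilt_succ_le (one_mem_lenFilt _) fun X v hv => ι_mul_mem_lenFilt X (ih hv)

omit [AddCommMonoid C.Iso] in
theorem lenFilt_mono : Monotone (lenFilt n) := monotone_nat_of_le_succ lenFilt_mono_succ

omit [AddCommMonoid C.Iso] in
theorem exists_mem_lenFilt (u : UniversalEnvelopingAlgebra ℚ n) : ∃ k, u ∈ lenFilt n k := by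
  have := envelopingAlgebra_induction (⨆ k, lenFilt n k)
    (Submodule.mem_iSup_of_mem 1 (one_mem_lenFilt 0)) (fun X u hu => by
      rw [Submodule.mem_iSup_of_directed _ lenFilt_mono.directed_le] at hu ⊢
      obtain ⟨k, hk⟩ := hu
      exact ⟨k + 1, ι_mul_mem_lenFilt X hk⟩) u
  rwa [Submodule.mem_iSup_of_directed _ lenFilt_mono.directed_le] at this

include hn in
-- Each primitive factor raises the coradical level by at most one.
theorem toHall_mem_corad {k : ℕ} {u : UniversalEnvelopingAlgebra ℚ n} (hu : u ∈ lenFilt n k) :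
    toHall n u ∈ h.corad H k := by
  induction k generalizing u with
  | zero =>
    have : u = 0 := hu
    simp [this]
  | succ k ih =>
    have hle : lenFilt n (k + 1) ≤ (h.corad H (k + 1)).comap (toHall n).toLinearMap := by
      refine lenFilt_succ_le ?_ fun X v hv => ?_
      · simp only [Submodule.mem_comap, AlgHom.toLinearMap_apply, map_one]
        have hmono : Monotone (h.corad H) := monotone_nat_of_le_succ (h.corad_mono_succ H)
        exact hmono (show 1 ≤ k + 1 by omega) (h.one_mem_corad H)
      · simp only [Submodule.mem_comap, AlgHom.toLinearMap_apply, map_mul, toHall_ι]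
        exact h.mul_mem_corad H ((hn _).1 X.2) (ih hv)
    exact hle hu

/-! #### Surjectivity -/

variable (n) in
/-- The operator `f ↦ ∑ δ_T × f(T ⊕ ·)`, the sum over the classes `T` with primitive `δ_T`. -/
noncomputable def euler : C.Hall →ₗ[ℚ] C.Hall :=
  h.shiftSum H fun T => LinearMap.mulLeft ℚ (prim n T : C.Hall)

include h hn in
theorem delta_not_mem {A : C.Iso} (hA : A ≠ 0) (hAn : delta A ∉ n) :
    ∃ B D, B ≠ 0 ∧ D ≠ 0 ∧ A = B + D := by
  classical
  by_contra! hcon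
  refine hAn ((hn _).2 ((h.isPrimitive_iff _).2 fun B D => ?_))
  by_cases hB : B = 0
  · subst hB
    simp [h.deltaZero_zero, delta_apply, hA]
  by_cases hD : D = 0
  · subst hD
    simp [h.deltaZero_zero, delta_apply, hA]
  simp [delta_apply, hcon B D hB hD, h.deltaZero_of_ne hB, h.deltaZero_of_ne hD]

include hn in
-- Euler's identity for polynomials of degree at most `k`, which is what level `k + 1` amounts to.
-- Membership is tested by translating by `A ≠ 0`; the derivation property modulo lower terms gives
-- one copy of the translate of `f` from differentiating the variable `δ_A`, and the remaining
-- copies by induction.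
theorem euler_sub_smul_mem {k : ℕ} {f : C.Hall} (hf : f ∈ h.corad H (k + 1)) :
    h.euler H n f - (k : ℚ) • f ∈ h.corad H k := by
  classical
  induction k generalizing f with
  | zero =>
    obtain ⟨F, hF⟩ := h.exists_finset H f
    rw [Nat.cast_zero, zero_smul, sub_zero, euler, h.shiftSum_eq H _ hF]
    refine sum_mem fun T _ => ?_
    by_cases hT : T = 0
    · rw [hT, h.prim_zero hn]
      simp
    · have h0 : h.shift H T f = 0 := (h.mem_corad_succ H).1 hf T hT
      simp [h0]
  | succ k ih =>
    refine (h.mem_corad_succ H).2 fun A hA => ?_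
    have hAf := (h.mem_corad_succ H).1 hf A hA
    obtain ⟨F, hF⟩ := h.exists_finset H f
    have hFA : ∀ T ∉ F, h.shift H T (h.shift H A f) = 0 := fun T hT => by
      rw [shift_comm, hF T hT, map_zero]
    have h1 : h.shift H A (h.euler H n f) - (∑ T ∈ F, (prim n T : C.Hall) A • h.shift H T f +
        h.euler H n (h.shift H A f)) ∈ h.corad H k := by
      rw [euler, h.shiftSum_eq H _ hF, h.shiftSum_eq H _ hFA, map_sum, ← Finset.sum_add_distrib,
        ← Finset.sum_sub_distrib]
      refine sum_mem fun T _ => ?_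
      by_cases hT : T = 0
      · rw [hT, h.prim_zero hn]
        simp [H.zero_apply]
      · simp only [LinearMap.mulLeft_apply]
        rw [h.shift_comm H T A]
        exact h.shift_mul_congr H ((hn _).1 (prim n T).2) ((h.mem_corad_succ H).1 hf T hT) A
    -- Differentiating the variables: for indecomposable `A` exactly the term `T = A` survives. For
    -- decomposable `A` no term survives, but then the translate by `A` is itself of lower level.
    have h2 : ∑ T ∈ F, (prim n T : C.Hall) A • h.shift H T f - h.shift H A f ∈ h.corad H k := by
      by_cases hAn : delta A ∈ n
      · have : ∑ T ∈ F, (prim n T : C.Hall) A • h.shift H T f = h.shift H A f := by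
          rw [Finset.sum_eq_single A]
          · have : (prim n A : C.Hall) A = 1 := by simp [prim, hAn, delta_apply]
            rw [this, one_smul]
          · intro T _ hT
            rcases prim_cases n T with h0 | h0
            · simp [h0, H.zero_apply]
            · simp [h0, delta_apply, hT]
          · intro hA'
            rw [hF A hA', smul_zero]
        rw [this, sub_self]
        exact zero_mem _
      · have : ∑ T ∈ F, (prim n T : C.Hall) A • h.shift H T f = 0 := by
          refine Finset.sum_eq_zero fun T _ => ?_
          rcases prim_cases n T with h0 | h0
          · simp [h0, H.zero_apply]
          · have hTA : T ≠ A := by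
              rintro rfl
              exact hAn (h0 ▸ (prim n T).2)
            simp [h0, delta_apply, hTA]
        rw [this, zero_sub, neg_mem_iff]
        obtain ⟨B, D, hB, hD, rfl⟩ := h.delta_not_mem hn hA hAn
        -- Translation by `B + D` is two successive translations by nonzero classes, so it drops two
        -- levels.
        rw [← shift_shift]
        exact (h.mem_corad_succ H).1 ((h.mem_corad_succ H).1 hf D hD) B hB
    have h3 := ih hAf
    have := add_mem (add_mem h1 h2) h3
    convert this using 1
    rw [map_sub, map_smul]
    push_cast
    module

include hn in
-- By Euler's identity `k f` is `euler f` minus a function of lower level, and `euler f` is a sum of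
-- primitive elements times translates that are lifted by induction. Division by `k` needs
-- characteristic zero; the case `k = 0` consists of multiples of the unit.
theorem corad_le_map (k : ℕ) :
    h.corad H k ≤ (lenFilt n k).map (toHall n).toLinearMap := by
  induction k with
  | zero => simp [corad]
  | succ k ih =>
    intro f hf
    rcases Nat.eq_zero_or_pos k with rfl | hk
    · rw [h.corad_one_eq H hf]
      refine Submodule.smul_mem _ _ ⟨1, one_mem_lenFilt 0, by simp⟩
    have h1 : h.euler H n f ∈ (lenFilt n (k + 1)).map (toHall n).toLinearMap := by
      obtain ⟨F, hF⟩ := h.exists_finset H f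
      rw [euler, h.shiftSum_eq H _ hF]
      refine sum_mem fun T _ => ?_
      by_cases hT : T = 0
      · rw [hT, h.prim_zero hn]
        simp
      · obtain ⟨w, hw, hw'⟩ := ih ((h.mem_corad_succ H).1 hf T hT)
        refine ⟨ι ℚ (prim n T) * w, ι_mul_mem_lenFilt _ hw, ?_⟩
        simp only [AlgHom.toLinearMap_apply] at hw'
        rw [AlgHom.toLinearMap_apply, map_mul, toHall_ι, hw', LinearMap.mulLeft_apply]
    have h2 := Submodule.map_mono (lenFilt_mono_succ k) (ih (h.euler_sub_smul_mem H hn hf))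
    have h3 := sub_mem h1 h2
    rw [sub_sub_cancel] at h3
    have hk' : (k : ℚ) ≠ 0 := by positivity
    have := Submodule.smul_mem _ ((k : ℚ)⁻¹) h3
    rwa [smul_smul, inv_mul_cancel₀ hk', one_smul] at this

/-! #### Injectivity -/

variable (n) in
/-- The symmetrization of the part of `f` that lives on the sums of `k` objects. -/
noncomputable def symm : ℕ → C.Hall →ₗ[ℚ] UniversalEnvelopingAlgebra ℚ n
  | 0 => (H.eval 0).smulRight 1
  | k + 1 => ((k + 1 : ℕ) : ℚ)⁻¹ •
      h.shiftSum H fun T => (LinearMap.mulLeft ℚ (ι ℚ (prim n T))).comp (symm k)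

include hn in
theorem symm_eq_zero {k : ℕ} {f : C.Hall} (hf : f ∈ h.corad H k) : h.symm H n k f = 0 := by
  induction k generalizing f with
  | zero =>
    have : f = 0 := hf
    simp [this]
  | succ k ih =>
    obtain ⟨F, hF⟩ := h.exists_finset H f
    rw [symm, LinearMap.smul_apply, h.shiftSum_eq H _ hF, Finset.sum_eq_zero, smul_zero]
    intro T _
    by_cases hT : T = 0
    · rw [hT, h.prim_zero hn]
      simp
    · simp [ih ((h.mem_corad_succ H).1 hf T hT)]

include hn in
-- For `u = X v` and `f` the image of `v`, translating `X f` by `T` gives `X(T) f + X f(T ⊕ ·)` up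
-- to lower terms. The first summands add up to `X v`. In the second, the factor `ι (prim n T)` is
-- moved past `X` at the cost of a commutator, and Euler's formula leaves `k X v`. The total `(k +
-- 1) X v` is cancelled by the factor in `symm`. Strong induction is needed because Euler's formula
-- inside `U(n)` rests on the statement two steps below.
theorem symm_toHall_sub_mem (k : ℕ) : ∀ u ∈ lenFilt n (k + 1),
    h.symm H n k (toHall n u) - u ∈ lenFilt n k := by
  induction k using Nat.strong_induction_on with
  | _ k IH =>
  suffices lenFilt n (k + 1) ≤
      (lenFilt n k).comap ((h.symm H n k).comp (toHall n).toLinearMap - LinearMap.id) from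
    fun u hu => this hu
  rcases k with _ | k
  · refine lenFilt_succ_le ?_ ?_
    · simp [symm, IsHallAlgebra.eval, H.one_apply, h.deltaZero_zero]
    · intro X v hv
      have : v = 0 := hv
      simp [this]
  have IHk := IH k (Nat.lt_succ_self k)
  refine lenFilt_succ_le ?_ fun X v hv => ?_
  · have h1 := h.symm_eq_zero H hn (h.toHall_mem_corad H hn (one_mem_lenFilt (n := n) k))
    simp only [Submodule.mem_comap, LinearMap.sub_apply, LinearMap.comp_apply,
      AlgHom.toLinearMap_apply, LinearMap.id_apply]
    rw [h1, zero_sub, neg_mem_iff]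
    exact one_mem_lenFilt _
  simp only [Submodule.mem_comap, LinearMap.sub_apply, LinearMap.comp_apply,
      AlgHom.toLinearMap_apply, LinearMap.id_apply, map_mul, toHall_ι]
  set f := toHall n v with hf
  have hfk : f ∈ h.corad H (k + 1) := h.toHall_mem_corad H hn hv
  have hXp := (hn _).1 X.2
  -- lifts of the translates of `f`
  have hw : ∀ T, ∃ w ∈ lenFilt n k, T ≠ 0 → toHall n w = h.shift H T f := by
    intro T
    by_cases hT : T = 0
    · exact ⟨0, zero_mem _, fun h0 => absurd hT h0⟩
    · obtain ⟨w, hw, hw'⟩ := h.corad_le_map H hn k ((h.mem_corad_succ H).1 hfk T hT)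
      exact ⟨w, hw, fun _ => hw'⟩
  choose w hwk hwf using hw
  obtain ⟨F₁, hF₁⟩ := h.exists_finset H ((X : C.Hall) * f)
  obtain ⟨F₂, hF₂⟩ := h.exists_finset H f
  obtain ⟨F₃, hF₃⟩ := h.exists_finset H (X : C.Hall)
  classical
  let F := F₁ ∪ F₂ ∪ F₃
  have hFXf : ∀ T ∉ F, h.shift H T ((X : C.Hall) * f) = 0 := fun T hT =>
    hF₁ T fun h0 => hT (by simp [F, h0])
  have hFf : ∀ T ∉ F, h.shift H T f = 0 := fun T hT => hF₂ T fun h0 => hT (by simp [F, h0])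
  have hFX : ∀ T ∉ F, (X : C.Hall) T = 0 := fun T hT => by
    have h1 := hF₃ T fun h0 => hT (by simp [F, h0])
    have h2 : h.shift H T (X : C.Hall) 0 = 0 := by rw [h1, H.zero_apply]
    simpa using h2
  -- Euler's formula in the enveloping algebra
  have hEuler : ∑ T ∈ F, ι ℚ (prim n T) * w T - (k : ℚ) • v ∈ lenFilt n k := by
    rcases k with _ | j
    · have : ∀ T, w T = 0 := hwk
      simp [this]
    have h1 : ∑ T ∈ F, ι ℚ (prim n T) * h.symm H n j (h.shift H T f) -
        ∑ T ∈ F, ι ℚ (prim n T) * w T ∈ lenFilt n (j + 1) := by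
      rw [← Finset.sum_sub_distrib]
      refine sum_mem fun T _ => ?_
      by_cases hT : T = 0
      · rw [hT, h.prim_zero hn]
        simp
      · rw [← mul_sub, ← hwf T hT]
        exact ι_mul_mem_lenFilt _ (IH j (by omega) _ (hwk T))
    have h2 : ((j + 1 : ℕ) : ℚ) • h.symm H n (j + 1) f =
        ∑ T ∈ F, ι ℚ (prim n T) * h.symm H n j (h.shift H T f) := by
      rw [symm, LinearMap.smul_apply, smul_smul, mul_inv_cancel₀ (by positivity), one_smul,
        h.shiftSum_eq H _ hFf]
      rfl
    have h3 := Submodule.smul_mem _ ((j + 1 : ℕ) : ℚ) (IHk v hv)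
    rw [smul_sub, h2] at h3
    have := sub_mem h3 h1
    convert this using 1
    abel
  have hterm : ∀ T, ι ℚ (prim n T) * h.symm H n k (h.shift H T ((X : C.Hall) * f)) -
      ((X : C.Hall) T • (ι ℚ (prim n T) * h.symm H n k f) + ι ℚ X * (ι ℚ (prim n T) * w T)) ∈
        lenFilt n (k + 1) := by
    intro T
    by_cases hT : T = 0
    · rw [hT, h.prim_zero hn]
      simp
    have h1 : h.symm H n k (h.shift H T ((X : C.Hall) * f)) =
        (X : C.Hall) T • h.symm H n k f + h.symm H n k (toHall n (ι ℚ X * w T)) := by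
      have := h.symm_eq_zero H hn (h.shift_mul_congr H hXp hfk T)
      rw [map_sub, sub_eq_zero] at this
      rw [this, map_add, map_smul, map_mul (toHall n), toHall_ι, hwf T hT]
    have h2 := ι_mul_mem_lenFilt (prim n T) (IHk _ (ι_mul_mem_lenFilt X (hwk T)))
    -- The commutator from exchanging the two factors is a single element of the Lie algebra, so the
    -- product is one factor shorter.
    have h3 := ι_mul_mem_lenFilt ⁅prim n T, X⁆ (hwk T)
    rw [LieHom.map_lie, LieRing.of_associative_ring_bracket] at h3
    rw [h1]
    have := add_mem h2 h3
    convert this using 1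
    simp only [mul_add, mul_sub, sub_mul, mul_assoc, mul_smul_comm]
    abel
  have hsum := sum_mem (t := F) fun T _ => hterm T
  -- Here `X` is expanded in the indicators of indecomposable classes.
  have h4 : ∑ T ∈ F, (X : C.Hall) T • (ι ℚ (prim n T) * h.symm H n k f) =
      ι ℚ X * h.symm H n k f := by
    conv_rhs => rw [h.eq_sum_prim H hn hFX]
    simp only [map_sum, map_smul, Finset.sum_mul, smul_mul_assoc]
  rw [Finset.sum_sub_distrib, Finset.sum_add_distrib, h4, ← Finset.mul_sum] at hsum
  have h5 := ι_mul_mem_lenFilt X (IHk v hv)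
  have h6 := ι_mul_mem_lenFilt X hEuler
  have h7 : ((k + 1 : ℕ) : ℚ) • h.symm H n (k + 1) ((X : C.Hall) * f) =
      ∑ T ∈ F, ι ℚ (prim n T) * h.symm H n k (h.shift H T ((X : C.Hall) * f)) := by
    rw [symm, LinearMap.smul_apply, smul_smul, mul_inv_cancel₀ (by positivity), one_smul,
      h.shiftSum_eq H _ hFXf]
    rfl
  rw [← h7] at hsum
  have h8 := Submodule.smul_mem _ (((k + 1 : ℕ) : ℚ)⁻¹) (add_mem (add_mem hsum h5) h6)
  convert h8 using 1
  have : ∀ a b c d : UniversalEnvelopingAlgebra ℚ n,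
      a - (b + ι ℚ X * c) + ι ℚ X * d + ι ℚ X * (c - (k : ℚ) • v) =
        a - b + ι ℚ X * d - (k : ℚ) • (ι ℚ X * v) := by
    intro a b c d
    rw [mul_sub, mul_smul_comm]
    abel
  rw [this, mul_sub]
  have h9 : ∀ a b : UniversalEnvelopingAlgebra ℚ n,
      ((k + 1 : ℕ) : ℚ) • a - b + (b - ι ℚ X * v) - (k : ℚ) • (ι ℚ X * v) =
        ((k + 1 : ℕ) : ℚ) • (a - ι ℚ X * v) := by
    intro a b
    push_cast
    module
  rw [h9, smul_smul, inv_mul_cancel₀ (by positivity), one_smul]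

include h H hn in
-- If `u` maps to zero, `symm` shows that `u` lies one step lower in the length filtration, and
-- descent ends at `⊥`. Surjectivity is `corad_le_map` together with exhaustiveness of the coradical
-- filtration.
theorem toHall_bijective : Function.Bijective (toHall n) := by
  constructor
  · rw [injective_iff_map_eq_zero]
    intro u hu
    obtain ⟨k, hk⟩ := exists_mem_lenFilt u
    induction k with
    | zero => exact hk
    | succ k ih =>
      refine ih ?_
      have := h.symm_toHall_sub_mem H hn k u hk
      rwa [hu, map_zero, zero_sub, neg_mem_iff] at this
  · intro f
    obtain ⟨k, hk⟩ := h.exists_mem_corad H f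
    obtain ⟨u, _, hu⟩ := h.corad_le_map H hn k hk
    exact ⟨u, hu⟩

end HallData.IsGraded

/-! ### The transpose -/

section Transpose

open UniversalEnvelopingAlgebra

variable (L : Type*) [LieRing L] [LieAlgebra ℚ L]

/-- The transpose as a linear endomorphism of the enveloping algebra. -/
noncomputable def transposeLin :
    UniversalEnvelopingAlgebra ℚ L →ₗ[ℚ] UniversalEnvelopingAlgebra ℚ L :=
  (MulOpposite.opLinearEquiv ℚ).symm.toLinearMap ∘ₗ (transpose L).toLinearMap

variable {L}

theorem transposeLin_apply (u : UniversalEnvelopingAlgebra ℚ L) :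
    transposeLin L u = MulOpposite.unop (transpose L u) := rfl

theorem transposeLin_ι (X : L) : transposeLin L (ι ℚ X) = -ι ℚ X := by
  rw [transposeLin_apply, transpose, lift_ι_apply]
  rfl

theorem transposeLin_one : transposeLin L 1 = 1 := by
  rw [transposeLin_apply, map_one, MulOpposite.unop_one]

theorem transposeLin_mul (u v : UniversalEnvelopingAlgebra ℚ L) :
    transposeLin L (u * v) = transposeLin L v * transposeLin L u := by
  simp only [transposeLin_apply]
  rw [map_mul, MulOpposite.unop_mul]

theorem transposeLin_involutive : Function.Involutive (transposeLin L) := by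
  intro u
  refine envelopingAlgebra_induction
    (LinearMap.eqLocus ((transposeLin L).comp (transposeLin L)) LinearMap.id) ?_ ?_ u
  · simp [LinearMap.mem_eqLocus, transposeLin_one]
  · intro X v hv
    rw [LinearMap.mem_eqLocus] at hv ⊢
    simp only [LinearMap.comp_apply, LinearMap.id_apply] at hv ⊢
    rw [transposeLin_mul, transposeLin_mul, hv, transposeLin_ι, map_neg, transposeLin_ι, neg_neg]

end Transpose

/-! ### The transpose on the Ringel-Hall algebra and the grading -/

namespace HallData.IsGraded

open UniversalEnvelopingAlgebra

variable {C : HallData}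
variable [AddCommMonoid C.Iso] {deg : C.Iso →+ ℕ} (h : C.IsGraded deg)
variable [Ring C.Hall] [Algebra ℚ C.Hall] (H : C.IsHallAlgebra)
variable {n : LieSubalgebra ℚ C.Hall} (hn : ∀ X, X ∈ n ↔ C.IsPrimitive X)

/-- The isomorphism of the enveloping algebra with the Ringel-Hall algebra. -/
noncomputable def hallEquiv : UniversalEnvelopingAlgebra ℚ n ≃ₐ[ℚ] C.Hall :=
  AlgEquiv.ofBijective (toHall n) (h.toHall_bijective H hn)

theorem hallEquiv_ι (X : n) : h.hallEquiv H hn (ι ℚ X) = X := toHall_ι X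

/-- The transpose on the Ringel-Hall algebra. -/
noncomputable def hallTranspose : C.Hall ≃ₗ[ℚ] C.Hall :=
  (h.hallEquiv H hn).symm.toLinearEquiv ≪≫ₗ
    LinearEquiv.ofInvolutive (transposeLin n) transposeLin_involutive ≪≫ₗ
    (h.hallEquiv H hn).toLinearEquiv

theorem hallTranspose_hallEquiv (u : UniversalEnvelopingAlgebra ℚ n) :
    h.hallTranspose H hn (h.hallEquiv H hn u) = h.hallEquiv H hn (transposeLin n u) := by
  change h.hallEquiv H hn (transposeLin n ((h.hallEquiv H hn).symm (h.hallEquiv H hn u))) = _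
  rw [AlgEquiv.symm_apply_apply]

theorem hallTranspose_one : h.hallTranspose H hn 1 = 1 := by
  have := h.hallTranspose_hallEquiv H hn 1
  rwa [transposeLin_one, map_one] at this

/-- An anti-homomorphism that negates `X` turns left multiplication by `X` into right multiplication
by `-X`; this is exactly equivariance from `Ins n` to `TopIns n`. -/
theorem hallTranspose_mul (X : n) (f : C.Hall) :
    h.hallTranspose H hn (X * f) = h.hallTranspose H hn f * -(X : C.Hall) := by
  obtain ⟨u, rfl⟩ := (h.hallEquiv H hn).surjective f
  rw [← h.hallEquiv_ι H hn X, ← map_mul, hallTranspose_hallEquiv, hallTranspose_hallEquiv,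
    transposeLin_mul, transposeLin_ι, map_mul, map_neg]

theorem hallTranspose_symm : (h.hallTranspose H hn).symm = h.hallTranspose H hn := by
  ext f
  rw [LinearEquiv.symm_apply_eq]
  obtain ⟨u, rfl⟩ := (h.hallEquiv H hn).surjective f
  rw [hallTranspose_hallEquiv, hallTranspose_hallEquiv, transposeLin_involutive u]

/-- The automorphism that multiplies the functions of degree `d` by `2 ^ d`. -/
noncomputable def scale : C.Hall →ₗ[ℚ] C.Hall where
  toFun f := h.ofBounded (fun A => 2 ^ deg A * f A) (exists_deg_bound deg f).choose fun A hA =>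
    (exists_deg_bound deg f).choose_spec A (right_ne_zero_of_mul hA)
  map_add' f g := hall_ext fun A => by
    simp only [H.add_apply, ofBounded_apply, mul_add]
  map_smul' c f := hall_ext fun A => by
    simp only [H.smul_apply, ofBounded_apply, RingHom.id_apply, mul_left_comm]

@[simp]
theorem scale_apply (f : C.Hall) (A : C.Iso) : h.scale H f A = 2 ^ deg A * f A := rfl

theorem scale_one : h.scale H 1 = 1 := hall_ext fun A => by
  rw [scale_apply, H.one_apply]
  by_cases hA : A = 0
  · simp [hA]
  · simp [h.deltaZero_of_ne hA]

/-- The degree is additive on subobject and quotient. -/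
theorem scale_mul (f g : C.Hall) : h.scale H (f * g) = h.scale H f * h.scale H g :=
  hall_ext fun A => by
    rw [scale_apply, h.mul_apply H, h.mul_apply H, mul_conv]
    refine h.conv_congr fun a b hab => ?_
    rw [scale_apply, scale_apply, ← hab, pow_add]
    ring

include hn in
theorem scale_mem (X : n) : h.scale H X ∈ n := by
  have hX := (h.isPrimitive_iff _).1 ((hn _).1 X.2)
  refine (hn _).2 ((h.isPrimitive_iff _).2 fun A B => ?_)
  simp only [scale_apply, hX, map_add]
  by_cases hA : A = 0
  · subst hA
    by_cases hB : B = 0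
    · simp [hB]
    · simp [h.deltaZero_of_ne hB, h.deltaZero_zero]
  · by_cases hB : B = 0
    · simp [hB, h.deltaZero_of_ne hA, h.deltaZero_zero]
    · simp [h.deltaZero_of_ne hA, h.deltaZero_of_ne hB]

/-- Scaling is an algebra homomorphism that maps `n` to itself, so both composites are
anti-homomorphisms of `U(n)` with the same values on generators. -/
theorem hallTranspose_scale (f : C.Hall) :
    h.hallTranspose H hn (h.scale H f) = h.scale H (h.hallTranspose H hn f) := by
  obtain ⟨u, rfl⟩ := (h.hallEquiv H hn).surjective f
  refine envelopingAlgebra_induction (LinearMap.eqLocus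
    ((h.hallTranspose H hn).toLinearMap ∘ₗ h.scale H ∘ₗ (h.hallEquiv H hn).toLinearMap)
    (h.scale H ∘ₗ (h.hallTranspose H hn).toLinearMap ∘ₗ (h.hallEquiv H hn).toLinearMap)) ?_ ?_ u
  · simp [LinearMap.mem_eqLocus, hallTranspose_one, scale_one]
  · intro X v hv
    rw [LinearMap.mem_eqLocus] at hv ⊢
    simp only [LinearMap.comp_apply, LinearEquiv.coe_coe, AlgEquiv.toLinearMap_apply] at hv ⊢
    rw [map_mul, hallEquiv_ι, scale_mul]
    have h1 := h.hallTranspose_mul H hn ⟨_, h.scale_mem H hn X⟩ (h.scale H (h.hallEquiv H hn v))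
    rw [h1, hv, hallTranspose_mul, scale_mul, map_neg]

/-- The homogeneous components are eigenspaces of scaling with distinct eigenvalues `2 ^ d`, and the
transpose preserves eigenspaces. -/
theorem hallTranspose_delta_apply {A B : C.Iso} (hAB : deg A ≠ deg B) :
    h.hallTranspose H hn (delta B) A = 0 := by
  classical
  have h1 : h.scale H (delta B) = (2 ^ deg B : ℚ) • (delta B : C.Hall) := hall_ext fun D => by
    rw [H.smul_apply, scale_apply, delta_apply]
    split_ifs with hD
    · rw [hD]
    · simp
  have h2 := DFunLike.congr_fun (h.hallTranspose_scale H hn (delta B)) A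
  rw [h1, map_smul, H.smul_apply, scale_apply] at h2
  by_contra h0
  have h3 := mul_right_cancel₀ h0 h2
  exact hAB (pow_right_injective₀ (by norm_num : (0 : ℚ) < 2) (by norm_num) h3).symm

/-! ### The restricted dual -/

omit [AddCommMonoid C.Iso] in
theorem eval_mem_restrictedDual (A : C.Iso) : H.eval A ∈ C.restrictedDual :=
  Submodule.subset_span ⟨A, fun _ => rfl⟩

omit [AddCommMonoid C.Iso] in
theorem restrictedDual_comp_mem {g : C.Hall →ₗ[ℚ] C.Hall}
    (hg : ∀ A, H.eval A ∘ₗ g ∈ C.restrictedDual) {φ : Module.Dual ℚ C.Hall}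
    (hφ : φ ∈ C.restrictedDual) : φ ∘ₗ g ∈ C.restrictedDual := by
  have : C.restrictedDual ≤ C.restrictedDual.comap (LinearMap.lcomp ℚ ℚ g) := by
    refine Submodule.span_le.2 ?_
    rintro ψ ⟨A, hA⟩
    have : ψ = H.eval A := LinearMap.ext hA
    rw [this]
    exact hg A
  exact this hφ

include h H in
-- An object has finitely many subobjects, so `φ_A (X × f)` is a finite combination of the values of
-- `f` at the quotients of `A`.
theorem restrictedDual_mulLeft_mem (X : C.Hall) {φ : Module.Dual ℚ C.Hall}
    (hφ : φ ∈ C.restrictedDual) : φ ∘ₗ LinearMap.mulLeft ℚ X ∈ C.restrictedDual := by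
  refine restrictedDual_comp_mem H (fun A => ?_) hφ
  have : H.eval A ∘ₗ LinearMap.mulLeft ℚ X = ∑ N : C.Sub (Quotient.out A),
      X (C.cls (C.sub _ N)) • H.eval (C.cls (C.quot _ N)) := by
    ext f
    rw [LinearMap.sum_apply]
    exact h.mul_apply H X f A
  rw [this]
  exact sum_mem fun N _ => Submodule.smul_mem _ _ (eval_mem_restrictedDual H _)

include h H in
theorem restrictedDual_mulRight_mem (X : C.Hall) {φ : Module.Dual ℚ C.Hall}
    (hφ : φ ∈ C.restrictedDual) : φ ∘ₗ LinearMap.mulRight ℚ X ∈ C.restrictedDual := by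
  refine restrictedDual_comp_mem H (fun A => ?_) hφ
  have : H.eval A ∘ₗ LinearMap.mulRight ℚ X = ∑ N : C.Sub (Quotient.out A),
      X (C.cls (C.quot _ N)) • H.eval (C.cls (C.sub _ N)) := by
    ext f
    rw [LinearMap.sum_apply]
    refine (h.mul_apply H f X A).trans (Finset.sum_congr rfl fun N _ => ?_)
    exact mul_comm _ _
  rw [this]
  exact sum_mem fun N _ => Submodule.smul_mem _ _ (eval_mem_restrictedDual H _)

/-- By homogeneity `φ_A` composed with the transpose involves only the `φ_B` with `deg B = deg A`,
and these are finitely many. -/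
theorem restrictedDual_hallTranspose_mem {φ : Module.Dual ℚ C.Hall}
    (hφ : φ ∈ C.restrictedDual) : φ ∘ₗ (h.hallTranspose H hn).toLinearMap ∈ C.restrictedDual := by
  classical
  refine restrictedDual_comp_mem H (fun A => ?_) hφ
  have : H.eval A ∘ₗ (h.hallTranspose H hn).toLinearMap =
      ∑ B ∈ (h.finite_deg (deg A)).toFinset, h.hallTranspose H hn (delta B) A • H.eval B := by
    refine H.hom_ext fun D => ?_
    rw [LinearMap.sum_apply]
    change h.hallTranspose H hn (delta D) A =
      ∑ B ∈ (h.finite_deg (deg A)).toFinset, h.hallTranspose H hn (delta B) A * delta D B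
    simp only [delta_apply, mul_ite, mul_one, mul_zero, Finset.sum_ite_eq]
    split_ifs with hD
    · rfl
    · exact h.hallTranspose_delta_apply H hn fun h0 => hD (by simp [h0])
  rw [this]
  exact sum_mem fun N _ => Submodule.smul_mem _ _ (eval_mem_restrictedDual H _)

/-! ### The isomorphisms of modules -/

/-- The transpose as an isomorphism of Lie modules. -/
noncomputable def insEquiv : Ins n ≃ₗ⁅ℚ, n⁆ TopIns n :=
  let e := (toIns n).symm ≪≫ₗ h.hallTranspose H hn ≪≫ₗ toTopIns n
  { e with map_lie' := fun {X f} => h.hallTranspose_mul H hn X f }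

variable (n) in
/-- The restricted dual of the module `Ins n`. -/
def elim : LieSubmodule ℚ n (Module.Dual ℚ (Ins n)) :=
  { C.restrictedDual.comap (LinearMap.lcomp ℚ ℚ (toIns n).toLinearMap) with
    lie_mem := fun {X φ} hφ => by
      have h1 := neg_mem (h.restrictedDual_mulLeft_mem H (X : C.Hall) hφ)
      change ⁅X, φ⁆ ∘ₗ (toIns n).toLinearMap ∈ C.restrictedDual
      convert h1 using 1
      ext f
      simp
      rfl }

variable (n) in
/-- The restricted dual of the module `TopIns n`. -/
def topElim : LieSubmodule ℚ n (Module.Dual ℚ (TopIns n)) :=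
  { C.restrictedDual.comap (LinearMap.lcomp ℚ ℚ (toTopIns n).toLinearMap) with
    lie_mem := fun {X φ} hφ => by
      have h1 := neg_mem (h.restrictedDual_mulRight_mem H (-X : C.Hall) hφ)
      change ⁅X, φ⁆ ∘ₗ (toTopIns n).toLinearMap ∈ C.restrictedDual
      convert h1 using 1
      ext f
      simp
      rfl }

theorem mem_elim (φ : Module.Dual ℚ (Ins n)) :
    φ ∈ h.elim H n ↔ φ ∘ₗ (toIns n).toLinearMap ∈ C.restrictedDual := Iff.rfl

theorem mem_topElim (φ : Module.Dual ℚ (TopIns n)) :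
    φ ∈ h.topElim H n ↔ φ ∘ₗ (toTopIns n).toLinearMap ∈ C.restrictedDual := Iff.rfl

/-- The isomorphism of the restricted duals that is induced by the transpose. -/
noncomputable def elimEquiv : h.elim H n ≃ₗ⁅ℚ, n⁆ h.topElim H n :=
  let T := h.insEquiv H hn
  { toFun := fun φ => ⟨(φ : Module.Dual ℚ (Ins n)) ∘ₗ (T.symm : TopIns n →ₗ[ℚ] Ins n), by
      have := h.restrictedDual_hallTranspose_mem H hn φ.2
      rwa [← h.hallTranspose_symm H hn] at this⟩
    invFun := fun ψ => ⟨(ψ : Module.Dual ℚ (TopIns n)) ∘ₗ (T : Ins n →ₗ[ℚ] TopIns n),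
      h.restrictedDual_hallTranspose_mem H hn ψ.2⟩
    map_add' := fun _ _ => rfl
    map_smul' := fun _ _ => rfl
    map_lie' := fun {X φ} => by
      refine Subtype.ext (LinearMap.ext fun f => ?_)
      have hT : T.symm ⁅X, f⁆ = ⁅X, T.symm f⁆ := T.symm.toLieModuleHom.map_lie X f
      change -(φ : Module.Dual ℚ (Ins n)) ⁅X, T.symm f⁆ =
        -(φ : Module.Dual ℚ (Ins n)) (T.symm ⁅X, f⁆)
      rw [hT]
    left_inv := fun φ => Subtype.ext (LinearMap.ext fun f =>
      congrArg (φ : Module.Dual ℚ (Ins n)) (T.symm_apply_apply f))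
    right_inv := fun ψ => Subtype.ext (LinearMap.ext fun f =>
      congrArg (ψ : Module.Dual ℚ (TopIns n)) (T.apply_symm_apply f)) }

theorem elimEquiv_apply (φ : h.elim H n) (f : Ins n) :
    (h.elimEquiv H hn φ : Module.Dual ℚ (TopIns n)) (h.insEquiv H hn f) =
      (φ : Module.Dual ℚ (Ins n)) f :=
  congrArg (φ : Module.Dual ℚ (Ins n)) ((h.insEquiv H hn).symm_apply_apply f)

end HallData.IsGraded

/-! ### The theorem for all graded Hall data -/

open HallData IsGraded in
theorem HallData.IsGraded.main {C : HallData} [AddCommMonoid C.Iso] {deg : C.Iso →+ ℕ}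
    (h : C.IsGraded deg) :
    ∃ (_ : Ring C.Hall) (_ : Algebra ℚ C.Hall) (n : LieSubalgebra ℚ C.Hall),
      C.IsHallAlgebra ∧ (∀ X : C.Hall, X ∈ n ↔ C.IsPrimitive X) ∧
      ∃ Φ : UniversalEnvelopingAlgebra ℚ n ≃ₐ[ℚ] C.Hall,
        (∀ X : n, Φ (UniversalEnvelopingAlgebra.ι ℚ X) = X) ∧
        ∃ T : Ins n ≃ₗ⁅ℚ, n⁆ TopIns n,
          (∀ u : UniversalEnvelopingAlgebra ℚ n,
            T (toIns n (Φ u)) = toTopIns n (Φ (MulOpposite.unop (transpose n u)))) ∧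
          ∃ (elim : LieSubmodule ℚ n (Module.Dual ℚ (Ins n)))
            (topElim : LieSubmodule ℚ n (Module.Dual ℚ (TopIns n))),
            (∀ φ, φ ∈ elim ↔ φ ∘ₗ (toIns n).toLinearMap ∈ C.restrictedDual) ∧
            (∀ φ, φ ∈ topElim ↔ φ ∘ₗ (toTopIns n).toLinearMap ∈ C.restrictedDual) ∧
            ∃ S : elim ≃ₗ⁅ℚ, n⁆ topElim, ∀ (φ : elim) (f : Ins n),
              (S φ : Module.Dual ℚ (TopIns n)) (T f) = (φ : Module.Dual ℚ (Ins n)) f := by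
  let _ := h.hallRing
  let _ := h.hallAlgebra
  have H := h.isHallAlgebra
  have hn : ∀ X, X ∈ h.primitives H ↔ C.IsPrimitive X := fun _ => Iff.rfl
  refine ⟨h.hallRing, h.hallAlgebra, h.primitives H, H, hn, h.hallEquiv H hn, h.hallEquiv_ι H hn,
    h.insEquiv H hn, fun u => ?_, h.elim H _, h.topElim H _, h.mem_elim H, h.mem_topElim H,
    h.elimEquiv H hn, h.elimEquiv_apply H hn⟩
  exact congrArg (toTopIns (h.primitives H)) (h.hallTranspose_hallEquiv H hn u)

open HallData

/-! ### Rooted forests as graded Hall data -/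

namespace Forest

theorem iso_of_equiv {F G : Forest} (e : F.V ≃ G.V)
    (he : ∀ v w, F.parent v = some w ↔ G.parent (e v) = some (e w)) : LRF.cls F = LRF.cls G := by
  refine Quotient.sound ⟨e, fun v => ?_⟩
  ext w
  obtain ⟨w, rfl⟩ := e.surjective w
  rw [← he]
  simp

theorem exists_equiv {F G : Forest} (h : LRF.cls F = LRF.cls G) : ∃ e : F.V ≃ G.V,
    ∀ v w, F.parent v = some w ↔ G.parent (e v) = some (e w) := by
  obtain ⟨e, he⟩ := Quotient.exact h
  exact ⟨e, fun v w => by simp [he]⟩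

theorem restrict_parent_iff (F : Forest) (S : Set F.V) (v w : S) :
    (F.restrict S).parent v = some w ↔ F.parent v = some w.1 := by
  simp only [Option.bind_eq_some_iff]
  constructor
  · rintro ⟨u, hu, h⟩
    split_ifs at h
    rw [hu, ← Option.some.inj h]
  · intro h
    exact ⟨w, h, by simp⟩

theorem sum_parent_inl (F G : Forest) (v w : F.V) :
    (F.sum G).parent (.inl v) = some (.inl w) ↔ F.parent v = some w := by
  simp

theorem sum_parent_inr (F G : Forest) (v w : G.V) :
    (F.sum G).parent (.inr v) = some (.inr w) ↔ G.parent v = some w := by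
  simp

/-! #### The monoid of isomorphism classes -/

theorem cls_sum_congr {F F' G G' : Forest} (h : LRF.cls F = LRF.cls F')
    (h' : LRF.cls G = LRF.cls G') : LRF.cls (F.sum G) = LRF.cls (F'.sum G') := by
  obtain ⟨e, he⟩ := exists_equiv h
  obtain ⟨e', he'⟩ := exists_equiv h'
  refine iso_of_equiv (e.sumCongr e') ?_
  rintro (v | v) (w | w) <;> simp [he, he']

noncomputable instance : Add LRF.Iso where
  add := Quotient.map₂ Forest.sum fun _ _ h _ _ h' =>
    Quotient.exact (cls_sum_congr (Quotient.sound h) (Quotient.sound h'))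

noncomputable instance : Zero LRF.Iso where
  zero := LRF.cls Forest.empty

noncomputable instance : AddCommMonoid LRF.Iso where
  nsmul := nsmulRec
  add_assoc := by
    rintro ⟨F⟩ ⟨G⟩ ⟨K⟩
    refine iso_of_equiv (Equiv.sumAssoc _ _ _) ?_
    rintro ((v | v) | v) ((w | w) | w) <;> simp
  zero_add := by
    rintro ⟨F⟩
    refine iso_of_equiv (Equiv.emptySum _ _) ?_
    rintro (v | v) (w | w)
    · exact v.elim
    · exact v.elim
    · exact w.elim
    · simp
  add_zero := by
    rintro ⟨F⟩
    refine iso_of_equiv (Equiv.sumEmpty _ _) ?_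
    rintro (v | v) (w | w)
    · simp
    · exact w.elim
    · exact v.elim
    · exact v.elim
  add_comm := by
    rintro ⟨F⟩ ⟨G⟩
    refine iso_of_equiv (Equiv.sumComm _ _) ?_
    rintro (v | v) (w | w) <;> simp

/-- The number of vertices. -/
noncomputable def deg : LRF.Iso →+ ℕ where
  toFun := Quotient.lift (fun F : Forest => Nat.card F.V) fun _ _ ⟨e, _⟩ => Nat.card_congr e
  map_zero' := Nat.card_of_isEmpty (α := Empty)
  map_add' := by
    rintro ⟨F⟩ ⟨G⟩
    have := F.finite
    have := G.finite
    exact Nat.card_sum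

theorem cls_eq_zero_of_isEmpty {F : Forest} (h : IsEmpty F.V) : LRF.cls F = 0 :=
  iso_of_equiv (G := Forest.empty) (Equiv.equivOfIsEmpty _ _) fun v => h.elim v

theorem isEmpty_of_cls_eq_zero {F : Forest} (h : LRF.cls F = 0) : IsEmpty F.V := by
  obtain ⟨e, _⟩ := exists_equiv (G := Forest.empty) h
  exact e.isEmpty

/-! #### Cuts and sets that are closed under descendants -/

/-- The sets of vertices that contain the descendants of their elements. -/
abbrev Lower (F : Forest) : Type := {S : Set F.V // ∀ v w, F.parent v = some w → w ∈ S → v ∈ S}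

theorem Lower.mem_of_below {F : Forest} (S : F.Lower) {v w : F.V} (h : F.Below v w)
    (hw : w ∈ S.1) : v ∈ S.1 := by
  induction h using Relation.ReflTransGen.head_induction_on with
  | refl => exact hw
  | head h _ ih => exact S.2 _ _ h ih

/-- A finite acyclic relation is well founded, so climbing from a vertex through its parents
terminates. -/
theorem parent_wellFounded (F : Forest) : WellFounded fun w v => F.parent v = some w := by
  have := F.finite
  have : IsTrans F.V (Relation.TransGen fun w v => F.parent v = some w) :=
    ⟨fun _ _ _ => Relation.TransGen.trans⟩
  have : Std.Irrefl (Relation.TransGen fun w v => F.parent v = some w) := ⟨fun v hv =>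
    F.acyclic v (Relation.transGen_swap.1 hv)⟩
  exact (Finite.wellFounded_of_trans_of_irrefl
    (Relation.TransGen fun w v => F.parent v = some w)).mono fun _ _ h => .single h

theorem cut_ext {F : Forest} {c d : F.Cut} (h : c.marks = d.marks) : c = d := by
  cases c
  cases d
  cases h
  rfl

/-- An admissible cut is determined by the set of vertices that it separates from the root. -/
def cutEquiv (F : Forest) : F.Cut ≃ F.Lower where
  toFun c := ⟨c.pruned, fun _ _ h ⟨a, ha, hw⟩ => ⟨a, ha, .head h hw⟩⟩
  invFun S :=
    -- The cut edges are those that leave `S`; the marks are the topmost vertices of `S`.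
    { marks := {v | v ∈ S.1 ∧ ∀ w, F.parent v = some w → w ∉ S.1}
      admissible := fun a ha b hb hab => by
        rcases Relation.ReflTransGen.cases_head hab with h | ⟨w, hw, hwb⟩
        · exact h
        · exact absurd (S.mem_of_below hwb hb.1) (ha.2 w hw) }
  left_inv c := by
    refine cut_ext (Set.ext fun v => ⟨?_, ?_⟩)
    · rintro ⟨⟨a, ha, hva⟩, hv⟩
      rcases Relation.ReflTransGen.cases_head hva with h | ⟨w, hw, hwa⟩
      · exact h ▸ ha
      · exact absurd ⟨a, ha, hwa⟩ (hv w hw)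
    · intro hv
      refine ⟨⟨v, hv, .refl⟩, ?_⟩
      rintro w hw ⟨a, ha, hwa⟩
      have h1 : F.Below v a := .head hw hwa
      obtain rfl := c.admissible v hv a ha h1
      exact F.acyclic v (.head' hw hwa)
  right_inv S := by
    refine Subtype.ext (Set.ext fun v => ⟨?_, ?_⟩)
    · rintro ⟨a, ha, hva⟩
      exact S.mem_of_below hva ha.1
    · intro hv
      -- Climb inside `S` to its last vertex, which is a mark.
      induction v using F.parent_wellFounded.induction with
      | _ v ih =>
      by_cases h : ∀ w, F.parent v = some w → w ∉ S.1
      · exact ⟨v, ⟨hv, h⟩, .refl⟩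
      · push Not at h
        obtain ⟨w, hw, hwS⟩ := h
        obtain ⟨a, ha, hwa⟩ := ih w hw hwS
        exact ⟨a, ha, .head hw hwa⟩

theorem restrict_congr {F : Forest} {S T : Set F.V} (h : S = T) :
    LRF.cls (F.restrict S) = LRF.cls (F.restrict T) := by rw [h]

theorem restrict_restrict (F : Forest) (S : Set F.V) (T : Set S) :
    LRF.cls ((F.restrict S).restrict T) = LRF.cls (F.restrict (Subtype.val '' T)) := by
  refine iso_of_equiv (F := (F.restrict S).restrict T) (G := F.restrict (Subtype.val '' T))
    (Equiv.Set.image _ _ Subtype.val_injective) fun v w => ?_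
  rw [restrict_parent_iff, restrict_parent_iff, restrict_parent_iff]
  rfl

theorem restrict_univ (F : Forest) : LRF.cls (F.restrict Set.univ) = LRF.cls F :=
  iso_of_equiv (F := F.restrict Set.univ) (Equiv.Set.univ _) fun v w => by
    rw [restrict_parent_iff]
    rfl

theorem restrict_empty (F : Forest) : LRF.cls (F.restrict ∅) = 0 :=
  cls_eq_zero_of_isEmpty (F := F.restrict ∅) (inferInstanceAs (IsEmpty (∅ : Set F.V)))

theorem eq_empty_of_restrict {F : Forest} {S : Set F.V} (h : LRF.cls (F.restrict S) = 0) :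
    S = ∅ := Set.isEmpty_coe_sort.1 (isEmpty_of_cls_eq_zero h)

/-- Pairs of nested lower sets as lower sets in the forest on a lower set. -/
def lowerPairEquiv (F : Forest) :
    (Σ S : F.Lower, (F.restrict S.1).Lower) ≃ {p : F.Lower × F.Lower // p.1.1 ⊆ p.2.1} where
  toFun p := ⟨(⟨Subtype.val '' p.2.1, by
      rintro v w hvw ⟨w, hw, rfl⟩
      have hv := p.1.2 _ _ hvw w.2
      exact ⟨⟨v, hv⟩, p.2.2 ⟨v, hv⟩ w ((restrict_parent_iff _ _ _ _).2 hvw) hw, rfl⟩⟩, p.1), by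
    rintro _ ⟨v, _, rfl⟩
    exact v.2⟩
  invFun p := ⟨p.1.2, Subtype.val ⁻¹' p.1.1.1, fun _ _ h hw =>
    p.1.1.2 _ _ ((restrict_parent_iff _ _ _ _).1 h) hw⟩
  left_inv p := Sigma.ext rfl (heq_of_eq (Subtype.ext
    (Set.preimage_image_eq _ Subtype.val_injective)))
  right_inv p := Subtype.ext (Prod.ext (Subtype.ext (by
    change Subtype.val '' (Subtype.val ⁻¹' p.1.1.1 : Set p.1.2.1) = p.1.1.1
    rw [Subtype.image_preimage_coe]
    exact Set.inter_eq_right.2 p.2)) rfl)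

/-- Pairs of nested lower sets as lower sets in the forest on the complement of a lower set. -/
def lowerPairEquiv' (F : Forest) :
    (Σ S : F.Lower, (F.restrict S.1ᶜ).Lower) ≃ {p : F.Lower × F.Lower // p.1.1 ⊆ p.2.1} where
  toFun p := ⟨(p.1, ⟨p.1.1 ∪ Subtype.val '' p.2.1, by
      rintro v w hvw hw
      by_cases hv : v ∈ p.1.1
      · exact Or.inl hv
      rcases hw with hw | ⟨w, hw, rfl⟩
      · exact Or.inl (p.1.2 _ _ hvw hw)
      · exact Or.inr ⟨⟨v, hv⟩, p.2.2 ⟨v, hv⟩ w ((restrict_parent_iff _ _ _ _).2 hvw) hw, rfl⟩⟩),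
    Set.subset_union_left⟩
  invFun p := ⟨p.1.1, Subtype.val ⁻¹' p.1.2.1, fun _ _ h hw =>
    p.1.2.2 _ _ ((restrict_parent_iff _ _ _ _).1 h) hw⟩
  left_inv p := Sigma.ext rfl (heq_of_eq (Subtype.ext (by
    ext v
    simp)))
  right_inv p := Subtype.ext (Prod.ext rfl (Subtype.ext (by
    ext v
    have := @p.2 v
    by_cases hv : v ∈ p.1.1.1 <;> simp_all)))

theorem pruned_symm {F : Forest} (S : F.Lower) : ((cutEquiv F).symm S).pruned = S.1 :=
  congrArg Subtype.val ((cutEquiv F).apply_symm_apply S)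

/-! #### Finiteness, invariance, associativity, sums and units -/

/-- A forest with `d` vertices is a parent function on `Fin d`. Functions with cycles are sent to
the class `0`, which does no harm to finiteness. -/
theorem finite_deg (d : ℕ) : {A : LRF.Iso | deg A = d}.Finite := by
  classical
  let g : (Fin d → Option (Fin d)) → LRF.Iso := fun p =>
    if hp : ∀ v, ¬ Relation.TransGen (fun x y => p x = some y) v v then
      LRF.cls (Forest.mk (Fin d) inferInstance p hp) else 0
  refine (Set.finite_range g).subset ?_
  rintro ⟨F⟩ hF
  have := F.finite
  let e : F.V ≃ Fin d := Finite.equivFinOfCardEq hF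
  refine ⟨fun i => (F.parent (e.symm i)).map e, ?_⟩
  have hp : ∀ v, ¬ Relation.TransGen
      (fun x y => (F.parent (e.symm x)).map e = some y) v v := by
    intro v hv
    refine F.acyclic (e.symm v) (hv.lift e.symm fun a b hab => ?_)
    obtain ⟨w, hw, rfl⟩ := Option.map_eq_some_iff.1 hab
    change F.parent (e.symm a) = some (e.symm (e w))
    rwa [e.symm_apply_apply]
  simp only [g, dif_pos hp]
  refine iso_of_equiv (F := Forest.mk (Fin d) _ _ hp) (G := F) e.symm fun v w => ?_
  rw [Option.map_eq_some_iff]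
  constructor
  · rintro ⟨a, ha, rfl⟩
    rwa [e.symm_apply_apply]
  · intro h
    exact ⟨_, h, e.apply_symm_apply w⟩

theorem exists_cut_equiv_of_iso {F G : Forest} (hFG : LRF.cls F = LRF.cls G) :
    ∃ e : F.Cut ≃ G.Cut, ∀ c, LRF.cls (F.restrict c.pruned) = LRF.cls (G.restrict (e c).pruned) ∧
      LRF.cls (F.restrict c.prunedᶜ) = LRF.cls (G.restrict (e c).prunedᶜ) := by
  obtain ⟨e, he⟩ := exists_equiv hFG
  have he' : ∀ v w, F.parent (e.symm v) = some (e.symm w) ↔ G.parent v = some w := by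
    intro v w
    rw [he, e.apply_symm_apply, e.apply_symm_apply]
  let d : F.Lower ≃ G.Lower := (Equiv.Set.congr e).subtypeEquiv fun S => by
    constructor
    · rintro hS v w hvw ⟨w, hw, rfl⟩
      exact ⟨e.symm v, hS _ w (by simpa using (he' _ _).2 hvw) hw, by simp⟩
    · intro hS v w hvw hw
      obtain ⟨v', hv', h⟩ := hS _ _ ((he _ _).1 hvw) ⟨w, hw, rfl⟩
      rwa [← e.injective h]
  have key : ∀ S : Set F.V, LRF.cls (F.restrict S) = LRF.cls (G.restrict (e '' S)) := fun S =>
    iso_of_equiv (F := F.restrict S) (G := G.restrict (e '' S)) (e.image S) fun v w => by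
      rw [restrict_parent_iff, restrict_parent_iff]
      exact he _ _
  refine ⟨(cutEquiv F).trans (d.trans (cutEquiv G).symm), fun c => ?_⟩
  have h1 : ((cutEquiv F).trans (d.trans (cutEquiv G).symm) c).pruned = e '' c.pruned :=
    pruned_symm (d (cutEquiv F c))
  refine ⟨(key _).trans (restrict_congr h1.symm), (key _).trans (restrict_congr ?_)⟩
  rw [h1, Set.image_compl_eq e.bijective]

/-- Both sides parametrize nested pairs `A ⊆ B` of sets closed under descendants; the three pieces
are the forests on `A`, on `B \ A` and on the complement of `B`. -/
theorem exists_cut_cut_equiv (F : Forest) :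
    ∃ e : (Σ c : F.Cut, (F.restrict c.pruned).Cut) ≃ Σ c : F.Cut, (F.restrict c.prunedᶜ).Cut, ∀ p,
      LRF.cls ((F.restrict p.1.pruned).restrict p.2.pruned) =
        LRF.cls (F.restrict (e p).1.pruned) ∧
      LRF.cls ((F.restrict p.1.pruned).restrict p.2.prunedᶜ) =
        LRF.cls ((F.restrict (e p).1.prunedᶜ).restrict (e p).2.pruned) ∧
      LRF.cls (F.restrict p.1.prunedᶜ) =
        LRF.cls ((F.restrict (e p).1.prunedᶜ).restrict (e p).2.prunedᶜ) := by
  let e₁ : (Σ c : F.Cut, (F.restrict c.pruned).Cut) ≃ Σ S : F.Lower, (F.restrict S.1).Lower :=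
    Equiv.sigmaCongr (cutEquiv F) fun c => cutEquiv _
  let e₂ : (Σ c : F.Cut, (F.restrict c.prunedᶜ).Cut) ≃ Σ S : F.Lower, (F.restrict S.1ᶜ).Lower :=
    Equiv.sigmaCongr (cutEquiv F) fun c => cutEquiv _
  refine ⟨(e₁.trans ((lowerPairEquiv F).trans (lowerPairEquiv' F).symm)).trans e₂.symm,
    fun p => ?_⟩
  set q := ((e₁.trans ((lowerPairEquiv F).trans (lowerPairEquiv' F).symm)).trans e₂.symm) p
    with hq
  have h1 : lowerPairEquiv' F (e₂ q) = lowerPairEquiv F (e₁ p) := by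
    rw [hq, Equiv.trans_apply, Equiv.apply_symm_apply, Equiv.trans_apply, Equiv.trans_apply,
      Equiv.apply_symm_apply]
  have h2 := congrArg (fun x => x.1.1.1) h1
  have h3 := congrArg (fun x => x.1.2.1) h1
  change q.1.pruned = Subtype.val '' p.2.pruned at h2
  change q.1.pruned ∪ Subtype.val '' q.2.pruned = p.1.pruned at h3
  have h4 : Subtype.val '' q.2.pruned ⊆ q.1.prunedᶜ := by
    rintro _ ⟨v, _, rfl⟩
    exact v.2
  refine ⟨?_, ?_, ?_⟩
  · exact (restrict_restrict _ _ _).trans (restrict_congr h2.symm)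
  · refine (restrict_restrict _ _ _).trans
      ((restrict_congr ?_).trans (restrict_restrict _ _ _).symm)
    rw [Set.image_val_compl, ← h2, ← h3]
    ext v
    have := @h4 v
    simp only [Set.mem_sdiff, Set.mem_union, Set.mem_compl_iff] at this ⊢
    tauto
  · refine (restrict_congr ?_).trans (restrict_restrict _ _ _).symm
    rw [Set.image_val_compl, ← h3, Set.compl_union]
    rfl

/-- The lower sets in a disjoint union. -/
def lowerSumEquiv (F G : Forest) : (F.sum G).Lower ≃ F.Lower × G.Lower where
  toFun S := (⟨Sum.inl ⁻¹' S.1, fun v w h hw => S.2 _ _ ((sum_parent_inl F G v w).2 h) hw⟩,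
    ⟨Sum.inr ⁻¹' S.1, fun v w h hw => S.2 _ _ ((sum_parent_inr F G v w).2 h) hw⟩)
  invFun p := ⟨Sum.inl '' p.1.1 ∪ Sum.inr '' p.2.1, by
    rintro (v | v) (w | w) h hw
    · simp at hw ⊢
      exact p.1.2 _ _ ((sum_parent_inl F G v w).1 h) hw
    · simp at h
    · simp at h
    · simp at hw ⊢
      exact p.2.2 _ _ ((sum_parent_inr F G v w).1 h) hw⟩
  left_inv S := Subtype.ext (by ext (v | v) <;> simp)
  right_inv p := Prod.ext (Subtype.ext (by ext v; simp)) (Subtype.ext (by ext v; simp))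

theorem restrict_sum (F G : Forest) (S : Set (F.V ⊕ G.V)) : LRF.cls ((F.sum G).restrict S) =
    LRF.cls (F.restrict (Sum.inl ⁻¹' S)) + LRF.cls (G.restrict (Sum.inr ⁻¹' S)) := by
  refine (iso_of_equiv (F := (F.restrict (Sum.inl ⁻¹' S)).sum (G.restrict (Sum.inr ⁻¹' S)))
    (G := (F.sum G).restrict S) (Equiv.subtypeSum (p := fun x => x ∈ S)).symm ?_).symm
  rintro (v | v) (w | w)
  · rw [sum_parent_inl, restrict_parent_iff, restrict_parent_iff]
    exact (sum_parent_inl F G v w).symm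
  · rw [restrict_parent_iff]
    change Option.map Sum.inl _ = some (Sum.inr _) ↔ Option.map Sum.inl _ = some (Sum.inr _)
    rw [Option.map_eq_some_iff, Option.map_eq_some_iff]
    simp
  · rw [restrict_parent_iff]
    change Option.map Sum.inr _ = some (Sum.inl _) ↔ Option.map Sum.inr _ = some (Sum.inl _)
    rw [Option.map_eq_some_iff, Option.map_eq_some_iff]
    simp
  · rw [sum_parent_inr, restrict_parent_iff, restrict_parent_iff]
    exact (sum_parent_inr F G v w).symm

theorem exists_cut_sum_equiv (F G : Forest) : ∃ e : (F.sum G).Cut ≃ F.Cut × G.Cut, ∀ c,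
    LRF.cls ((F.sum G).restrict c.pruned) =
      LRF.cls (F.restrict (e c).1.pruned) + LRF.cls (G.restrict (e c).2.pruned) ∧
    LRF.cls ((F.sum G).restrict c.prunedᶜ) =
      LRF.cls (F.restrict (e c).1.prunedᶜ) + LRF.cls (G.restrict (e c).2.prunedᶜ) := by
  refine ⟨(cutEquiv _).trans ((lowerSumEquiv F G).trans
    ((cutEquiv F).symm.prodCongr (cutEquiv G).symm)), fun c => ?_⟩
  set q := ((cutEquiv _).trans ((lowerSumEquiv F G).trans
    ((cutEquiv F).symm.prodCongr (cutEquiv G).symm))) c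
  have h1 : q.1.pruned = Sum.inl ⁻¹' c.pruned := pruned_symm _
  have h2 : q.2.pruned = Sum.inr ⁻¹' c.pruned := pruned_symm _
  rw [restrict_sum, restrict_sum, Set.preimage_compl, Set.preimage_compl, ← h1, ← h2]
  exact ⟨rfl, rfl⟩

theorem exists_cut_empty (F : Forest) : ∃ c₀ : F.Cut, LRF.cls (F.restrict c₀.pruned) = 0 ∧
    LRF.cls (F.restrict c₀.prunedᶜ) = LRF.cls F ∧
    ∀ c : F.Cut, LRF.cls (F.restrict c.pruned) = 0 → c = c₀ := by
  refine ⟨(cutEquiv F).symm ⟨∅, fun _ _ _ h => h⟩, ?_, ?_, fun c hc => ?_⟩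
  · exact (restrict_congr (pruned_symm _)).trans (restrict_empty F)
  · exact (restrict_congr (by rw [pruned_symm, Set.compl_empty])).trans (restrict_univ F)
  · exact (Equiv.eq_symm_apply _).2 (Subtype.ext (eq_empty_of_restrict hc))

theorem exists_cut_full (F : Forest) : ∃ c₀ : F.Cut, LRF.cls (F.restrict c₀.prunedᶜ) = 0 ∧
    LRF.cls (F.restrict c₀.pruned) = LRF.cls F ∧
    ∀ c : F.Cut, LRF.cls (F.restrict c.prunedᶜ) = 0 → c = c₀ := by
  refine ⟨(cutEquiv F).symm ⟨Set.univ, fun _ _ _ _ => Set.mem_univ _⟩, ?_, ?_, fun c hc => ?_⟩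
  · exact (restrict_congr (by rw [pruned_symm, Set.compl_univ])).trans (restrict_empty F)
  · exact (restrict_congr (pruned_symm _)).trans (restrict_univ F)
  · exact (Equiv.eq_symm_apply _).2 (Subtype.ext (Set.compl_empty_iff.1 (eq_empty_of_restrict hc)))

theorem isGraded : LRF.IsGraded deg where
  cls_zero := rfl
  cls_sum _ _ := rfl
  finite_deg := finite_deg
  eq_zero := by
    rintro ⟨F⟩ hF
    have := F.finite
    exact cls_eq_zero_of_isEmpty (Finite.card_eq_zero_iff.1 hF)
  deg_sub (F : Forest) (c : F.Cut) := by
    have := F.finite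
    exact (Set.ncard_add_ncard_compl c.pruned : _)
  sub_congr _ _ hFG := exists_cut_equiv_of_iso hFG
  sub_sub := exists_cut_cut_equiv
  sub_sum := exists_cut_sum_equiv
  sub_bot := exists_cut_empty
  sub_top := exists_cut_full

end Forest

open Relation

/-! ### Diagrams of half-edges

A Feynman graph, its subgraphs and its contractions are all described by relations on the set of
half-edges of the graph. -/

/-- A graph whose half-edges are among the elements of `H`: the partial equivalence relation of
belonging to the same vertex, and adjacency. -/
structure Diagram (H : Type) where
  vr : H → H → Prop
  adj : H → H → Prop

namespace Diagram

variable {H : Type}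

@[ext]
theorem ext {X Y : Diagram H} (h1 : ∀ h k, X.vr h k ↔ Y.vr h k)
    (h2 : ∀ h k, X.adj h k ↔ Y.adj h k) : X = Y := by
  obtain ⟨v, a⟩ := X
  obtain ⟨v', a'⟩ := Y
  obtain rfl : v = v' := funext fun h => funext fun k => propext (h1 h k)
  obtain rfl : a = a' := funext fun h => funext fun k => propext (h2 h k)
  rfl

/-- Two half-edges belong to the same connected component. -/
def cn (X : Diagram H) (h k : H) : Prop :=
  X.vr h h ∧ ReflTransGen (fun a b => X.vr a b ∨ X.adj a b) h k

/-- The external half-edges of the component of `h`. -/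
def legs (X : Diagram H) (h : H) : Set H := {k | X.cn h k ∧ ∀ l, ¬ X.adj k l}

/-- The elements with `vr h h` are the half-edges actually present. On them `vr` is an equivalence
relation whose classes are the vertices, and `adj` is a partial matching. -/
structure Basic (X : Diagram H) : Prop where
  vr_symm : ∀ {h k}, X.vr h k → X.vr k h
  vr_trans : ∀ {h k l}, X.vr h k → X.vr k l → X.vr h l
  adj_symm : ∀ {h k}, X.adj h k → X.adj k h
  adj_irrefl : ∀ {h}, ¬ X.adj h h
  adj_unique : ∀ {h k l}, X.adj h k → X.adj h l → k = l
  adj_mem : ∀ {h k}, X.adj h k → X.vr h h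

/-- Feynman graphs. One-particle irreducibility says that no set of vertices is joined to its
complement by exactly one edge. -/
structure Feynman (X : Diagram H) : Prop extends X.Basic where
  trivalent : ∀ {h}, X.vr h h → {k | X.vr h k}.ncard = 3
  legs_card : ∀ {h}, X.vr h h → (X.legs h).ncard = 2 ∨ (X.legs h).ncard = 3
  loop : ∀ {h}, X.vr h h → ∃ k l, X.cn h k ∧ X.adj k l
  irreducible : ∀ S : Set H, (∀ a b, X.vr a b → a ∈ S → b ∈ S) → ∀ {h k}, X.adj h k →
    (∀ a b, X.adj a b → a ≠ h → a ≠ k → a ∈ S → b ∈ S) → h ∈ S → k ∈ S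

theorem cn.mem_of_closed {X : Diagram H} {S : Set H} (h1 : ∀ a b, X.vr a b → a ∈ S → b ∈ S)
    (h2 : ∀ a b, X.adj a b → a ∈ S → b ∈ S) {h k : H} (hk : X.cn h k) (hS : h ∈ S) : k ∈ S := by
  obtain ⟨-, hk⟩ := hk
  induction hk with
  | refl => exact hS
  | tail _ hs ih => exact hs.elim (fun h => h1 _ _ h ih) fun h => h2 _ _ h ih

namespace Basic

variable {X : Diagram H} (hX : X.Basic)
include hX

theorem vr_left {h k : H} (hk : X.vr h k) : X.vr h h := hX.vr_trans hk (hX.vr_symm hk)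

theorem vr_right {h k : H} (hk : X.vr h k) : X.vr k k := hX.vr_trans (hX.vr_symm hk) hk

theorem adj_mem_right {h k : H} (hk : X.adj h k) : X.vr k k := hX.adj_mem (hX.adj_symm hk)

theorem cn_mem_right {h k : H} (hk : X.cn h k) : X.vr k k := by
  obtain ⟨h0, hk⟩ := hk
  induction hk with
  | refl => exact h0
  | tail _ hs _ => exact hs.elim hX.vr_right hX.adj_mem_right

omit hX in
theorem cn_refl {h : H} (hh : X.vr h h) : X.cn h h := ⟨hh, .refl⟩

theorem cn_of_vr {h k : H} (hk : X.vr h k) : X.cn h k := ⟨hX.vr_left hk, .single (.inl hk)⟩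

theorem cn_of_adj {h k : H} (hk : X.adj h k) : X.cn h k := ⟨hX.adj_mem hk, .single (.inr hk)⟩

omit hX in
theorem cn_trans {h k l : H} (hk : X.cn h k) (hl : X.cn k l) : X.cn h l :=
  ⟨hk.1, hk.2.trans hl.2⟩

theorem cn_symm {h k : H} (hk : X.cn h k) : X.cn k h := by
  refine ⟨hX.cn_mem_right hk, ?_⟩
  obtain ⟨-, hk⟩ := hk
  induction hk with
  | refl => exact .refl
  | tail _ hs ih => exact .head (hs.imp hX.vr_symm hX.adj_symm) ih

theorem cn_iff {h k : H} (hk : X.cn h k) (l : H) : X.cn h l ↔ X.cn k l :=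
  ⟨fun hl => cn_trans (hX.cn_symm hk) hl, fun hl => cn_trans hk hl⟩

theorem legs_eq {h k : H} (hk : X.cn h k) : X.legs h = X.legs k := by
  ext l
  exact and_congr_left fun _ => hX.cn_iff hk l

theorem self_mem_legs {h k : H} (hk : k ∈ X.legs h) : k ∈ X.legs k :=
  ⟨cn_refl (hX.cn_mem_right hk.1), hk.2⟩

end Basic

/-- In a Feynman graph every vertex lies on an internal edge. -/
theorem Feynman.exists_vr_adj {X : Diagram H} (hX : X.Feynman) {h : H} (hh : X.vr h h) :
    ∃ k l, X.vr h k ∧ X.adj k l := by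
  by_contra! hcon
  obtain ⟨k, l, h1, h2⟩ := hX.loop hh
  exact hcon k l (h1.mem_of_closed (S := {k | X.vr h k}) (fun a b hab ha => hX.vr_trans ha hab)
    (fun a b hab ha => absurd hab (hcon a b ha)) hh) h2

/-! ### Parts, threads and contractions of diagrams -/

/-- `Z` is a part of `X`: some of the vertices, with all their half-edges, and some of the
adjacencies. -/
structure IsSub (Z X : Diagram H) : Prop where
  vr_le : ∀ {h k}, Z.vr h k → X.vr h k
  vr_full : ∀ {h k}, Z.vr h h → X.vr h k → Z.vr h k
  adj_le : ∀ {h k}, Z.adj h k → X.adj h k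

theorem IsSub.cn {Z X : Diagram H} (h : Z.IsSub X) {a b : H} (hab : Z.cn a b) : X.cn a b :=
  ⟨h.vr_le hab.1, hab.2.lift id fun _ _ hs => hs.imp h.vr_le h.adj_le⟩

theorem IsSub.trans {W Z X : Diagram H} (h : W.IsSub Z) (h' : Z.IsSub X) : W.IsSub X where
  vr_le := fun hk => h'.vr_le (h.vr_le hk)
  vr_full := fun hh hk => h.vr_full hh (h'.vr_full (h.vr_le hh) hk)
  adj_le := fun hk => h'.adj_le (h.adj_le hk)

theorem IsSub.refl (X : Diagram H) : X.IsSub X := ⟨id, fun _ h => h, id⟩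

variable (X Z : Diagram H)

/-- The component of `h` in `Z` is not a component of `X`. -/
def Att (h : H) : Prop := ∃ k ∈ Z.legs h, ∃ l, X.adj k l

/-- The half-edges of the contraction. -/
def CMem (h : H) : Prop :=
  X.vr h h ∧ ¬ Z.vr h h ∨ h ∈ Z.legs h ∧ (Z.legs h).ncard = 3 ∧ Att X Z h

/-- The two external half-edges of a component with two external half-edges. -/
def Pass (x y : H) : Prop :=
  (Z.legs x).ncard = 2 ∧ x ∈ Z.legs x ∧ y ∈ Z.legs x ∧ x ≠ y

/-- The paths that consist of edges of `X` and of passages through components of `Z` with two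
external half-edges. -/
inductive Thread : H → H → Prop
  | edge {h k : H} : X.adj h k → Thread h k
  | through {h x y k : H} : Thread h x → Z.Pass x y → X.adj y k → Thread h k

/-- The contraction of `Z` in `X`. -/
def contract : Diagram H where
  vr h k := CMem X Z h ∧ CMem X Z k ∧ (X.vr h k ∨ Z.cn h k)
  adj h k := CMem X Z h ∧ CMem X Z k ∧ Thread X Z h k

variable {X Z}

theorem Thread.mono {Y : Diagram H} (hYX : Y.IsSub X) {h k : H} (ht : Thread Y Z h k) :
    Thread X Z h k := by
  induction ht with
  | edge h => exact .edge (hYX.adj_le h)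
  | through _ hp ha ih => exact .through ih hp (hYX.adj_le ha)

theorem CMem.mono {Y : Diagram H} (hYX : Y.IsSub X) {h : H} (hm : CMem Y Z h) : CMem X Z h := by
  rcases hm with ⟨h1, h2⟩ | ⟨h1, h2, k, hk, l, hl⟩
  · exact .inl ⟨hYX.vr_le h1, h2⟩
  · exact .inr ⟨h1, h2, k, hk, l, hYX.adj_le hl⟩

theorem contract_vr_self {h : H} : (contract X Z).vr h h ↔ CMem X Z h := by
  refine ⟨fun hh => hh.1, fun hh => ⟨hh, hh, ?_⟩⟩
  rcases hh with hh | hh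
  · exact .inl hh.1
  · exact .inr hh.1.1

theorem Thread.adj_right (hX : X.Basic) {h k : H} (ht : Thread X Z h k) : ∃ l, X.adj k l := by
  cases ht with
  | edge h => exact ⟨_, hX.adj_symm h⟩
  | through _ _ h => exact ⟨_, hX.adj_symm h⟩

theorem Thread.adj_left {h k : H} (ht : Thread X Z h k) : ∃ l, X.adj h l := by
  induction ht with
  | edge h => exact ⟨_, h⟩
  | through _ _ _ ih => exact ih

/-- The constructors extend a thread at its end; this and `Thread.head` give access to its
beginning. -/
theorem Thread.cons {h x y k : H} (ha : X.adj h x) (hp : Z.Pass x y) (ht : Thread X Z y k) :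
    Thread X Z h k := by
  induction ht with
  | edge h => exact .through (.edge ha) hp h
  | through _ hp' ha' ih => exact .through ih hp' ha'

theorem Thread.append {h x y k : H} (ht : Thread X Z h x) (hp : Z.Pass x y)
    (ht' : Thread X Z y k) : Thread X Z h k := by
  induction ht' with
  | edge h => exact .through ht hp h
  | through _ hp' ha' ih => exact .through ih hp' ha'

theorem Thread.head {h k : H} (ht : Thread X Z h k) :
    X.adj h k ∨ ∃ x y, X.adj h x ∧ Z.Pass x y ∧ Thread X Z y k := by
  induction ht with
  | edge h => exact .inl h
  | through _ hp ha ih =>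
    rcases ih with ih | ⟨x, y, h1, h2, h3⟩
    · exact .inr ⟨_, _, ih, hp, .edge ha⟩
    · exact .inr ⟨x, y, h1, h2, .through h3 hp ha⟩

theorem Pass.mem {x y : H} (hp : Z.Pass x y) : Z.vr x x := hp.2.1.1.1

theorem Pass.cn {x y : H} (hp : Z.Pass x y) : Z.cn x y := hp.2.2.1.1

theorem Pass.not_adj {x y l : H} (hp : Z.Pass x y) : ¬ Z.adj x l := hp.2.1.2 l

theorem Pass.symm (hZ : Z.Basic) {x y : H} (hp : Z.Pass x y) : Z.Pass y x := by
  have := hZ.legs_eq hp.cn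
  refine ⟨this ▸ hp.1, this ▸ hp.2.2.1, this ▸ hp.2.1, hp.2.2.2.symm⟩

theorem Pass.eq_or_eq {x y z : H} (hp : Z.Pass x y) (hz : z ∈ Z.legs x) : z = x ∨ z = y := by
  obtain ⟨a, b, hab, he⟩ := Set.ncard_eq_two.1 hp.1
  have h1 := hp.2.1
  have h2 := hp.2.2.1
  have h3 := hp.2.2.2
  rw [he] at h1 h2 hz
  simp only [Set.mem_insert_iff, Set.mem_singleton_iff] at h1 h2 hz
  grind

theorem Pass.unique {x y z : H} (hp : Z.Pass x y) (hq : Z.Pass x z) : y = z := by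
  rcases hp.eq_or_eq hq.2.2.1 with h | h
  · exact absurd h.symm hq.2.2.2
  · exact h.symm

theorem exists_pass {x : H} (h1 : (Z.legs x).ncard = 2) (h2 : x ∈ Z.legs x) :
    ∃ y, Z.Pass x y := by
  obtain ⟨a, b, hab, he⟩ := Set.ncard_eq_two.1 h1
  have h3 := h2
  rw [he] at h3
  rcases h3 with rfl | h3
  · exact ⟨b, h1, h2, by simp [he], hab⟩
  · obtain rfl : x = b := h3
    exact ⟨a, h1, h2, by simp [he], hab.symm⟩

theorem CMem.not_pass {x y : H} (hm : CMem X Z x) : ¬ Z.Pass x y := by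
  intro hp
  rcases hm with hm | hm
  · exact hm.2 hp.mem
  · have := hp.1
    omega

theorem CMem.not_adj (hZ : Z.Basic) {x l : H} (hm : CMem X Z x) : ¬ Z.adj x l := by
  intro hl
  rcases hm with hm | hm
  · exact hm.2 (hZ.adj_mem hl)
  · exact hm.1.2 l hl

/-- A part of `X` that can be contracted: a component with two external half-edges has both or none
of them adjacent to other half-edges. -/
structure Contractible (X Z : Diagram H) : Prop where
  basic : X.Basic
  feynman : Z.Feynman
  isSub : Z.IsSub X
  bridge : ∀ {x y x'}, Z.Pass x y → X.adj x x' → ∃ y', X.adj y y'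

/-- If only the leg `x` of a component with two legs were attached, the edge at `x` would be the
only edge of `X` leaving that component, against one-particle irreducibility. -/
theorem Feynman.contractible (hX : X.Feynman) (hZ : Z.Feynman) (hs : Z.IsSub X) :
    Contractible X Z where
  basic := hX.toBasic
  feynman := hZ
  isSub := hs
  bridge := by
    intro x y x' hp hx
    by_contra! hy
    have key : x' ∈ {h | Z.cn x h} := by
      refine hX.irreducible {h | Z.cn x h} ?_ hx ?_ (Basic.cn_refl hp.mem)
      · intro a b hab ha
        exact Basic.cn_trans ha (hZ.cn_of_vr (hs.vr_full (hZ.cn_mem_right ha) hab))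
      · intro a b hab h1 _ ha
        by_cases hb : ∃ c, Z.adj a c
        · obtain ⟨c, hc⟩ := hb
          rw [← hX.adj_unique (hs.adj_le hc) hab]
          exact Basic.cn_trans ha (hZ.cn_of_adj hc)
        · rcases hp.eq_or_eq ⟨ha, not_exists.1 hb⟩ with rfl | rfl
          · exact absurd rfl h1
          · exact absurd hab (hy b)
    have h1 : ∀ l, ¬ Z.adj x' l := fun l hl => by
      obtain rfl := hX.adj_unique (hX.adj_symm hx) (hs.adj_le hl)
      exact hp.not_adj (hZ.adj_symm hl)
    rcases hp.eq_or_eq ⟨key, h1⟩ with rfl | rfl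
    · exact hX.adj_irrefl hx
    · exact hy _ (hX.adj_symm hx)

/-! ### Uniqueness and existence of the ends of threads -/

namespace Contractible

variable (c : Contractible X Z)
include c

/-- A thread arriving at such a half-edge either ends there or can enter a component with two legs;
there is no third possibility. -/
theorem cMem_or_pass {h k : H} (ha : X.adj h k) (hn : ∀ l, ¬ Z.adj h l) :
    CMem X Z h ∨ ∃ y, Z.Pass h y := by
  by_cases hm : Z.vr h h
  · have hl : h ∈ Z.legs h := ⟨Basic.cn_refl hm, hn⟩
    rcases c.feynman.legs_card hm with h2 | h3
    · exact .inr (exists_pass h2 hl)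
    · exact .inl (.inr ⟨hl, h3, h, hl, k, ha⟩)
  · exact .inl (.inl ⟨c.basic.adj_mem ha, hm⟩)

theorem thread_symm {h k : H} (ht : Thread X Z h k) : Thread X Z k h := by
  induction ht with
  | edge h => exact .edge (c.basic.adj_symm h)
  | through _ hp ha ih =>
    exact .cons (c.basic.adj_symm ha) (hp.symm c.feynman.toBasic) ih

/-- Each step of a thread is forced, by uniqueness of adjacency and of the other leg. Of two threads
from `h`, one that reaches a stopping point `l` therefore extends every other. -/
theorem thread_compare {h k l : H} (hk : Thread X Z h k) (hl : Thread X Z h l)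
    (hn : ∀ y, ¬ Z.Pass l y) : k = l ∨ ∃ y, Z.Pass k y ∧ Thread X Z y l := by
  induction hk with
  | edge ha =>
    rcases hl.head with hl | ⟨x, y, h1, h2, h3⟩
    · exact .inl (c.basic.adj_unique ha hl)
    · obtain rfl := c.basic.adj_unique ha h1
      exact .inr ⟨y, h2, h3⟩
  | through _ hp ha ih =>
    rcases ih with rfl | ⟨y, h1, h2⟩
    · exact absurd hp (hn _)
    obtain rfl := hp.unique h1
    rcases h2.head with h2 | ⟨x, y, h1, h2, h3⟩
    · exact .inl (c.basic.adj_unique ha h2)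
    · obtain rfl := c.basic.adj_unique ha h1
      exact .inr ⟨y, h2, h3⟩

theorem thread_unique {h k l : H} (hk : Thread X Z h k) (hl : Thread X Z h l)
    (hkn : ∀ y, ¬ Z.Pass k y) (hn : ∀ y, ¬ Z.Pass l y) : k = l := by
  rcases c.thread_compare hk hl hn with h | ⟨y, h, _⟩
  · exact h
  · exact absurd h (hkn y)

theorem thread_not_adj {h k : H} (hk : Thread X Z h k) (hn : ∀ l, ¬ Z.adj h l) (l : H) :
    ¬ Z.adj k l := by
  intro hl
  have key : ∀ y, X.adj y k → (∀ l, ¬ Z.adj y l) → False := fun y hy hn => by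
    obtain rfl := c.basic.adj_unique (c.basic.adj_symm hy) (c.isSub.adj_le hl)
    exact hn k (c.feynman.adj_symm hl)
  cases hk with
  | edge ha => exact key _ ha hn
  | through _ hp ha => exact key _ ha fun l => (hp.symm c.feynman.toBasic).not_adj

theorem thread_cn {h k : H} (hk : Thread X Z h k) : X.cn h k := by
  induction hk with
  | edge ha => exact c.basic.cn_of_adj ha
  | through _ hp ha ih =>
    exact Basic.cn_trans ih (Basic.cn_trans (c.isSub.cn hp.cn) (c.basic.cn_of_adj ha))

omit c in
/-- Threads with a given number of passages. -/
def _root_.HallCK.Diagram.ThreadLen (X Z : Diagram H) : ℕ → H → H → Prop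
  | 0, h, k => X.adj h k
  | n + 1, h, k => ∃ x y, X.adj h x ∧ Z.Pass x y ∧ ThreadLen X Z n y k

omit c in
theorem threadLen_snoc {n : ℕ} : ∀ {h k : H}, ThreadLen X Z (n + 1) h k ↔
    ∃ x y, ThreadLen X Z n h x ∧ Z.Pass x y ∧ X.adj y k := by
  induction n with
  | zero => exact Iff.rfl
  | succ n ih =>
    intro h k
    constructor
    · rintro ⟨x, y, h1, h2, h3⟩
      obtain ⟨x', y', h4, h5, h6⟩ := ih.1 h3
      exact ⟨x', y', ⟨x, y, h1, h2, h4⟩, h5, h6⟩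
    · rintro ⟨x', y', ⟨x, y, h1, h2, h4⟩, h5, h6⟩
      exact ⟨x, y, h1, h2, ih.2 ⟨x', y', h4, h5, h6⟩⟩

omit c in
theorem Thread.exists_len {h k : H} (ht : Thread X Z h k) : ∃ n, ThreadLen X Z n h k := by
  induction ht with
  | edge h => exact ⟨0, h⟩
  | through _ hp ha ih =>
    obtain ⟨n, hn⟩ := ih
    exact ⟨n + 1, threadLen_snoc.2 ⟨_, _, hn, hp, ha⟩⟩

/-- A thread from `x` back to `x` would be its own reversal. Stripping the first and last edge and
passage gives a shorter one of the same kind, down to an edge from a half-edge to itself or a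
passage with equal legs. -/
theorem threadLen_irrefl (n : ℕ) : ∀ x, ¬ ThreadLen X Z n x x := by
  induction n using Nat.strong_induction_on with
  | _ n ih =>
  rcases n with _ | _ | n
  · exact fun x h => c.basic.adj_irrefl h
  · rintro x ⟨z, z', h1, h2, h3⟩
    exact h2.2.2.2 (c.basic.adj_unique h1 (c.basic.adj_symm h3))
  · rintro x ⟨z, z', h1, h2, h3⟩
    obtain ⟨w, w', h4, h5, h6⟩ := threadLen_snoc.1 h3
    obtain rfl := c.basic.adj_unique h1 (c.basic.adj_symm h6)
    obtain rfl := h2.unique (h5.symm c.feynman.toBasic)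
    exact ih n (by omega) _ h4

theorem thread_irrefl {x : H} : ¬ Thread X Z x x := fun h => by
  obtain ⟨n, hn⟩ := Thread.exists_len h
  exact c.threadLen_irrefl n x hn

/-- A thread that starts at `a` cannot traverse the edge between `h` and `k` in both directions:
joining one thread to the reversal of the other would lead from `a` back to `a`. -/
theorem thread_not_both {a h k : H} (hk : Thread X Z a k) (hh : Thread X Z a h)
    (ha : X.adj h k) : False := by
  cases hk with
  | edge h1 =>
    obtain rfl := c.basic.adj_unique (c.basic.adj_symm h1) (c.basic.adj_symm ha)
    exact c.thread_irrefl hh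
  | through h1 hp h2 =>
    obtain rfl := c.basic.adj_unique (c.basic.adj_symm h2) (c.basic.adj_symm ha)
    exact c.thread_irrefl (hh.append (hp.symm c.feynman.toBasic) (c.thread_symm h1))

/-- Following the thread from a half-edge, one visits only finitely many half-edges; if none of them
belongs to the contraction, then the thread closes up. -/
theorem exists_thread_or [Finite H] {h : H} (hn : ∀ l, ¬ Z.adj h l) :
    (∃ k, CMem X Z k ∧ Thread X Z h k) ∨
      ∀ k, Thread X Z h k → ∃ k' y, Thread X Z h k' ∧ Z.Pass k' y ∧ X.adj y k := by
  by_cases hex : ∃ k, CMem X Z k ∧ Thread X Z h k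
  · exact .inl hex
  right
  -- If no end lies in the contraction, every reached half-edge has a successor: pass through its
  -- component and follow the edge there, which exists by `bridge`.
  have h1 : ∀ k : {k // Thread X Z h k}, ∃ k' : {k // Thread X Z h k}, ∃ y,
      Z.Pass k.1 y ∧ X.adj y k'.1 := by
    rintro ⟨k, hk⟩
    obtain ⟨l, hl⟩ := hk.adj_right c.basic
    rcases c.cMem_or_pass hl (c.thread_not_adj hk hn) with hm | ⟨y, hy⟩
    · exact absurd ⟨k, hm, hk⟩ hex
    · obtain ⟨z, hz⟩ := c.bridge hy hl
      exact ⟨⟨z, .through hk hy hz⟩, y, hy, hz⟩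
  choose f y hy hf using h1
  -- Passages and edges can be reversed, so the successor map is injective, hence surjective on the
  -- finite set of reached half-edges: each has a predecessor.
  have hinj : Function.Injective f := by
    intro a b hab
    have h2 := hf a
    rw [hab] at h2
    have h3 := c.basic.adj_unique (c.basic.adj_symm h2) (c.basic.adj_symm (hf b))
    have h4 := (hy b).symm c.feynman.toBasic
    rw [← h3] at h4
    exact Subtype.ext (((hy a).symm c.feynman.toBasic).unique h4)
  intro k hk
  obtain ⟨k', hk'⟩ := Finite.surjective_of_injective hinj ⟨k, hk⟩
  have := hf k'
  rw [hk'] at this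
  exact ⟨k'.1, y k', k'.2, hy k', this⟩

/-- If the thread closed up, `h` would be the exit of a passage, which is impossible for a half-edge
of the contraction. -/
theorem exists_thread [Finite H] {h h' : H} (ha : X.adj h h') (hm : CMem X Z h) :
    ∃ k, CMem X Z k ∧ Thread X Z h k := by
  rcases c.exists_thread_or fun l => hm.not_adj c.feynman.toBasic with h | h
  · exact h
  obtain ⟨k', y, _, hp, hy⟩ := h h' (.edge ha)
  obtain rfl := c.basic.adj_unique (c.basic.adj_symm ha) (c.basic.adj_symm hy)
  exact absurd (hp.symm c.feynman.toBasic) hm.not_pass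

/-! #### Lifting sets of half-edges from the contraction -/

omit c in
/-- The half-edges of the contraction that are joined to the vertex of `h`, or to the component of
`h` in the contracted part. -/
def _root_.HallCK.Diagram.Ends (X Z : Diagram H) (h k : H) : Prop :=
  CMem X Z k ∧ (¬ Z.vr h h ∧ X.vr h k ∨ Z.cn h k ∨
    ∃ x y, Z.cn h x ∧ Z.Pass x y ∧ Thread X Z x k)

omit c in
/-- The largest set of half-edges whose ends lie in `S`. -/
def _root_.HallCK.Diagram.liftSet (X Z : Diagram H) (S : Set H) : Set H :=
  {h | ∀ k, Ends X Z h k → k ∈ S}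

/-- All half-edges of a component of `Z` have the same ends. With `vr_mem_liftSet`, the lift is a
union of vertices of `X` that contains each component of `Z` entirely or not at all, so
connectedness and irreducibility of `X` apply to it. -/
theorem cn_mem_liftSet {S : Set H} {a b : H} (hab : Z.cn a b) (ha : a ∈ liftSet X Z S) :
    b ∈ liftSet X Z S := by
  rintro k ⟨hk, h1⟩
  refine ha k ⟨hk, .inr ?_⟩
  rcases h1 with h1 | h1 | ⟨x, y, h1, h2⟩
  · exact absurd (c.feynman.cn_mem_right hab) h1.1
  · exact .inl (Basic.cn_trans hab h1)
  · exact .inr ⟨x, y, Basic.cn_trans hab h1, h2⟩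

theorem vr_mem_liftSet {S : Set H} {a b : H} (hab : X.vr a b) (ha : a ∈ liftSet X Z S) :
    b ∈ liftSet X Z S := by
  by_cases hb : Z.vr b b
  · exact c.cn_mem_liftSet
      (c.feynman.cn_of_vr (c.feynman.vr_symm (c.isSub.vr_full hb (c.basic.vr_symm hab)))) ha
  have ha' : ¬ Z.vr a a := fun h => hb (c.feynman.vr_right (c.isSub.vr_full h hab))
  rintro k ⟨hk, h1⟩
  refine ha k ⟨hk, .inl ⟨ha', ?_⟩⟩
  rcases h1 with h1 | h1 | ⟨x, y, h1, h2⟩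
  · exact c.basic.vr_trans hab h1.2
  · exact absurd h1.1 hb
  · exact absurd h1.1 hb

omit c in
theorem ends_self {h : H} (hm : CMem X Z h) : Ends X Z h h := by
  refine ⟨hm, ?_⟩
  rcases hm with hm | hm
  · exact .inl ⟨hm.2, hm.1⟩
  · exact .inr (.inl hm.1.1)

theorem mem_liftSet_iff {S : Set H} (hS : ∀ a b, (contract X Z).vr a b → a ∈ S → b ∈ S) {h : H}
    (hm : CMem X Z h) : h ∈ liftSet X Z S ↔ h ∈ S := by
  refine ⟨fun hh => hh h (ends_self hm), fun hh k hk => ?_⟩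
  obtain ⟨hk, h1⟩ := hk
  rcases h1 with h1 | h1 | ⟨x, y, h1, h2, _⟩
  · exact hS _ _ ⟨hm, hk, .inl h1.2⟩ hh
  · exact hS _ _ ⟨hm, hk, .inr h1⟩ hh
  · exfalso
    rcases hm with hm | hm
    · exact hm.2 h1.1
    · have h3 := h2.1
      rw [← c.feynman.legs_eq h1] at h3
      omega

/-- An edge that leaves the lift of `S` starts a thread that leaves `S`. -/
theorem liftSet_boundary {S : Set H} (hS : ∀ a b, (contract X Z).vr a b → a ∈ S → b ∈ S) {a b : H}
    (hab : X.adj a b) (ha : a ∈ liftSet X Z S) (hb : b ∉ liftSet X Z S) :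
    CMem X Z a ∧ a ∈ S ∧ ∃ k, CMem X Z k ∧ Thread X Z a k ∧ k ∉ S := by
  -- An edge of `Z` cannot leave the lift, so `a` and `b` each survive or belong to a component with
  -- two legs.
  have hna : ∀ l, ¬ Z.adj a l := fun l hl => by
    obtain rfl := c.basic.adj_unique hab (c.isSub.adj_le hl)
    exact hb (c.cn_mem_liftSet (c.feynman.cn_of_adj hl) ha)
  have hnb : ∀ l, ¬ Z.adj b l := fun l hl => by
    obtain rfl := c.basic.adj_unique (c.basic.adj_symm hab) (c.isSub.adj_le hl)
    exact hna _ (c.feynman.adj_symm hl)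
  -- the ends of a component with two legs, seen from one of the legs
  have hends : ∀ {x y k}, Z.Pass x y → Ends X Z x k → Thread X Z x k ∨ Thread X Z y k := by
    rintro x y k hp ⟨hk, h1 | h1 | ⟨z, w, h1, h2, h3⟩⟩
    · exact absurd hp.mem h1.1
    · exfalso
      rcases hk with hk | hk
      · exact hk.2 (c.feynman.cn_mem_right h1)
      · have := hp.1
        rw [c.feynman.legs_eq h1] at this
        omega
    · rcases hp.eq_or_eq ⟨h1, fun l => h2.not_adj⟩ with rfl | rfl
      · exact .inl h3
      · exact .inr h3
  have hpass : ∀ {x y k}, Z.Pass x y → CMem X Z k → Thread X Z y k → Ends X Z x k :=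
    fun hp hk ht => ⟨hk, .inr (.inr ⟨_, _, hp.cn, hp.symm c.feynman.toBasic, ht⟩)⟩
  have hpass' : ∀ {x y k}, Z.Pass x y → CMem X Z k → Thread X Z x k → Ends X Z x k :=
    fun hp hk ht => ⟨hk, .inr (.inr ⟨_, _, Basic.cn_refl hp.mem, hp, ht⟩)⟩
  -- a thread that starts with the edge from `x` to a component passes through that component
  have hnext : ∀ {x x' y' k}, X.adj x x' → Z.Pass x' y' → CMem X Z k → Thread X Z x k →
      Thread X Z y' k := by
    intro x x' y' k hx hp hk ht
    rcases ht.head with h1 | ⟨z, w, h1, h2, h3⟩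
    · obtain rfl := c.basic.adj_unique hx h1
      exact absurd hp hk.not_pass
    · obtain rfl := c.basic.adj_unique hx h1
      obtain rfl := hp.unique h2
      exact h3
  simp only [liftSet, Set.mem_ofPred_eq, not_forall] at hb
  obtain ⟨k, hkb, hk⟩ := hb
  have hkm := hkb.1
  rcases c.cMem_or_pass hab hna with hma | ⟨a', hpa⟩
  · have haS := (c.mem_liftSet_iff hS hma).1 ha
    refine ⟨hma, haS, ?_⟩
    rcases c.cMem_or_pass (c.basic.adj_symm hab) hnb with hmb | ⟨b', hpb⟩
    · refine ⟨b, hmb, .edge hab, fun hbS => hk ?_⟩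
      exact (c.mem_liftSet_iff hS hmb).2 hbS k hkb
    · refine ⟨k, hkm, ?_, hk⟩
      rcases hends hpb hkb with ht | ht
      · have := c.thread_unique ht (.edge (c.basic.adj_symm hab)) (fun _ => hkm.not_pass)
          fun _ => hma.not_pass
        exact absurd haS (this ▸ hk)
      · exact .cons hab hpb ht
  -- If `a` is a leg of a component with two legs, every end seen from `b` is also an end of that
  -- component, and `b` would be in the lift.
  · exfalso
    rcases c.cMem_or_pass (c.basic.adj_symm hab) hnb with hmb | ⟨b', hpb⟩
    · have hbS : b ∈ S := ha b (hpass' hpa hmb (.edge hab))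
      exact hk ((c.mem_liftSet_iff hS hmb).2 hbS k hkb)
    · rcases hends hpb hkb with ht | ht
      · exact hk (ha k (hpass hpa hkm (hnext (c.basic.adj_symm hab) hpa hkm ht)))
      · exact hk (ha k (hpass' hpa hkm (.cons hab hpb ht)))

/-! #### The components of the contraction -/

theorem contract_basic : (contract X Z).Basic where
  vr_symm := fun ⟨h1, h2, h3⟩ => ⟨h2, h1, h3.imp c.basic.vr_symm c.feynman.cn_symm⟩
  vr_trans := by
    rintro h k l ⟨h1, h2, h3⟩ ⟨_, h4, h5⟩
    refine ⟨h1, h4, ?_⟩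
    by_cases hZ : Z.vr h h
    · have h3' : Z.cn h k := h3.elim (fun h => c.feynman.cn_of_vr (c.isSub.vr_full hZ h)) id
      have h5' : Z.cn k l := h5.elim (fun h => c.feynman.cn_of_vr
        (c.isSub.vr_full (c.feynman.cn_mem_right h3') h)) id
      exact .inr (Basic.cn_trans h3' h5')
    · have h3' : X.vr h k := h3.elim id fun h => absurd h.1 hZ
      have hZk : ¬ Z.vr k k := fun hk => hZ
        (c.feynman.vr_right (c.isSub.vr_full hk (c.basic.vr_symm h3')))
      exact .inl (c.basic.vr_trans h3' (h5.elim id fun h => absurd h.1 hZk))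
  adj_symm := fun ⟨h1, h2, h3⟩ => ⟨h2, h1, c.thread_symm h3⟩
  adj_irrefl := fun ⟨_, _, h3⟩ => c.thread_irrefl h3
  adj_unique := fun ⟨_, h2, h3⟩ ⟨_, h5, h6⟩ =>
    c.thread_unique h3 h6 (fun _ => h2.not_pass) fun _ => h5.not_pass
  adj_mem := fun h => contract_vr_self.2 h.1

/-- For the converse, lift the component `S` of `d` in the contraction. An edge of `X` leaving the
lift would start a thread leaving `S`, so the lift contains the whole component of `d` in `X`. -/
theorem contract_cn {d e : H} (hd : CMem X Z d) :
    (contract X Z).cn d e ↔ CMem X Z e ∧ X.cn d e := by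
  constructor
  · rintro ⟨_, h⟩
    have hXd : X.vr d d := hd.elim (fun h => h.1) fun h => c.isSub.vr_le h.1.1.1
    induction h with
    | refl => exact ⟨hd, Basic.cn_refl hXd⟩
    | tail _ hs ih =>
      rcases hs with ⟨_, h2, h3⟩ | ⟨_, h2, h3⟩
      · exact ⟨h2, Basic.cn_trans ih.2 (h3.elim c.basic.cn_of_vr c.isSub.cn)⟩
      · exact ⟨h2, Basic.cn_trans ih.2 (c.thread_cn h3)⟩
  · rintro ⟨he, hde⟩
    let S : Set H := {k | (contract X Z).cn d k}
    have hS : ∀ a b, (contract X Z).vr a b → a ∈ S → b ∈ S := fun a b hab ha =>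
      Basic.cn_trans ha (c.contract_basic.cn_of_vr hab)
    refine (c.mem_liftSet_iff hS he).1 (hde.mem_of_closed (S := liftSet X Z S)
      (fun a b hab ha => c.vr_mem_liftSet hab ha) (fun a b hab ha => ?_)
      ((c.mem_liftSet_iff hS hd).2 (Basic.cn_refl (contract_vr_self.2 hd))))
    by_contra hb
    obtain ⟨h1, h2, k, h3, h4, h5⟩ := c.liftSet_boundary hS hab ha hb
    exact h5 (Basic.cn_trans h2 (c.contract_basic.cn_of_adj ⟨h1, h3, h4⟩))

/-- The components of the contracted part that are not attached are components. -/
theorem cn_of_not_att {h k : H} (hh : Z.vr h h) (hn : ¬ Att X Z h) (hk : X.cn h k) : Z.cn h k := by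
  refine hk.mem_of_closed (S := {k | Z.cn h k}) (fun a b hab ha => ?_) (fun a b hab ha => ?_)
    (Basic.cn_refl hh)
  · exact Basic.cn_trans ha (c.feynman.cn_of_vr (c.isSub.vr_full (c.feynman.cn_mem_right ha) hab))
  · by_cases hb : ∃ l, Z.adj a l
    · obtain ⟨l, hl⟩ := hb
      rw [← c.basic.adj_unique (c.isSub.adj_le hl) hab]
      exact Basic.cn_trans ha (c.feynman.cn_of_adj hl)
    · exact absurd ⟨a, ⟨ha, not_exists.1 hb⟩, b, hab⟩ hn

theorem legs_of_not_att {h : H} (hh : Z.vr h h) (hn : ¬ Att X Z h) : X.legs h = Z.legs h := by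
  ext k
  constructor
  · rintro ⟨h1, h2⟩
    exact ⟨c.cn_of_not_att hh hn h1, fun l hl => h2 l (c.isSub.adj_le hl)⟩
  · intro hk
    exact ⟨c.isSub.cn hk.1, fun l hl => hn ⟨k, hk, l, hl⟩⟩

theorem att_iff_of_pass {x y : H} (hp : Z.Pass x y) : Att X Z x ↔ ∃ l, X.adj x l := by
  constructor
  · rintro ⟨k, hk, l, hl⟩
    rcases hp.eq_or_eq hk with rfl | rfl
    · exact ⟨l, hl⟩
    · exact c.bridge (hp.symm c.feynman.toBasic) hl
  · rintro ⟨l, hl⟩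
    exact ⟨x, hp.2.1, l, hl⟩

omit c in
theorem _root_.HallCK.Diagram.CMem.att {d : H} (hd : CMem X Z d) (hZ : Z.vr d d) : Att X Z d := by
  rcases hd with hd | hd
  · exact absurd hZ hd.2
  · exact hd.2.2

/-- A surviving half-edge on an internal edge of `X` starts a thread, so it stays internal. No leg
of `X` is lost: a removed component with two legs that is attached has both legs on edges of `X`, by
`bridge`. -/
theorem contract_legs [Finite H] {d : H} (hd : CMem X Z d) :
    (contract X Z).legs d = X.legs d := by
  ext k
  constructor
  · rintro ⟨h1, h2⟩
    obtain ⟨h3, h4⟩ := (c.contract_cn hd).1 h1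
    refine ⟨h4, fun l hl => ?_⟩
    obtain ⟨b, hb, ht⟩ := c.exists_thread hl h3
    exact h2 b ⟨h3, hb, ht⟩
  · rintro ⟨h1, h2⟩
    have hk : CMem X Z k := by
      by_cases hZ : Z.vr k k
      · have hl : k ∈ Z.legs k := ⟨Basic.cn_refl hZ, fun l hl => h2 l (c.isSub.adj_le hl)⟩
        have hatt : Att X Z k := by
          by_contra hn
          have h3 := c.cn_of_not_att hZ hn (c.basic.cn_symm h1)
          refine hn ?_
          have := hd.att (c.feynman.cn_mem_right h3)
          unfold Att at this ⊢
          rwa [c.feynman.legs_eq h3]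
        rcases c.feynman.legs_card hZ with h3 | h3
        · obtain ⟨y, hy⟩ := exists_pass h3 hl
          obtain ⟨l, hl⟩ := (c.att_iff_of_pass hy).1 hatt
          exact absurd hl (h2 l)
        · exact .inr ⟨hl, h3, hatt⟩
      · exact .inl ⟨c.basic.cn_mem_right h1, hZ⟩
    refine ⟨(c.contract_cn hd).2 ⟨hk, h1⟩, fun l hl => ?_⟩
    obtain ⟨l', hl'⟩ := hl.2.2.adj_left
    exact h2 l' hl'

end Contractible

/-- The contraction of a Feynman subgraph is a Feynman graph. -/
theorem Feynman.contract [Finite H] (hX : X.Feynman) (hZ : Z.Feynman) (hs : Z.IsSub X) :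
    (contract X Z).Feynman :=
  have c := hX.contractible hZ hs
  { c.contract_basic with
    trivalent := by
      intro h hh
      replace hh := contract_vr_self.1 hh
      by_cases hm : Z.vr h h
      · rcases hh with hh | hh
        · exact absurd hm hh.2
        have : {k | (Diagram.contract X Z).vr h k} = Z.legs h := by
          ext k
          constructor
          · rintro ⟨_, h2, h3⟩
            have h4 : Z.cn h k := h3.elim (fun h => hZ.cn_of_vr (hs.vr_full hm h)) id
            exact ⟨h4, fun l => h2.not_adj hZ.toBasic⟩
          · intro hk
            refine ⟨.inr hh, .inr ⟨hZ.self_mem_legs hk, ?_, ?_⟩, .inr hk.1⟩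
            · rw [← hZ.legs_eq hk.1]
              exact hh.2.1
            · have := hh.2.2
              unfold Att at this ⊢
              rwa [← hZ.legs_eq hk.1]
        rw [this]
        exact hh.2.1
      · rcases hh with hh | hh
        swap
        · exact absurd hh.1.1.1 hm
        have : {k | (Diagram.contract X Z).vr h k} = {k | X.vr h k} := by
          ext k
          constructor
          · rintro ⟨_, h2, h3⟩
            exact h3.elim id fun h => absurd h.1 hm
          · intro hk
            refine ⟨.inl hh, .inl ⟨hX.vr_right hk, fun hZk => hm ?_⟩, .inl hk⟩
            exact hZ.vr_right (hs.vr_full hZk (hX.vr_symm hk))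
        rw [this]
        exact hX.trivalent hh.1
    legs_card := by
      intro h hh
      have hm := contract_vr_self.1 hh
      rw [c.contract_legs hm]
      exact hX.legs_card (hm.elim (fun h => h.1) fun h => hs.vr_le h.1.1.1)
    loop := by
      intro h hh
      have hm := contract_vr_self.1 hh
      obtain ⟨k, l, hhk, hk, hl⟩ : ∃ k l, (Diagram.contract X Z).vr h k ∧ CMem X Z k ∧
          X.adj k l := by
        by_cases hZh : Z.vr h h
        · rcases hm with hm | hm
          · exact absurd hZh hm.2
          obtain ⟨k, hk, l, hl⟩ := hm.2.2
          have hkm : CMem X Z k := by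
            refine .inr ⟨hZ.self_mem_legs hk, ?_, ?_⟩
            · rw [← hZ.legs_eq hk.1]
              exact hm.2.1
            · have := hm.2.2
              unfold Att at this ⊢
              rwa [← hZ.legs_eq hk.1]
          exact ⟨k, l, ⟨.inr hm, hkm, .inr hk.1⟩, hkm, hl⟩
        · have hXh : X.vr h h := hm.elim (fun h => h.1) fun h => hs.vr_le h.1.1.1
          obtain ⟨k, l, hk, hl⟩ := hX.exists_vr_adj hXh
          have hkm : CMem X Z k := .inl ⟨hX.vr_right hk, fun hZk => hZh
            (hZ.vr_right (hs.vr_full hZk (hX.vr_symm hk)))⟩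
          exact ⟨k, l, ⟨hm, hkm, .inl hk⟩, hkm, hl⟩
      obtain ⟨b, hb, ht⟩ := c.exists_thread hl hk
      exact ⟨k, b, c.contract_basic.cn_of_vr hhk, hk, hb, ht⟩
    irreducible := by
      rintro S hS h k ⟨hh, hk, ht⟩ hother hhS
      by_contra hkS
      obtain ⟨l, hl⟩ := ht.adj_left
      have h1 : h ∈ liftSet X Z S := (c.mem_liftSet_iff hS hh).2 hhS
      -- Any edge leaving the lift of `S` starts a thread leaving `S`, which by assumption starts at
      -- `h`. So only the first edge of that thread could leave, and irreducibility of `X` forbids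
      -- this.
      have h2 : l ∈ liftSet X Z S := by
        refine hX.irreducible _ (fun a b => c.vr_mem_liftSet) hl (fun a b hab hah hal ha => ?_) h1
        by_contra hb
        obtain ⟨h3, h4, e, h5, h6, h7⟩ := c.liftSet_boundary hS hab ha hb
        have hak : a ≠ k := fun h => hkS (h ▸ h4)
        exact h7 (hother a e ⟨h3, h5, h6⟩ hah hak h4)
      refine hkS (h2 k ?_)
      rcases ht.head with h3 | ⟨x, y, h3, h4, h5⟩
      · obtain rfl := hX.adj_unique hl h3
        exact Contractible.ends_self hk
      · obtain rfl := hX.adj_unique hl h3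
        exact ⟨hk, .inr (.inr ⟨y, l, h4.cn, h4.symm hZ.toBasic, h5⟩)⟩ }

end Diagram

namespace Diagram

variable {H : Type} {X Y Z K : Diagram H}

/-! ### Iterated contractions -/

/-- Unlike in `Contractible.exists_thread`, `h` need not survive. If the thread never reached the
contraction, it would be a closed chain of components with two legs, and their union would contain a
component of `X` without legs. -/
theorem Feynman.exists_thread [Finite H] (hX : X.Feynman) (hZ : Z.Feynman) (hs : Z.IsSub X)
    {h h' : H} (ha : X.adj h h') (hn : ∀ l, ¬ Z.adj h l) : ∃ k, CMem X Z k ∧ Thread X Z h k := by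
  have c := hX.contractible hZ hs
  by_contra hex
  have hclosed := (c.exists_thread_or hn).resolve_left hex
  have hpass : ∀ {k}, Thread X Z h k → ∃ y, Z.Pass k y := fun hk => by
    obtain ⟨l, hl⟩ := hk.adj_right hX.toBasic
    exact (c.cMem_or_pass hl (c.thread_not_adj hk hn)).resolve_left fun hm => hex ⟨_, hm, hk⟩
  let S : Set H := {a | ∃ k, Thread X Z h k ∧ Z.cn k a}
  have hmem : ∀ {k}, Thread X Z h k → k ∈ S := fun hk => by
    obtain ⟨y, hy⟩ := hpass hk
    exact ⟨_, hk, Basic.cn_refl hy.mem⟩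
  have hh' : Thread X Z h h' := .edge ha
  have hne : (X.legs h').Nonempty := by
    refine Set.nonempty_of_ncard_ne_zero ?_
    rcases hX.legs_card (hX.adj_mem_right ha) with h2 | h3 <;> omega
  obtain ⟨e, he⟩ := hne
  have heS : e ∈ S := by
    refine he.1.mem_of_closed (S := S) ?_ ?_ (hmem hh')
    · rintro a b hab ⟨k, hk, hka⟩
      exact ⟨k, hk, Basic.cn_trans hka (hZ.cn_of_vr (hs.vr_full (hZ.cn_mem_right hka) hab))⟩
    · rintro a b hab ⟨k, hk, hka⟩
      by_cases hl : ∃ l, Z.adj a l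
      · obtain ⟨l, hl⟩ := hl
        rw [← hX.adj_unique (hs.adj_le hl) hab]
        exact ⟨k, hk, Basic.cn_trans hka (hZ.cn_of_adj hl)⟩
      obtain ⟨z, hz⟩ := hpass hk
      rcases hz.eq_or_eq ⟨hka, not_exists.1 hl⟩ with rfl | rfl
      · obtain ⟨k', y, hk', hy, hya⟩ := hclosed a hk
        rw [hX.adj_unique hab (hX.adj_symm hya)]
        exact ⟨k', hk', hy.cn⟩
      · exact hmem (.through hk hz hab)
  obtain ⟨k, hk, hke⟩ := heS
  obtain ⟨z, hz⟩ := hpass hk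
  obtain ⟨l, hl⟩ := hk.adj_right hX.toBasic
  rcases hz.eq_or_eq ⟨hke, fun l hl => he.2 l (hs.adj_le hl)⟩ with rfl | rfl
  · exact he.2 l hl
  · obtain ⟨l', hl'⟩ := c.bridge hz hl
    exact he.2 l' hl'

theorem IsSub.contract (hX : X.Basic) (hY : Y.Basic) (hZ : Z.Basic) (hZY : Z.IsSub Y) (hYX : Y.IsSub X) :
    (contract Y Z).IsSub (contract X Z) where
  vr_le := fun ⟨h1, h2, h3⟩ => ⟨h1.mono hYX, h2.mono hYX, h3.imp hYX.vr_le id⟩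
  adj_le := fun ⟨h1, h2, h3⟩ => ⟨h1.mono hYX, h2.mono hYX, h3.mono hYX⟩
  vr_full := by
    rintro h k ⟨hm, -, -⟩ ⟨-, hk, h3⟩
    have hs := hZY.trans hYX
    rcases hm with hm | hm
    · have hXk : X.vr h k := h3.elim id fun h => absurd h.1 hm.2
      have hYk := hYX.vr_full hm.1 hXk
      refine ⟨.inl hm, .inl ⟨?_, fun hZk => hm.2 ?_⟩, .inl hYk⟩
      · exact hY.vr_right hYk
      · exact hZ.vr_right (hs.vr_full hZk (hX.vr_symm hXk))
    · have hZk : Z.cn h k := h3.elim (fun h => hZ.cn_of_vr (hs.vr_full hm.1.1.1 h)) id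
      refine ⟨.inr hm, .inr ?_, .inr hZk⟩
      rcases hk with hk | hk
      · exact absurd (hZ.cn_mem_right hZk) hk.2
      · refine ⟨hk.1, hk.2.1, ?_⟩
        have := hm.2.2
        unfold Att at this ⊢
        rwa [← hZ.legs_eq hZk]

section Chain

variable [Finite H] (hX : X.Feynman) (hY : Y.Feynman) (hZ : Z.Feynman) (hZY : Z.IsSub Y)
  (hYX : Y.IsSub X)
include hX hY hZ hZY hYX

omit [Finite H] hX hYX in
-- An attached component of `Z` with three legs survives as a vertex, and one with two legs has no
-- leg that is external in `Y`. So `x` can disappear from `Y/Z` only with a whole component of `Y`.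
theorem not_att_of_leg {x : H} (hx : x ∈ Y.legs x) (hm : ¬ CMem Y Z x) :
    Z.vr x x ∧ ¬ Att Y Z x := by
  have c := hY.contractible hZ hZY
  have hZx : Z.vr x x := by
    by_contra h
    exact hm (.inl ⟨hx.1.1, h⟩)
  refine ⟨hZx, fun hatt => ?_⟩
  have hl : x ∈ Z.legs x := ⟨Basic.cn_refl hZx, fun l hl => hx.2 l (hZY.adj_le hl)⟩
  rcases hZ.legs_card hZx with h2 | h3
  · obtain ⟨y, hy⟩ := exists_pass h2 hl
    obtain ⟨l, hl⟩ := (c.att_iff_of_pass hy).1 hatt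
    exact hx.2 l hl
  · exact hm (.inr ⟨hl, h3, hatt⟩)

omit hX hYX in
theorem pass_contract_iff {x y : H} :
    (contract Y Z).Pass x y ↔ CMem Y Z x ∧ Y.Pass x y := by
  have c := hY.contractible hZ hZY
  constructor
  · intro hp
    have hm : CMem Y Z x := contract_vr_self.1 hp.mem
    refine ⟨hm, ?_⟩
    unfold Pass at hp ⊢
    rwa [c.contract_legs hm] at hp
  · rintro ⟨hm, hp⟩
    unfold Pass at hp ⊢
    rwa [c.contract_legs hm]

omit [Finite H] in
-- Starting from a half-edge that is not internal in `Y`, the thread uses no edge of `Y`. The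
-- components of `Z` that it passes are then not attached in `Y`, hence are components of `Y`.
theorem Thread.of_contract {h k : H} (ht : Thread X Z h k) (hn : ∀ l, ¬ Y.adj h l) :
    Thread X Y h k ∧ ∀ l, ¬ Y.adj k l := by
  have c := hY.contractible hZ hZY
  have key : ∀ {y k}, X.adj y k → (∀ l, ¬ Y.adj y l) → ∀ l, ¬ Y.adj k l := by
    intro y k hyk hy l hl
    obtain rfl := hX.adj_unique (hX.adj_symm hyk) (hYX.adj_le hl)
    exact hy k (hY.adj_symm hl)
  induction ht with
  | edge ha => exact ⟨.edge ha, key ha hn⟩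
  | @through x y k ht hp ha ih =>
    have hatt : ¬ Att Y Z x := fun h => by
      obtain ⟨l, hl⟩ := (c.att_iff_of_pass hp).1 h
      exact ih.2 l hl
    have hp' : Y.Pass x y := by
      unfold Pass
      rw [c.legs_of_not_att hp.mem hatt]
      exact hp
    exact ⟨.through ih.1 hp' ha, key ha fun l => (hp'.symm hY.toBasic).not_adj⟩

/-- A component of `Y` with three legs that is also a component of `Z` becomes a vertex already in
`X/Z` and lies outside `Y/Z`. The other ones that become vertices do so in the second contraction.
-/
theorem cMem_contract_iff {h : H} :
    CMem (contract X Z) (contract Y Z) h ↔ CMem X Y h := by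
  have cY := hY.contractible hZ hZY
  have cX := hX.contractible hZ (hZY.trans hYX)
  have hle : CMem Y Z h → Y.vr h h := fun hm => hm.elim (fun h => h.1) fun h => hZY.vr_le h.1.1.1
  constructor
  · rintro (⟨h1, h2⟩ | ⟨h1, h2, h3⟩)
    · rw [contract_vr_self] at h1 h2
      rcases h1 with h1 | h1
      · exact .inl ⟨h1.1, fun h => h2 (.inl ⟨h, h1.2⟩)⟩
      · have hatt : ¬ Att Y Z h := fun ha => h2 (.inr ⟨h1.1, h1.2.1, ha⟩)
        right
        unfold Att
        rw [cY.legs_of_not_att h1.1.1.1 hatt]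
        exact h1
    · have hm : CMem Y Z h := contract_vr_self.1 h1.1.1
      obtain ⟨k, hk, l, hl⟩ := h3
      rw [cY.contract_legs hm] at h1 h2 hk
      obtain ⟨l', hl'⟩ := hl.2.2.adj_left
      exact .inr ⟨h1, h2, k, hk, l', hl'⟩
  · rintro (⟨h1, h2⟩ | ⟨h1, h2, k, hk, l, hl⟩)
    · refine .inl ⟨contract_vr_self.2 (.inl ⟨h1, fun h => h2 (hZY.vr_le h)⟩), fun h => h2 ?_⟩
      exact hle (contract_vr_self.1 h)
    · by_cases hm : CMem Y Z h
      · refine .inr ?_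
        unfold Att
        rw [cY.contract_legs hm]
        refine ⟨h1, h2, k, hk, ?_⟩
        rw [← cY.contract_legs hm] at hk
        have hkm : CMem X Z k := (contract_vr_self.1 (cY.contract_basic.cn_mem_right hk.1)).mono hYX
        obtain ⟨b, hb, ht⟩ := cX.exists_thread hl hkm
        exact ⟨b, hkm, hb, ht⟩
      · obtain ⟨hZh, hatt⟩ := not_att_of_leg hY hZ hZY h1 hm
        rw [cY.legs_of_not_att hZh hatt] at h1 h2 hk
        refine .inl ⟨contract_vr_self.2 (.inr ⟨h1, h2, k, hk, l, hl⟩), fun h => hm ?_⟩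
        exact contract_vr_self.1 h

/-- All diagrams share one set of half-edges, so the isomorphism of iterated quotients is an
equality. For adjacency, a thread of `X/Z` through `Y/Z` is expanded by concatenating threads, and a
thread of `X` through `Y` is cut wherever it meets a half-edge that survives in `Y/Z`. -/
theorem contract_contract :
    contract (contract X Z) (contract Y Z) = contract X Y := by
  have cY := hY.contractible hZ hZY
  have cX := hX.contractible hZ (hZY.trans hYX)
  have cXY := hX.contractible hY hYX
  have c' := (hX.contract hZ (hZY.trans hYX)).contractible (hY.contract hZ hZY)
    (hZY.contract hX.toBasic hY.toBasic hZ.toBasic hYX)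
  have hiff : ∀ h, CMem (contract X Z) (contract Y Z) h ↔ CMem X Y h := fun h =>
    cMem_contract_iff hX hY hZ hZY hYX
  have hle : ∀ {h}, CMem X Y h → CMem X Z h := fun {h} hm => by
    rcases (hiff h).2 hm with h1 | h1
    · exact contract_vr_self.1 h1.1
    · exact (contract_vr_self.1 h1.1.1.1).mono hYX
  have hinner : ∀ {h}, CMem X Y h → ∀ l, ¬ Y.adj h l := fun hm l => hm.not_adj hY.toBasic
  refine Diagram.ext (fun h k => ?_) fun h k => ?_
  · change CMem _ _ h ∧ CMem _ _ k ∧ _ ↔ CMem X Y h ∧ CMem X Y k ∧ _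
    rw [hiff, hiff]
    refine and_congr_right fun hh => and_congr_right fun hk => ?_
    constructor
    · rintro (⟨_, _, h3 | h3⟩ | h3)
      · exact .inl h3
      · exact .inr (hZY.cn h3)
      · exact .inr ((cY.contract_cn (contract_vr_self.1 h3.1)).1 h3).2
    · rintro (h3 | h3)
      · exact .inl ⟨hle hh, hle hk, .inl h3⟩
      · have hYh : h ∈ Y.legs h := by
          rcases hh with hh | hh
          · exact absurd h3.1 hh.2
          · exact hh.1
        by_cases hm : CMem Y Z h
        · have hk' : k ∈ Y.legs h := ⟨h3, hinner hk⟩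
          rw [← cY.contract_legs hm] at hk'
          exact .inr hk'.1
        · obtain ⟨hZh, hatt⟩ := not_att_of_leg hY hZ hZY hYh hm
          exact .inl ⟨hle hh, hle hk, .inr (cY.cn_of_not_att hZh hatt h3)⟩
  · change CMem _ _ h ∧ CMem _ _ k ∧ _ ↔ CMem X Y h ∧ CMem X Y k ∧ _
    rw [hiff, hiff]
    refine and_congr_right fun hh => and_congr_right fun hk => ?_
    constructor
    · intro ht
      have key : ∀ {x}, Thread (Diagram.contract X Z) (Diagram.contract Y Z) h x →
          Thread X Y h x := by
        intro x ht
        induction ht with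
        | edge ha => exact (ha.2.2.of_contract hX hY hZ hZY hYX (hinner hh)).1
        | through _ hp ha ih =>
          have hp' := ((pass_contract_iff hY hZ hZY).1 hp).2
          exact ih.append hp' (ha.2.2.of_contract hX hY hZ hZY hYX fun l =>
            (hp'.symm hY.toBasic).not_adj).1
      exact key ht
    · intro ht
      -- `m` is the last cut point: the piece from `m` to `x` is a single edge of `X/Z`, and
      -- everything before `m` is already a thread of the contractions.
      have key : ∀ {x}, Thread X Y h x → ∃ m, CMem X Z m ∧ Thread X Z m x ∧
          (m = h ∨ ∃ x', Thread (Diagram.contract X Z) (Diagram.contract Y Z) h x' ∧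
            (Diagram.contract Y Z).Pass x' m) := by
        intro x ht
        induction ht with
        | edge ha => exact ⟨h, hle hh, .edge ha, .inl rfl⟩
        | @through x y k _ hp ha ih =>
          obtain ⟨m, hm, hmx, hmh⟩ := ih
          by_cases hx : CMem Y Z x
          · have hp' : (Diagram.contract Y Z).Pass x y := (pass_contract_iff hY hZ hZY).2 ⟨hx, hp⟩
            have hy : CMem Y Z y := contract_vr_self.1
              (hp'.symm (hY.contract hZ hZY).toBasic).mem
            have hmx' : (Diagram.contract X Z).adj m x := ⟨hm, hx.mono hYX, hmx⟩
            refine ⟨y, hy.mono hYX, .edge ha, .inr ⟨x, ?_, hp'⟩⟩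
            rcases hmh with rfl | ⟨x', h1, h2⟩
            · exact .edge hmx'
            · exact .through h1 h2 hmx'
          · obtain ⟨hZx, hatt⟩ := not_att_of_leg hY hZ hZY hp.2.1 hx
            have hp' : Z.Pass x y := by
              unfold Pass at hp ⊢
              rwa [cY.legs_of_not_att hZx hatt] at hp
            exact ⟨m, hm, .through hmx hp' ha, hmh⟩
      obtain ⟨m, hm, hmk, hmh⟩ := key ht
      have hmk' : (Diagram.contract X Z).adj m k := ⟨hm, hle hk, hmk⟩
      rcases hmh with rfl | ⟨x', h1, h2⟩
      · exact .edge hmk'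
      · exact .through h1 h2 hmk'

/-- An edge of `Y` outside `Z` lies on a thread that starts at a surviving half-edge `a`. Since `a`
is internal in the common contraction, it has an edge in `Y'` too, and the thread can be followed in
`Y'`: `bridge` provides each next edge, and adjacency in `X` forces it to be the same one. -/
theorem adj_le_of_contract_le {Y' : Diagram H} (hY' : Y'.Feynman) (hZY' : Z.IsSub Y')
    (hYX' : Y'.IsSub X) (heq : contract Y Z = contract Y' Z) {h k : H} (ha : Y.adj h k) :
    Y'.adj h k := by
  have cY' := hY'.contractible hZ hZY'
  have cY := hY.contractible hZ hZY
  by_cases hn : ∃ l, Z.adj k l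
  · obtain ⟨l, hl⟩ := hn
    rw [hY.adj_unique (hY.adj_symm ha) (hZY.adj_le hl)]
    exact hY'.adj_symm (hZY'.adj_le hl)
  obtain ⟨a, hm, ht⟩ := hY.exists_thread hZ hZY (hY.adj_symm ha) (not_exists.1 hn)
  replace ht := cY.thread_symm ht
  obtain ⟨a', ha'⟩ := ht.adj_left
  obtain ⟨b, hb, hab⟩ := cY.exists_thread ha' hm
  have h1 : (contract Y' Z).adj a b := by
    rw [← heq]
    exact ⟨hm, hb, hab⟩
  obtain ⟨a'', ha''⟩ := h1.2.2.adj_left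
  have key : ∀ {x}, Thread Y Z a x → Thread Y' Z a x := by
    intro x hx
    induction hx with
    | edge hax =>
      rw [hX.adj_unique (hYX.adj_le hax) (hYX'.adj_le ha'')]
      exact .edge ha''
    | through _ hp hyk ih =>
      obtain ⟨l, hl⟩ := ih.adj_right hY'.toBasic
      obtain ⟨y', hy'⟩ := cY'.bridge hp hl
      rw [hX.adj_unique (hYX.adj_le hyk) (hYX'.adj_le hy')]
      exact .through ih hp hy'
  obtain ⟨l, hl⟩ := (key ht).adj_right hY'.toBasic
  rw [hX.adj_unique (hX.adj_symm (hYX.adj_le ha)) (hYX'.adj_le hl)]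
  exact hY'.adj_symm hl

omit [Finite H] hX hY hZ in
theorem vr_le_of_contract_le {Y' : Diagram H} (hY : Y.Basic) (hZY' : Z.IsSub Y')
    (hYX' : Y'.IsSub X) (heq : contract Y Z = contract Y' Z) {h k : H} (hv : Y.vr h k) :
    Y'.vr h k := by
  by_cases hZh : Z.vr h h
  · exact hZY'.vr_le (hZY.vr_full hZh hv)
  · have h1 : CMem Y Z h := .inl ⟨hY.vr_left hv, hZh⟩
    have h2 : CMem Y' Z h := by
      rw [← contract_vr_self, ← heq]
      exact contract_vr_self.2 h1
    rcases h2 with h2 | h2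
    · exact hYX'.vr_full h2.1 (hYX.vr_le hv)
    · exact absurd h2.1.1.1 hZh

/-- A Feynman subgraph is determined by its contraction. -/
theorem eq_of_contract_eq {Y' : Diagram H} (hY' : Y'.Feynman) (hZY' : Z.IsSub Y')
    (hYX' : Y'.IsSub X) (heq : contract Y Z = contract Y' Z) : Y = Y' :=
  Diagram.ext
    (fun _ _ => ⟨vr_le_of_contract_le hZY hYX hY.toBasic hZY' hYX' heq,
      vr_le_of_contract_le hZY' hYX' hY'.toBasic hZY hYX heq.symm⟩)
    (fun _ _ => ⟨adj_le_of_contract_le hX hY hZ hZY hYX hY' hZY' hYX' heq,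
      adj_le_of_contract_le hX hY' hZ hZY' hYX' hY hZY hYX heq.symm⟩)

end Chain

end Diagram

namespace Diagram

variable {H : Type} {X Y Z K : Diagram H}

/-! ### Insertion -/

/-- If only edges to `q` leave the set `T`, then a thread that leaves `T` passes through `q`. -/
theorem Thread.cross {T : Set H} {q : H} (hT : ∀ a b, Z.Pass a b → a ∈ T → b ∈ T)
    (hadj : ∀ a b, Y.adj a b → a ∈ T → b ∉ T → b = q) {a x : H} (ht : Thread Y Z a x)
    (ha : a ∈ T) (hx : x ∉ T) : Thread Y Z a q := by
  induction ht with
  | edge h => exact hadj _ _ h ha hx ▸ .edge h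
  | @through x y k ht hp h ih =>
    by_cases hxT : x ∈ T
    · exact hadj _ _ h (hT _ _ hp hxT) hx ▸ .through ht hp h
    · exact ih hxT

/-- Going backwards along a thread: if `k` is reached from `a`, and `a` is joined with `b`, then
the predecessor of `k` is reached from `b`. -/
theorem Contractible.thread_back (c : Contractible X Z) {a b h k : H} (hab : Thread X Z a b)
    (hb : ∀ y, ¬ Z.Pass b y) (hk : Thread X Z a k) (ha : X.adj h k) : Thread X Z b h := by
  rcases c.thread_compare hk hab hb with rfl | ⟨y, hp, ht⟩
  · exact .edge (c.basic.adj_symm ha)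
  · exact .through (c.thread_symm ht) (hp.symm c.feynman.toBasic) (c.basic.adj_symm ha)

/-- An extension of Feynman graphs is a Feynman graph, provided that every edge outside `Z` is
visited by an edge of the contraction. For irreducibility, let the edge from `h` to `k` be the only
one leaving `S`. If it lies in `Z`, use irreducibility of `Z`; otherwise it lies on a thread between
some `a` and `b`, and irreducibility of the contraction puts both ends on the same side of `S`. -/
theorem Contractible.feynman_of_contract [Finite H] (c : Contractible Y Z)
    (hK : (contract Y Z).Feynman) (htri : ∀ {h}, Y.vr h h → {k | Y.vr h k}.ncard = 3)
    (hon : ∀ {h k}, Y.adj h k → ¬ Z.adj h k → ∃ a b, (contract Y Z).adj a b ∧ Thread Y Z a k) :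
    Y.Feynman :=
  have hcases : ∀ {h}, Y.vr h h →
      Z.vr h h ∧ ¬ Att Y Z h ∨ ∃ d, Y.cn h d ∧ CMem Y Z d := by
    intro h hh
    by_cases hZ : Z.vr h h
    · by_cases hatt : Att Y Z h
      · obtain ⟨k, hk, l, hl⟩ := hatt
        obtain ⟨a, b, hab, ht⟩ := hon (c.basic.adj_symm hl)
          fun hl' => hk.2 l (c.feynman.adj_symm hl')
        exact .inr ⟨a, Basic.cn_trans (c.isSub.cn hk.1) (c.basic.cn_symm (c.thread_cn ht)), hab.1⟩
      · exact .inl ⟨hZ, hatt⟩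
    · exact .inr ⟨h, Basic.cn_refl hh, .inl ⟨hh, hZ⟩⟩
  { c.basic with
    trivalent := htri
    legs_card := by
      intro h hh
      rcases hcases hh with ⟨h1, h2⟩ | ⟨d, h1, h2⟩
      · rw [c.legs_of_not_att h1 h2]
        exact c.feynman.legs_card h1
      · rw [c.basic.legs_eq h1, ← c.contract_legs h2]
        exact hK.legs_card (contract_vr_self.2 h2)
    loop := by
      intro h hh
      rcases hcases hh with ⟨h1, h2⟩ | ⟨d, h1, h2⟩
      · obtain ⟨k, l, hk, hl⟩ := c.feynman.loop h1
        exact ⟨k, l, c.isSub.cn hk, c.isSub.adj_le hl⟩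
      · obtain ⟨k, l, hk, hl⟩ := hK.loop (contract_vr_self.2 h2)
        obtain ⟨l', hl'⟩ := hl.2.2.adj_left
        exact ⟨k, l', Basic.cn_trans h1 ((c.contract_cn h2).1 hk).2, hl'⟩
    irreducible := by
      intro S hS h k ha hother hh
      by_cases hZ : Z.adj h k
      · refine c.feynman.irreducible S (fun a b hab => hS a b (c.isSub.vr_le hab)) hZ
          (fun a b hab => hother a b (c.isSub.adj_le hab)) hh
      by_contra hk
      have hnk : ∀ l, ¬ Z.adj k l := fun l hl => by
        obtain rfl := c.basic.adj_unique (c.basic.adj_symm ha) (c.isSub.adj_le hl)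
        exact hZ (c.feynman.adj_symm hl)
      have hnh : ∀ l, ¬ Z.adj h l := fun l hl => by
        obtain rfl := c.basic.adj_unique ha (c.isSub.adj_le hl)
        exact hZ hl
      have hcn : ∀ a b, Z.cn a b → a ∈ S → b ∈ S := fun a b hab =>
        hab.mem_of_closed (fun a b hab => hS a b (c.isSub.vr_le hab)) fun a b hab haS =>
          hother a b (c.isSub.adj_le hab) (fun h => hnh b (h ▸ hab)) (fun h => hnk b (h ▸ hab)) haS
      have hout : ∀ a b, Y.adj a b → a ∈ S → b ∉ S → a = h ∧ b = k := by
        intro a b hab haS hbS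
        by_cases h1 : a = h
        · exact ⟨h1, c.basic.adj_unique (h1 ▸ hab) ha⟩
        · exact absurd (hother a b hab h1 (fun h2 => hk (h2 ▸ haS)) haS) hbS
      have cross : ∀ {a x}, Thread Y Z a x → a ∈ S → x ∉ S → Thread Y Z a k := fun ht =>
        ht.cross (fun a b hp => hcn a b hp.cn) fun a b hab h1 h2 => (hout a b hab h1 h2).2
      have cross' : ∀ {a x}, Thread Y Z a x → a ∉ S → x ∈ S → Thread Y Z a h := fun ht h1 h2 =>
        ht.cross (T := Sᶜ) (fun a b hp h3 h4 => h3 (hcn b a (c.feynman.cn_symm hp.cn) h4))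
          (fun a b hab h3 h4 =>
            (hout b a (c.basic.adj_symm hab) (Set.notMem_compl_iff.1 h4) h3).1)
          h1 (fun h3 => h3 h2)
      obtain ⟨a, b, hab, htk⟩ := hon ha hZ
      have hth : Thread Y Z b h := c.thread_back hab.2.2 (fun _ => hab.2.1.not_pass) htk ha
      have hSK : ∀ x y, (Diagram.contract Y Z).vr x y → x ∈ S → y ∈ S := fun x y hxy hx =>
        hxy.2.2.elim (fun h => hS x y h hx) fun h => hcn x y h hx
      have hK1 : ∀ x y, (Diagram.contract Y Z).adj x y → x ≠ a → x ∈ S → y ∈ S := by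
        intro x y hxy hxa hx
        by_contra hy
        exact hxa (c.thread_unique (c.thread_symm (cross hxy.2.2 hx hy)) (c.thread_symm htk)
          (fun _ => hxy.1.not_pass) fun _ => hab.1.not_pass)
      have h1 : a ∈ S → b ∈ S := hK.irreducible S hSK hab fun x y hxy hxa _ => hK1 x y hxy hxa
      have h2 : b ∈ S → a ∈ S := hK.irreducible S hSK (hK.adj_symm hab)
        fun x y hxy _ hxa => hK1 x y hxy hxa
      -- The thread crosses out of or into `S` and has to come back, but only through the same edge
      -- in the other direction, contrary to `thread_not_both`.
      by_cases hbS : b ∈ S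
      · rcases c.thread_compare htk hab.2.2 fun _ => hab.2.1.not_pass with rfl | ⟨y, hp, ht⟩
        · exact hk hbS
        · have hy : y ∉ S := fun h => hk (hcn y k (c.feynman.cn_symm hp.cn) h)
          exact c.thread_not_both (cross (c.thread_symm ht) hbS hy) hth ha
      · have haS : a ∉ S := fun h => hbS (h1 h)
        rcases c.thread_compare hth (c.thread_symm hab.2.2) fun _ => hab.1.not_pass with
          rfl | ⟨y, hp, ht⟩
        · exact haS hh
        · exact c.thread_not_both htk (cross' (c.thread_symm ht) haS (hcn h y hp.cn hh)) ha }

variable (X Z K) in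
/-- `k` lies on a thread that is an edge of `K`. -/
def On (k : H) : Prop := ∃ a b, K.adj a b ∧ Thread X Z a k

variable (X Z K) in
/-- The part of `X` that consists of `Z` and the part `K` of the contraction. -/
def insertion : Diagram H where
  vr h k := X.vr h k ∧ (Z.vr h h ∨ K.vr h h)
  adj h k := Z.adj h k ∨ X.adj h k ∧ On X Z K k

section Insertion

variable (c : Contractible X Z) (hK : K.Feynman) (hKs : K.IsSub (contract X Z))

include c hKs

theorem On.not_adj {k : H} (hk : On X Z K k) (l : H) : ¬ Z.adj k l := by
  obtain ⟨a, b, hab, ht⟩ := hk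
  exact c.thread_not_adj ht (fun l => (hKs.adj_le hab).1.not_adj c.feynman.toBasic) l

include hK

theorem On.exists_adj {k : H} (hk : On X Z K k) (hm : CMem X Z k) : ∃ l, K.adj k l := by
  obtain ⟨a, b, hab, ht⟩ := hk
  obtain ⟨_, hb, ht'⟩ := hKs.adj_le hab
  obtain rfl := c.thread_unique ht ht' (fun _ => hm.not_pass) fun _ => hb.not_pass
  exact ⟨a, hK.adj_symm hab⟩

theorem On.of_adj {h k : H} (hk : On X Z K k) (ha : X.adj h k) : On X Z K h := by
  obtain ⟨a, b, hab, ht⟩ := hk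
  obtain ⟨_, hb, ht'⟩ := hKs.adj_le hab
  exact ⟨b, a, hK.adj_symm hab, c.thread_back ht' (fun _ => hb.not_pass) ht ha⟩

theorem On.of_pass {k y : H} (hk : On X Z K k) (hp : Z.Pass k y) : On X Z K y := by
  obtain ⟨a, b, hab, ht⟩ := hk
  obtain ⟨_, hb, ht'⟩ := hKs.adj_le hab
  rcases c.thread_compare ht ht' fun _ => hb.not_pass with rfl | ⟨z, hz, hzb⟩
  · exact absurd hp hb.not_pass
  · obtain rfl := hp.unique hz
    exact ⟨b, a, hK.adj_symm hab, c.thread_symm hzb⟩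

omit c in
theorem on_of_adj {h k : H} (ha : K.adj h k) : On X Z K h :=
  ⟨k, h, hK.adj_symm ha, (hKs.adj_le (hK.adj_symm ha)).2.2⟩

theorem insertion_basic : (insertion X Z K).Basic where
  vr_symm := by
    rintro h k ⟨h1, h2⟩
    refine ⟨c.basic.vr_symm h1, ?_⟩
    by_cases hZ : Z.vr h h
    · exact .inl (c.feynman.vr_right (c.isSub.vr_full hZ h1))
    have h3 := h2.resolve_left hZ
    by_cases hZk : Z.vr k k
    · exact .inl hZk
    · exact .inr (hK.vr_right (hKs.vr_full h3
        ⟨contract_vr_self.1 (hKs.vr_le h3), .inl ⟨c.basic.vr_right h1, hZk⟩, .inl h1⟩))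
  vr_trans := fun h1 h2 => ⟨c.basic.vr_trans h1.1 h2.1, h1.2⟩
  adj_symm := by
    rintro h k (h1 | ⟨h1, h2⟩)
    · exact .inl (c.feynman.adj_symm h1)
    · exact .inr ⟨c.basic.adj_symm h1, h2.of_adj c hK hKs h1⟩
  adj_irrefl := fun h => h.elim c.feynman.adj_irrefl fun h => c.basic.adj_irrefl h.1
  adj_unique := fun h1 h2 => c.basic.adj_unique (h1.elim c.isSub.adj_le And.left)
    (h2.elim c.isSub.adj_le And.left)
  adj_mem := by
    rintro h k (h1 | ⟨h1, h2⟩)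
    · have := c.feynman.adj_mem h1
      exact ⟨c.isSub.vr_le this, .inl this⟩
    · refine ⟨c.basic.adj_mem h1, ?_⟩
      have h3 := h2.of_adj c hK hKs h1
      rcases c.cMem_or_pass h1 (h3.not_adj c hKs) with h4 | ⟨y, hy⟩
      · obtain ⟨l, hl⟩ := h3.exists_adj c hK hKs h4
        exact .inr (hK.adj_mem hl)
      · exact .inl hy.mem

omit hKs hK in
theorem insertion_isSub : (insertion X Z K).IsSub X where
  vr_le := And.left
  vr_full := fun h1 h2 => ⟨h2, h1.2⟩
  adj_le := fun h => h.elim c.isSub.adj_le And.left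

omit hKs hK in
theorem isSub_insertion : Z.IsSub (insertion X Z K) where
  vr_le := fun h => ⟨c.isSub.vr_le h, .inl (c.feynman.vr_left h)⟩
  vr_full := fun h1 h2 => c.isSub.vr_full h1 h2.1
  adj_le := .inl

/-- An inserted thread contains both edges at each component that it passes, which gives `bridge`
without irreducibility. -/
theorem insertion_contractible : Contractible (insertion X Z K) Z where
  basic := insertion_basic c hK hKs
  feynman := c.feynman
  isSub := isSub_insertion c
  bridge := by
    rintro x y x' hp (hx | ⟨hx, hon⟩)
    · exact absurd hx hp.not_adj
    · have hy := (hon.of_adj c hK hKs hx).of_pass c hK hKs hp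
      obtain ⟨y', hy'⟩ := c.bridge hp hx
      exact ⟨y', .inr ⟨hy', hy.of_adj c hK hKs (c.basic.adj_symm hy')⟩⟩

omit hKs hK c in
theorem Thread.insertion {a b k : H} (hab : K.adj a b) (ht : Thread X Z a k) :
    Thread (insertion X Z K) Z a k := by
  induction ht with
  | edge h => exact .edge (.inr ⟨h, a, b, hab, .edge h⟩)
  | through ht hp h ih => exact .through ih hp (.inr ⟨h, a, b, hab, .through ht hp h⟩)

/-- For a component with three legs the point is attachment: a vertex of the Feynman graph `K` has
an internal edge, and the thread of this edge attaches the component in the insertion. -/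
theorem cMem_insertion_iff {h : H} : CMem (insertion X Z K) Z h ↔ K.vr h h := by
  constructor
  · rintro (⟨h1, h2⟩ | ⟨h1, h2, k, hk, l, hl⟩)
    · exact h1.2.resolve_left h2
    · obtain ⟨hl, hon⟩ := hl.resolve_left (hk.2 l)
      have hm : CMem X Z k := by
        refine .inr ⟨c.feynman.self_mem_legs hk, ?_, k, c.feynman.self_mem_legs hk, l, hl⟩
        rw [← c.feynman.legs_eq hk.1]
        exact h2
      have hm' : CMem X Z h := .inr ⟨h1, h2, k, hk, l, hl⟩
      obtain ⟨z, hz⟩ := (hon.of_adj c hK hKs hl).exists_adj c hK hKs hm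
      exact hK.vr_right (hKs.vr_full (hK.adj_mem hz) ⟨hm, hm', .inr (c.feynman.cn_symm hk.1)⟩)
  · intro hh
    rcases contract_vr_self.1 (hKs.vr_le hh) with h1 | h1
    · exact .inl ⟨⟨h1.1, .inr hh⟩, h1.2⟩
    · refine .inr ⟨h1.1, h1.2.1, ?_⟩
      obtain ⟨k, l, hk, hl⟩ := hK.exists_vr_adj hh
      obtain ⟨_, hm, hhk⟩ := hKs.vr_le hk
      obtain ⟨z, hz⟩ := (hKs.adj_le hl).2.2.adj_left
      refine ⟨k, ⟨hhk.elim (fun h => c.feynman.cn_of_vr (c.isSub.vr_full h1.1.1.1 h)) id,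
        fun l => hm.not_adj c.feynman.toBasic⟩, z, .inr ⟨hz, ?_⟩⟩
      exact (on_of_adj hK hKs hl).of_adj c hK hKs (c.basic.adj_symm hz)

/-- Threads that are edges of `K` are inserted completely and no other edges are added, so
contraction recovers `K`. This is the surjectivity in the bijection `subsSubs`; `eq_of_contract_eq`
is the injectivity. -/
theorem contract_insertion : contract (insertion X Z K) Z = K := by
  refine Diagram.ext (fun h k => ?_) fun h k => ?_
  · change CMem _ _ h ∧ CMem _ _ k ∧ _ ↔ _
    rw [cMem_insertion_iff c hK hKs, cMem_insertion_iff c hK hKs]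
    constructor
    · rintro ⟨h1, h2, h3⟩
      exact hKs.vr_full h1 ⟨contract_vr_self.1 (hKs.vr_le h1), contract_vr_self.1 (hKs.vr_le h2),
        h3.imp And.left id⟩
    · intro hk
      have h1 := hK.vr_left hk
      exact ⟨h1, hK.vr_right hk, (hKs.vr_le hk).2.2.imp (fun h => ⟨h, .inr h1⟩) id⟩
  · change CMem _ _ h ∧ CMem _ _ k ∧ _ ↔ _
    rw [cMem_insertion_iff c hK hKs, cMem_insertion_iff c hK hKs]
    constructor
    · rintro ⟨h1, h2, h3⟩
      have hm := contract_vr_self.1 (hKs.vr_le h1)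
      obtain ⟨x, hx⟩ := h3.adj_left
      obtain ⟨hx, hon⟩ := hx.resolve_left (hm.not_adj c.feynman.toBasic)
      obtain ⟨b, hb⟩ := (hon.of_adj c hK hKs hx).exists_adj c hK hKs hm
      obtain ⟨_, hmb, ht⟩ := hKs.adj_le hb
      obtain rfl := c.thread_unique ht (h3.mono (insertion_isSub c)) (fun _ => hmb.not_pass)
        fun _ => (contract_vr_self.1 (hKs.vr_le h2)).not_pass
      exact hb
    · intro hk
      exact ⟨hK.adj_mem hk, hK.adj_mem_right hk, (hKs.adj_le hk).2.2.insertion hk⟩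

theorem insertion_feynman [Finite H] (hX : X.Feynman) : (insertion X Z K).Feynman := by
  refine (insertion_contractible c hK hKs).feynman_of_contract ?_ ?_ ?_
  · rw [contract_insertion c hK hKs]
    exact hK
  · intro h hh
    rw [← hX.trivalent hh.1]
    congr 1
    ext k
    exact ⟨And.left, fun h => ⟨h, hh.2⟩⟩
  · intro h k hk hZ
    obtain ⟨a, b, hab, ht⟩ := (hk.resolve_left hZ).2
    rw [contract_insertion c hK hKs]
    exact ⟨a, b, hab, ht.insertion hab⟩

end Insertion

end Diagram

namespace Diagram

variable {H : Type} {X Y Z : Diagram H}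

/-! ### The empty part and the full part -/

/-- The empty diagram. -/
def empty (H : Type) : Diagram H := ⟨fun _ _ => False, fun _ _ => False⟩

theorem empty_feynman : (empty H).Feynman where
  vr_symm := False.elim
  vr_trans := False.elim
  adj_symm := False.elim
  adj_irrefl := id
  adj_unique := False.elim
  adj_mem := False.elim
  trivalent := False.elim
  legs_card := False.elim
  loop := False.elim
  irreducible := fun _ _ _ _ h => h.elim

theorem empty_isSub : (empty H).IsSub X := ⟨False.elim, False.elim, False.elim⟩

theorem contract_empty (hX : X.Basic) : contract X (empty H) = X := by
  have hm : ∀ {h}, CMem X (empty H) h ↔ X.vr h h := fun {h} =>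
    ⟨fun h => h.elim And.left fun h => h.1.1.1.elim, fun h => .inl ⟨h, id⟩⟩
  refine Diagram.ext (fun h k => ?_) fun h k => ?_
  · exact ⟨fun h => h.2.2.elim id fun h => h.1.elim,
      fun h => ⟨hm.2 (hX.vr_left h), hm.2 (hX.vr_right h), .inl h⟩⟩
  · refine ⟨fun h => ?_, fun h => ⟨hm.2 (hX.adj_mem h), hm.2 (hX.adj_mem_right h), .edge h⟩⟩
    cases h.2.2 with
    | edge h => exact h
    | through _ hp _ => exact hp.mem.elim

theorem contract_self (X : Diagram H) : contract X X = empty H := by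
  have hm : ∀ h, ¬ CMem X X h := by
    rintro h (h | ⟨_, _, k, hk, l, hl⟩)
    · exact h.2 h.1
    · exact hk.2 l hl
  exact Diagram.ext (fun h k => ⟨fun h' => hm h h'.1, False.elim⟩)
    fun h k => ⟨fun h' => hm h h'.1, False.elim⟩

/-- A vertex of `X` outside `Z` would survive, and an edge of `X` outside `Z` would lie on a thread
with a surviving end. -/
theorem eq_of_contract_eq_empty [Finite H] (hX : X.Feynman) (hZ : Z.Feynman) (hs : Z.IsSub X)
    (he : contract X Z = empty H) : Z = X := by
  have hm : ∀ h, ¬ CMem X Z h := fun h hh => by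
    rw [← contract_vr_self, he] at hh
    exact hh
  refine Diagram.ext (fun h k => ⟨hs.vr_le, fun hk => ?_⟩) fun h k => ⟨hs.adj_le, fun hk => ?_⟩
  · refine hs.vr_full ?_ hk
    by_contra h1
    exact hm h (.inl ⟨hX.vr_left hk, h1⟩)
  · by_cases hn : ∃ l, Z.adj h l
    · obtain ⟨l, hl⟩ := hn
      rwa [hX.adj_unique hk (hs.adj_le hl)]
    · obtain ⟨b, hb, _⟩ := hX.exists_thread hZ hs hk (not_exists.1 hn)
      exact absurd hb (hm b)

/-! ### The degree -/

/-- The half-edges other than the external edges of components with three external edges. -/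
def core (X : Diagram H) : Set H := {h | X.vr h h ∧ ¬ (h ∈ X.legs h ∧ (X.legs h).ncard = 3)}

/-- Numbers of vertices are not additive, since contraction creates vertices; this count is. The
legs of an attached component with three legs are half-edges of its new vertex and are left to the
contraction to count, while all half-edges of a component with two legs are counted in `Z`. -/
theorem Feynman.core_contract [Finite H] (hX : X.Feynman) (hZ : Z.Feynman) (hs : Z.IsSub X) :
    X.core.ncard = Z.core.ncard + (Diagram.contract X Z).core.ncard := by
  have c := hX.contractible hZ hs
  rw [← Set.ncard_union_eq]
  · congr 1
    ext h
    constructor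
    · rintro ⟨h1, h2⟩
      by_cases hm : CMem X Z h
      · refine .inr ⟨contract_vr_self.2 hm, ?_⟩
        rwa [c.contract_legs hm]
      · have hZh : Z.vr h h := by
          by_contra h3
          exact hm (.inl ⟨h1, h3⟩)
        refine .inl ⟨hZh, fun ⟨h3, h4⟩ => ?_⟩
        rw [c.legs_of_not_att hZh fun h5 => hm (.inr ⟨h3, h4, h5⟩)] at h2
        exact h2 ⟨h3, h4⟩
    · rintro (⟨h1, h2⟩ | ⟨h1, h2⟩)
      · refine ⟨hs.vr_le h1, fun ⟨h3, h4⟩ => h2 ?_⟩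
        have h5 : h ∈ Z.legs h := ⟨Basic.cn_refl h1, fun l hl => h3.2 l (hs.adj_le hl)⟩
        refine ⟨h5, (hZ.legs_card h1).resolve_left fun h6 => ?_⟩
        obtain ⟨y, hy⟩ := exists_pass h6 h5
        rw [c.legs_of_not_att h1 fun h7 => ?_] at h4
        · omega
        · obtain ⟨l, hl⟩ := (c.att_iff_of_pass hy).1 h7
          exact h3.2 l hl
      · have hm := contract_vr_self.1 h1
        rw [c.contract_legs hm] at h2
        exact ⟨hm.elim And.left fun h => hs.vr_le h.1.1.1, h2⟩
  · rw [Set.disjoint_left]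
    rintro h ⟨h1, h2⟩ ⟨h3, _⟩
    rcases contract_vr_self.1 h3 with h3 | h3
    · exact h3.2 h1
    · exact h2 ⟨h3.1, h3.2.1⟩

/-- Every vertex has an internal half-edge, which belongs to the core, and only three half-edges in
all. So the degree bounds the size of the graph. -/
theorem Feynman.card_le [Finite H] (hX : X.Feynman) :
    {h | X.vr h h}.ncard ≤ X.core.ncard * 3 := by
  classical
  have := Fintype.ofFinite H
  have h1 : {h | X.vr h h} ⊆
      ↑(X.core.toFinset.biUnion fun k => ({h | X.vr k h} : Set H).toFinset) := by
    intro h hh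
    obtain ⟨k, l, hk, hl⟩ := hX.exists_vr_adj hh
    simp only [Finset.coe_biUnion, Set.mem_iUnion, Set.coe_toFinset]
    exact ⟨k, ⟨hX.vr_right hk, fun h2 => h2.1.2 l hl⟩, hX.vr_symm hk⟩
  refine (Set.ncard_le_ncard h1).trans ?_
  rw [Set.ncard_coe_finset, Set.ncard_eq_toFinset_card']
  refine Finset.card_biUnion_le_card_mul _ _ _ fun k hk => ?_
  rw [← Set.ncard_eq_toFinset_card']
  exact (hX.trivalent (Set.mem_toFinset.1 hk).1).le

/-! ### Unions of components -/

variable {H' : Type} {X' Z' : Diagram H'} {f : H → H'}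

/-- The map `f` identifies `X` with a union of components of `X'`. -/
structure Piece (f : H → H') (X : Diagram H) (X' : Diagram H') : Prop where
  inj : Function.Injective f
  vr_iff : ∀ {a b}, X'.vr (f a) (f b) ↔ X.vr a b
  adj_iff : ∀ {a b}, X'.adj (f a) (f b) ↔ X.adj a b
  vr_range : ∀ {a k}, X'.vr (f a) k → ∃ b, f b = k
  adj_range : ∀ {a k}, X'.adj (f a) k → ∃ b, f b = k

namespace Piece

variable (p : Piece f X X') (q : Piece f Z Z')
include p

theorem exists_cn {a : H} {k : H'} (hk : X'.cn (f a) k) : ∃ b, f b = k ∧ X.cn a b := by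
  refine hk.mem_of_closed (S := {k | ∃ b, f b = k ∧ X.cn a b}) ?_ ?_
    ⟨a, rfl, Basic.cn_refl (p.vr_iff.1 hk.1)⟩
  · rintro _ l hl ⟨b, rfl, hb⟩
    obtain ⟨d, rfl⟩ := p.vr_range hl
    exact ⟨d, rfl, hb.1, hb.2.tail (.inl (p.vr_iff.1 hl))⟩
  · rintro _ l hl ⟨b, rfl, hb⟩
    obtain ⟨d, rfl⟩ := p.adj_range hl
    exact ⟨d, rfl, hb.1, hb.2.tail (.inr (p.adj_iff.1 hl))⟩

theorem cn_iff {a b : H} : X'.cn (f a) (f b) ↔ X.cn a b := by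
  constructor
  · intro h
    obtain ⟨d, hd, h⟩ := p.exists_cn h
    rwa [← p.inj hd]
  · rintro ⟨h1, h2⟩
    exact ⟨p.vr_iff.2 h1, h2.lift f fun _ _ hs => hs.imp p.vr_iff.2 p.adj_iff.2⟩

theorem exists_adj_iff {a : H} : (∃ k, X'.adj (f a) k) ↔ ∃ b, X.adj a b := by
  constructor
  · rintro ⟨k, hk⟩
    obtain ⟨b, rfl⟩ := p.adj_range hk
    exact ⟨b, p.adj_iff.1 hk⟩
  · rintro ⟨b, hb⟩
    exact ⟨f b, p.adj_iff.2 hb⟩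

theorem mem_legs_iff {a b : H} : f b ∈ X'.legs (f a) ↔ b ∈ X.legs a := by
  refine and_congr p.cn_iff ?_
  rw [← not_exists, ← not_exists, p.exists_adj_iff]

theorem legs_eq (a : H) : X'.legs (f a) = f '' X.legs a := by
  ext k
  constructor
  · intro hk
    obtain ⟨b, rfl, _⟩ := p.exists_cn hk.1
    exact ⟨b, p.mem_legs_iff.1 hk, rfl⟩
  · rintro ⟨b, hb, rfl⟩
    exact p.mem_legs_iff.2 hb

theorem ncard_legs (a : H) : (X'.legs (f a)).ncard = (X.legs a).ncard := by
  rw [p.legs_eq, Set.ncard_image_of_injective _ p.inj]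

omit p in
/-- A diagram whose components are Feynman graphs is one. -/
theorem feynman (hp : ∀ h' : H', ∃ (H : Type) (f : H → H') (X : Diagram H) (a : H),
    Piece f X X' ∧ X.Feynman ∧ f a = h') : X'.Feynman where
  vr_symm := by
    intro h k hk
    obtain ⟨H, f, X, a, p, hX, rfl⟩ := hp h
    obtain ⟨b, rfl⟩ := p.vr_range hk
    exact p.vr_iff.2 (hX.vr_symm (p.vr_iff.1 hk))
  vr_trans := by
    intro h k l hk hl
    obtain ⟨H, f, X, a, p, hX, rfl⟩ := hp h
    obtain ⟨b, rfl⟩ := p.vr_range hk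
    obtain ⟨d, rfl⟩ := p.vr_range hl
    exact p.vr_iff.2 (hX.vr_trans (p.vr_iff.1 hk) (p.vr_iff.1 hl))
  adj_symm := by
    intro h k hk
    obtain ⟨H, f, X, a, p, hX, rfl⟩ := hp h
    obtain ⟨b, rfl⟩ := p.adj_range hk
    exact p.adj_iff.2 (hX.adj_symm (p.adj_iff.1 hk))
  adj_irrefl := by
    intro h
    obtain ⟨H, f, X, a, p, hX, rfl⟩ := hp h
    rw [p.adj_iff]
    exact hX.adj_irrefl
  adj_unique := by
    intro h k l hk hl
    obtain ⟨H, f, X, a, p, hX, rfl⟩ := hp h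
    obtain ⟨b, rfl⟩ := p.adj_range hk
    obtain ⟨d, rfl⟩ := p.adj_range hl
    rw [hX.adj_unique (p.adj_iff.1 hk) (p.adj_iff.1 hl)]
  adj_mem := by
    intro h k hk
    obtain ⟨H, f, X, a, p, hX, rfl⟩ := hp h
    obtain ⟨b, rfl⟩ := p.adj_range hk
    exact p.vr_iff.2 (hX.adj_mem (p.adj_iff.1 hk))
  trivalent := by
    intro h hh
    obtain ⟨H, f, X, a, p, hX, rfl⟩ := hp h
    rw [← hX.trivalent (p.vr_iff.1 hh), ← Set.ncard_image_of_injective _ p.inj]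
    congr 1
    ext k
    constructor
    · intro hk
      obtain ⟨b, rfl⟩ := p.vr_range hk
      exact ⟨b, p.vr_iff.1 hk, rfl⟩
    · rintro ⟨b, hb, rfl⟩
      exact p.vr_iff.2 hb
  legs_card := by
    intro h hh
    obtain ⟨H, f, X, a, p, hX, rfl⟩ := hp h
    rw [p.ncard_legs]
    exact hX.legs_card (p.vr_iff.1 hh)
  loop := by
    intro h hh
    obtain ⟨H, f, X, a, p, hX, rfl⟩ := hp h
    obtain ⟨k, l, hk, hl⟩ := hX.loop (p.vr_iff.1 hh)
    exact ⟨f k, f l, p.cn_iff.2 hk, p.adj_iff.2 hl⟩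
  irreducible := by
    intro S hS h k hk hother hh
    obtain ⟨H, f, X, a, p, hX, rfl⟩ := hp h
    obtain ⟨b, rfl⟩ := p.adj_range hk
    exact hX.irreducible (f ⁻¹' S) (fun a b hab => hS _ _ (p.vr_iff.2 hab)) (p.adj_iff.1 hk)
      (fun x y hxy hx1 hx2 => hother _ _ (p.adj_iff.2 hxy) (p.inj.ne hx1) (p.inj.ne hx2)) hh

theorem feynman_of (hX : X'.Feynman) : X.Feynman where
  vr_symm := fun h => p.vr_iff.1 (hX.vr_symm (p.vr_iff.2 h))
  vr_trans := fun h h' => p.vr_iff.1 (hX.vr_trans (p.vr_iff.2 h) (p.vr_iff.2 h'))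
  adj_symm := fun h => p.adj_iff.1 (hX.adj_symm (p.adj_iff.2 h))
  adj_irrefl := fun h => hX.adj_irrefl (p.adj_iff.2 h)
  adj_unique := fun h h' => p.inj (hX.adj_unique (p.adj_iff.2 h) (p.adj_iff.2 h'))
  adj_mem := fun h => p.vr_iff.1 (hX.adj_mem (p.adj_iff.2 h))
  trivalent := by
    intro a ha
    rw [← hX.trivalent (p.vr_iff.2 ha), ← Set.ncard_image_of_injective _ p.inj]
    congr 1
    ext k
    constructor
    · rintro ⟨b, hb, rfl⟩
      exact p.vr_iff.2 hb
    · intro hk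
      obtain ⟨b, rfl⟩ := p.vr_range hk
      exact ⟨b, p.vr_iff.1 hk, rfl⟩
  legs_card := by
    intro a ha
    rw [← p.ncard_legs]
    exact hX.legs_card (p.vr_iff.2 ha)
  loop := by
    intro a ha
    obtain ⟨k, l, hk, hl⟩ := hX.loop (p.vr_iff.2 ha)
    obtain ⟨b, rfl, hb⟩ := p.exists_cn hk
    obtain ⟨d, hd⟩ := p.exists_adj_iff.1 ⟨l, hl⟩
    exact ⟨b, d, hb, hd⟩
  irreducible := by
    intro S hS h k hk hother hh
    obtain ⟨b, hb, hbk⟩ := hX.irreducible (f '' S) (by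
      rintro _ l hl ⟨a, ha, rfl⟩
      obtain ⟨b, rfl⟩ := p.vr_range hl
      exact ⟨b, hS _ _ (p.vr_iff.1 hl) ha, rfl⟩) (p.adj_iff.2 hk) (by
      rintro _ l hl h1 h2 ⟨a, ha, rfl⟩
      obtain ⟨b, rfl⟩ := p.adj_range hl
      exact ⟨b, hother _ _ (p.adj_iff.1 hl) (fun h => h1 (h ▸ rfl)) (fun h => h2 (h ▸ rfl)) ha,
        rfl⟩) ⟨h, hh, rfl⟩
    rwa [← p.inj hbk]

include q

theorem att_iff {a : H} : Att X' Z' (f a) ↔ Att X Z a := by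
  unfold Att
  rw [q.legs_eq, Set.exists_mem_image]
  simp only [p.exists_adj_iff]

theorem cMem_iff {a : H} : CMem X' Z' (f a) ↔ CMem X Z a := by
  unfold CMem
  rw [p.vr_iff, q.vr_iff, q.mem_legs_iff, q.ncard_legs, p.att_iff q]

omit p in
theorem pass_iff {a b : H} : Z'.Pass (f a) (f b) ↔ Z.Pass a b := by
  unfold Pass
  rw [q.ncard_legs, q.mem_legs_iff, q.mem_legs_iff, q.inj.ne_iff]

theorem exists_thread {a : H} {k : H'} (ht : Thread X' Z' (f a) k) :
    ∃ b, f b = k ∧ Thread X Z a b := by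
  obtain ⟨h, hh⟩ : ∃ h, h = f a := ⟨_, rfl⟩
  rw [← hh] at ht
  induction ht with
  | edge h =>
    subst hh
    obtain ⟨b, rfl⟩ := p.adj_range h
    exact ⟨b, rfl, .edge (p.adj_iff.1 h)⟩
  | @through x y k _ hp h ih =>
    obtain ⟨b, rfl, hb⟩ := ih
    obtain ⟨d, rfl, hd⟩ := q.exists_cn hp.cn
    obtain ⟨e, rfl⟩ := p.adj_range h
    exact ⟨e, rfl, .through hb (q.pass_iff.1 hp) (p.adj_iff.1 h)⟩

theorem thread_iff {a b : H} : Thread X' Z' (f a) (f b) ↔ Thread X Z a b := by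
  constructor
  · intro h
    obtain ⟨d, hd, h⟩ := p.exists_thread q h
    rwa [← p.inj hd]
  · intro h
    induction h with
    | edge h => exact .edge (p.adj_iff.2 h)
    | through _ hp h ih => exact .through ih (q.pass_iff.2 hp) (p.adj_iff.2 h)

/-- Components of `Z` and threads never leave a union of components of the ambient diagram, so
contraction is computed piecewise. -/
theorem contract : Piece f (contract X Z) (contract X' Z') where
  inj := p.inj
  vr_iff := and_congr (p.cMem_iff q) (and_congr (p.cMem_iff q) (or_congr p.vr_iff q.cn_iff))
  adj_iff := and_congr (p.cMem_iff q) (and_congr (p.cMem_iff q) (p.thread_iff q))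
  vr_range := fun h => h.2.2.elim p.vr_range fun h => (q.exists_cn h).imp fun _ => And.left
  adj_range := fun h => (p.exists_thread q h.2.2).imp fun _ => And.left

end Piece

/-- The disjoint union. -/
def sum (X : Diagram H) (X' : Diagram H') : Diagram (H ⊕ H') where
  vr := Sum.LiftRel X.vr X'.vr
  adj := Sum.LiftRel X.adj X'.adj

theorem piece_inl (X : Diagram H) (X' : Diagram H') : Piece Sum.inl X (X.sum X') where
  inj := Sum.inl_injective
  vr_iff := Sum.liftRel_inl_inl
  adj_iff := Sum.liftRel_inl_inl
  vr_range := fun h => by cases h; exact ⟨_, rfl⟩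
  adj_range := fun h => by cases h; exact ⟨_, rfl⟩

theorem piece_inr (X : Diagram H) (X' : Diagram H') : Piece Sum.inr X' (X.sum X') where
  inj := Sum.inr_injective
  vr_iff := Sum.liftRel_inr_inr
  adj_iff := Sum.liftRel_inr_inr
  vr_range := fun h => by cases h; exact ⟨_, rfl⟩
  adj_range := fun h => by cases h; exact ⟨_, rfl⟩

theorem sum_feynman (hX : X.Feynman) (hX' : X'.Feynman) : (X.sum X').Feynman := by
  refine Piece.feynman ?_
  rintro (h | h)
  · exact ⟨H, _, X, h, piece_inl X X', hX, rfl⟩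
  · exact ⟨H', _, X', h, piece_inr X X', hX', rfl⟩

theorem eq_sum_of_pieces {W : Diagram (H ⊕ H')} (p : Piece Sum.inl X W) (q : Piece Sum.inr X' W) :
    W = X.sum X' := by
  refine Diagram.ext ?_ ?_
  · rintro (h | h) (k | k)
    · exact p.vr_iff.trans Sum.liftRel_inl_inl.symm
    · exact iff_of_false (fun h => by simpa using p.vr_range h) Sum.not_liftRel_inl_inr
    · exact iff_of_false (fun h => by simpa using q.vr_range h) Sum.not_liftRel_inr_inl
    · exact q.vr_iff.trans Sum.liftRel_inr_inr.symm
  · rintro (h | h) (k | k)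
    · exact p.adj_iff.trans Sum.liftRel_inl_inl.symm
    · exact iff_of_false (fun h => by simpa using p.adj_range h) Sum.not_liftRel_inl_inr
    · exact iff_of_false (fun h => by simpa using q.adj_range h) Sum.not_liftRel_inr_inl
    · exact q.adj_iff.trans Sum.liftRel_inr_inr.symm

theorem contract_sum (X Z : Diagram H) (X' Z' : Diagram H') :
    contract (X.sum X') (Z.sum Z') = (contract X Z).sum (contract X' Z') :=
  eq_sum_of_pieces ((piece_inl X X').contract (piece_inl Z Z'))
    ((piece_inr X X').contract (piece_inr Z Z'))

/-- The diagram induced on a set of half-edges. -/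
def comap (f : H → H') (X : Diagram H') : Diagram H where
  vr a b := X.vr (f a) (f b)
  adj a b := X.adj (f a) (f b)

theorem piece_comap_inl {W : Diagram (H ⊕ H')} (hW : W.IsSub (X.sum X')) :
    Piece Sum.inl (W.comap Sum.inl) W where
  inj := Sum.inl_injective
  vr_iff := Iff.rfl
  adj_iff := Iff.rfl
  vr_range := fun h => (piece_inl X X').vr_range (hW.vr_le h)
  adj_range := fun h => (piece_inl X X').adj_range (hW.adj_le h)

theorem piece_comap_inr {W : Diagram (H ⊕ H')} (hW : W.IsSub (X.sum X')) :
    Piece Sum.inr (W.comap Sum.inr) W where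
  inj := Sum.inr_injective
  vr_iff := Iff.rfl
  adj_iff := Iff.rfl
  vr_range := fun h => (piece_inr X X').vr_range (hW.vr_le h)
  adj_range := fun h => (piece_inr X X').adj_range (hW.adj_le h)

theorem IsSub.of_piece (p : Piece f X X') (q : Piece f Z Z') (h : Z'.IsSub X') : Z.IsSub X where
  vr_le := fun h1 => p.vr_iff.1 (h.vr_le (q.vr_iff.2 h1))
  vr_full := fun h1 h2 => q.vr_iff.1 (h.vr_full (q.vr_iff.2 h1) (p.vr_iff.2 h2))
  adj_le := fun h1 => p.adj_iff.1 (h.adj_le (q.adj_iff.2 h1))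

theorem IsSub.sum (h : Z.IsSub X) (h' : Z'.IsSub X') : (Z.sum Z').IsSub (X.sum X') where
  vr_le := fun h1 => h1.mono (fun _ _ => h.vr_le) fun _ _ => h'.vr_le
  vr_full := fun h1 h2 => by
    cases h2 with
    | inl h2 => exact .inl (h.vr_full (Sum.liftRel_inl_inl.1 h1) h2)
    | inr h2 => exact .inr (h'.vr_full (Sum.liftRel_inr_inr.1 h1) h2)
  adj_le := fun h1 => h1.mono (fun _ _ => h.adj_le) fun _ _ => h'.adj_le

/-! ### Feynman subgraphs -/

/-- The Feynman subgraphs. -/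
def Subs (X : Diagram H) : Type := {Z : Diagram H // Z.IsSub X ∧ Z.Feynman}

/-- The Feynman subgraphs of a disjoint union. -/
def subsSum (X : Diagram H) (X' : Diagram H') : Subs (X.sum X') ≃ Subs X × Subs X' where
  toFun W :=
    (⟨W.1.comap Sum.inl, .of_piece (piece_inl X X') (piece_comap_inl W.2.1) W.2.1,
      (piece_comap_inl W.2.1).feynman_of W.2.2⟩,
    ⟨W.1.comap Sum.inr, .of_piece (piece_inr X X') (piece_comap_inr W.2.1) W.2.1,
      (piece_comap_inr W.2.1).feynman_of W.2.2⟩)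
  invFun p := ⟨p.1.1.sum p.2.1, p.1.2.1.sum p.2.2.1, sum_feynman p.1.2.2 p.2.2.2⟩
  left_inv W := Subtype.ext
    (eq_sum_of_pieces (piece_comap_inl W.2.1) (piece_comap_inr W.2.1)).symm
  right_inv := fun _ => Prod.ext
    (Subtype.ext (Diagram.ext (fun _ _ => Sum.liftRel_inl_inl) fun _ _ => Sum.liftRel_inl_inl))
    (Subtype.ext (Diagram.ext (fun _ _ => Sum.liftRel_inr_inr) fun _ _ => Sum.liftRel_inr_inr))

theorem subsSum_eq {X : Diagram H} {X' : Diagram H'} (W : Subs (X.sum X')) :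
    W.1 = (subsSum X X' W).1.1.sum (subsSum X X' W).2.1 :=
  eq_sum_of_pieces (piece_comap_inl W.2.1) (piece_comap_inr W.2.1)

/-- Feynman subgraphs `Z` of Feynman subgraphs `Y` correspond to Feynman subgraphs `Y / Z` of
contractions `X / Z`. -/
noncomputable def subsSubs [Finite H] (hX : X.Feynman) :
    (Σ Y : Subs X, Subs Y.1) ≃ Σ Z : Subs X, Subs (contract X Z.1) :=
  Equiv.ofBijective
    (fun p => ⟨⟨p.2.1, p.2.2.1.trans p.1.2.1, p.2.2.2⟩, ⟨contract p.1.1 p.2.1,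
      p.2.2.1.contract hX.toBasic p.1.2.2.toBasic p.2.2.2.toBasic p.1.2.1,
      p.1.2.2.contract p.2.2.2 p.2.2.1⟩⟩) (by
    constructor
    · rintro ⟨⟨Y, hYX, hY⟩, ⟨Z, hZY, hZ⟩⟩ ⟨⟨Y', hYX', hY'⟩, ⟨Z', hZY', hZ'⟩⟩ h
      obtain rfl : Z = Z' := congrArg (fun p => p.1.1) h
      obtain rfl : Y = Y' := eq_of_contract_eq hX hY hZ hZY hYX hY' hZY' hYX'
        (congrArg (fun p => p.2.1) h)
      rfl
    · rintro ⟨⟨Z, hZX, hZ⟩, ⟨K, hKs, hK⟩⟩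
      have c := hX.contractible hZ hZX
      refine ⟨⟨⟨insertion X Z K, insertion_isSub c, insertion_feynman c hK hKs hX⟩,
        ⟨Z, isSub_insertion c, hZ⟩⟩, ?_⟩
      exact Sigma.ext rfl (heq_of_eq (Subtype.ext (contract_insertion c hK hKs))))

end Diagram

open Relation

namespace Graph

variable {H : Type} {G G' : Graph} {X : Diagram H} {φ : G.H → H}

/-! ### The diagram of a graph -/

/-- The half-edges of the graph `G` are identified with those of the diagram `X`. -/
structure Models (G : Graph) (X : Diagram H) (φ : G.H → H) : Prop where
  inj : Function.Injective φ
  surj : Function.Surjective G.vert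
  vr_iff : ∀ {a b}, X.vr (φ a) (φ b) ↔ G.vert a = G.vert b
  adj_iff : ∀ {a b}, X.adj (φ a) (φ b) ↔ G.adj a b
  vr_range : ∀ {h k}, X.vr h k → (∃ a, φ a = h) ∧ ∃ b, φ b = k
  adj_range : ∀ {h k}, X.adj h k → (∃ a, φ a = h) ∧ ∃ b, φ b = k

/-- The diagram of a graph. -/
def diagram (G : Graph) : Diagram G.H := ⟨fun a b => G.vert a = G.vert b, G.adj⟩

theorem IsFeynman.surjective_vert (hG : G.IsFeynman) : Function.Surjective G.vert := by
  intro v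
  obtain ⟨a, ha⟩ := Set.nonempty_of_ncard_ne_zero (s := {h | G.vert h = v})
    (by rw [hG.trivalent]; omega)
  exact ⟨a, ha⟩

theorem models_diagram (hs : Function.Surjective G.vert) : Models G G.diagram id :=
  ⟨Function.injective_id, hs, Iff.rfl, Iff.rfl, fun _ => ⟨⟨_, rfl⟩, _, rfl⟩,
    fun _ => ⟨⟨_, rfl⟩, _, rfl⟩⟩

theorem comp_of_adj {a b : G.H} (h : G.adj a b) : G.comp (G.vert a) = G.comp (G.vert b) :=
  Quot.sound ⟨a, b, h, rfl, rfl⟩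

/-- A set of vertices that is closed under adjacency is a union of components. -/
theorem mem_of_comp_eq {S : Set G.V} (hS : ∀ a b, G.adj a b → (G.vert a ∈ S ↔ G.vert b ∈ S))
    {v w : G.V} (h : G.comp v = G.comp w) (hv : v ∈ S) : w ∈ S := by
  have h1 : ∀ v w, G.Link v w → (v ∈ S) = (w ∈ S) := by
    rintro _ _ ⟨a, b, hab, rfl, rfl⟩
    exact propext (hS a b hab)
  have h2 : (v ∈ S) = (w ∈ S) := congrArg (Quot.lift (· ∈ S) h1) h
  rwa [← h2]

namespace Models

variable (m : Models G X φ)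
include m

theorem vr_self (a : G.H) : X.vr (φ a) (φ a) := m.vr_iff.2 rfl

theorem vr_self_iff {h : H} : X.vr h h ↔ ∃ a, φ a = h :=
  ⟨fun h => (m.vr_range h).1, fun ⟨a, ha⟩ => ha ▸ m.vr_self a⟩

theorem exists_cn {a : G.H} {k : H} (hk : X.cn (φ a) k) :
    ∃ b, φ b = k ∧ G.comp (G.vert a) = G.comp (G.vert b) := by
  refine hk.mem_of_closed (S := {k | ∃ b, φ b = k ∧ G.comp (G.vert a) = G.comp (G.vert b)}) ?_ ?_
    ⟨a, rfl, rfl⟩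
  · rintro _ l hl ⟨b, rfl, hb⟩
    obtain ⟨_, d, rfl⟩ := m.vr_range hl
    exact ⟨d, rfl, hb.trans (congrArg G.comp (m.vr_iff.1 hl))⟩
  · rintro _ l hl ⟨b, rfl, hb⟩
    obtain ⟨_, d, rfl⟩ := m.adj_range hl
    exact ⟨d, rfl, hb.trans (comp_of_adj (m.adj_iff.1 hl))⟩

theorem cn_iff (hX : X.Basic) {a b : G.H} :
    X.cn (φ a) (φ b) ↔ G.comp (G.vert a) = G.comp (G.vert b) := by
  constructor
  · intro h
    obtain ⟨d, hd, h⟩ := m.exists_cn h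
    rwa [← m.inj hd]
  · intro h
    obtain ⟨d, hd, h⟩ := mem_of_comp_eq (S := {v | ∃ d, G.vert d = v ∧ X.cn (φ a) (φ d)}) (by
      intro x y hxy
      have hxy' := hX.cn_of_adj (m.adj_iff.2 hxy)
      constructor
      · rintro ⟨d, hd, h⟩
        exact ⟨y, rfl, Diagram.Basic.cn_trans (Diagram.Basic.cn_trans h
          (hX.cn_of_vr (m.vr_iff.2 hd))) hxy'⟩
      · rintro ⟨d, hd, h⟩
        exact ⟨x, rfl, Diagram.Basic.cn_trans (Diagram.Basic.cn_trans h
          (hX.cn_of_vr (m.vr_iff.2 hd))) (hX.cn_symm hxy')⟩)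
      h ⟨a, rfl, Diagram.Basic.cn_refl (m.vr_self a)⟩
    exact Diagram.Basic.cn_trans h (hX.cn_of_vr (m.vr_iff.2 hd))

theorem exists_adj_iff {a : G.H} : (∃ k, X.adj (φ a) k) ↔ ∃ b, G.adj a b := by
  constructor
  · rintro ⟨k, hk⟩
    obtain ⟨_, b, rfl⟩ := m.adj_range hk
    exact ⟨b, m.adj_iff.1 hk⟩
  · rintro ⟨b, hb⟩
    exact ⟨φ b, m.adj_iff.2 hb⟩

theorem mem_legs_iff (hX : X.Basic) {a b : G.H} :
    φ b ∈ X.legs (φ a) ↔ b ∈ G.legs (G.comp (G.vert a)) := by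
  refine and_congr ((m.cn_iff hX).trans eq_comm) ?_
  rw [← not_exists, ← not_exists, m.exists_adj_iff]

theorem legs_eq (hX : X.Basic) (a : G.H) : X.legs (φ a) = φ '' G.legs (G.comp (G.vert a)) := by
  ext k
  constructor
  · intro hk
    obtain ⟨b, rfl, _⟩ := m.exists_cn hk.1
    exact ⟨b, (m.mem_legs_iff hX).1 hk, rfl⟩
  · rintro ⟨b, hb, rfl⟩
    exact (m.mem_legs_iff hX).2 hb

theorem ncard_legs (hX : X.Basic) (a : G.H) :
    (X.legs (φ a)).ncard = (G.legs (G.comp (G.vert a))).ncard := by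
  rw [m.legs_eq hX, Set.ncard_image_of_injective _ m.inj]

theorem vertex_eq (a : G.H) : {k | X.vr (φ a) k} = φ '' {b | G.vert b = G.vert a} := by
  ext k
  constructor
  · intro hk
    obtain ⟨_, b, rfl⟩ := m.vr_range hk
    exact ⟨b, (m.vr_iff.1 hk).symm, rfl⟩
  · rintro ⟨b, hb, rfl⟩
    exact m.vr_iff.2 hb.symm

theorem basic (hG : G.IsFeynman) : X.Basic where
  vr_symm := fun h => by
    obtain ⟨⟨a, rfl⟩, b, rfl⟩ := m.vr_range h
    exact m.vr_iff.2 (m.vr_iff.1 h).symm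
  vr_trans := fun h h' => by
    obtain ⟨⟨a, rfl⟩, b, rfl⟩ := m.vr_range h
    obtain ⟨_, d, rfl⟩ := m.vr_range h'
    exact m.vr_iff.2 ((m.vr_iff.1 h).trans (m.vr_iff.1 h'))
  adj_symm := fun h => by
    obtain ⟨⟨a, rfl⟩, b, rfl⟩ := m.adj_range h
    exact m.adj_iff.2 (hG.adj_symm _ _ (m.adj_iff.1 h))
  adj_irrefl := fun h => by
    obtain ⟨⟨a, rfl⟩, _⟩ := m.adj_range h
    exact hG.adj_irrefl _ (m.adj_iff.1 h)
  adj_unique := fun h h' => by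
    obtain ⟨⟨a, rfl⟩, b, rfl⟩ := m.adj_range h
    obtain ⟨_, d, rfl⟩ := m.adj_range h'
    rw [hG.adj_unique _ _ _ (m.adj_iff.1 h) (m.adj_iff.1 h')]
  adj_mem := fun h => by
    obtain ⟨⟨a, rfl⟩, _⟩ := m.adj_range h
    exact m.vr_self a

/-- The half-edges in a set that only one edge leaves give a set of vertices closed under adjacency
once that edge is deleted, so the connectedness condition of the graph yields the cut condition of
the diagram. -/
theorem feynman (hG : G.IsFeynman) : X.Feynman :=
  have hX := m.basic hG
  { hX with
    trivalent := by
      intro h hh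
      obtain ⟨⟨a, rfl⟩, _⟩ := m.vr_range hh
      rw [m.vertex_eq, Set.ncard_image_of_injective _ m.inj]
      exact hG.trivalent _
    legs_card := by
      intro h hh
      obtain ⟨⟨a, rfl⟩, _⟩ := m.vr_range hh
      rw [m.ncard_legs hX]
      exact hG.legs_card _
    loop := by
      intro h hh
      obtain ⟨⟨a, rfl⟩, _⟩ := m.vr_range hh
      have h1 := hG.loop (G.comp (G.vert a))
      have := G.finiteV
      have h2 : 0 < {v | G.comp v = G.comp (G.vert a)}.ncard :=
        (Set.ncard_pos).2 ⟨G.vert a, rfl⟩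
      obtain ⟨b, hb, d, hd⟩ := Set.nonempty_of_ncard_ne_zero
        (s := G.inner (G.comp (G.vert a))) (by omega)
      exact ⟨φ b, φ d, (m.cn_iff hX).2 hb.symm, m.adj_iff.2 hd⟩
    irreducible := by
      intro S hS h k hk hother hh
      obtain ⟨⟨a, rfl⟩, b, rfl⟩ := m.adj_range hk
      have hab := m.adj_iff.1 hk
      have hmove : ∀ {x y}, G.vert x = G.vert y → φ x ∈ S → φ y ∈ S := fun h =>
        hS _ _ (m.vr_iff.2 h)
      obtain ⟨d, hd, hdS⟩ := mem_of_comp_eq (G := G.deleteEdge a b)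
        (S := {v | ∃ d, G.vert d = v ∧ φ d ∈ S}) (by
          have key : ∀ x y, (G.deleteEdge a b).adj x y → (∃ d, G.vert d = G.vert x ∧ φ d ∈ S) →
              ∃ d, G.vert d = G.vert y ∧ φ d ∈ S := by
            rintro x y ⟨hxy, ⟨hx1, hx2⟩, _⟩ ⟨d, hd, h⟩
            exact ⟨y, rfl, hother _ _ (m.adj_iff.2 hxy) (m.inj.ne hx1) (m.inj.ne hx2)
              (hmove hd h)⟩
          exact fun x y hxy => ⟨key x y hxy, key y x ⟨hG.adj_symm _ _ hxy.1, hxy.2.symm⟩⟩)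
        (hG.irreducible a b hab _ _ (comp_of_adj hab)) ⟨a, rfl, hh⟩
      exact hmove hd hdS }

end Models

/-- The number of half-edges on internal edges is even. -/
theorem even_ncard_inner (h1 : ∀ h k, G.adj h k → G.adj k h) (h2 : ∀ h, ¬ G.adj h h)
    (h3 : ∀ h k l, G.adj h k → G.adj h l → k = l) (c : G.Comp) : Even (G.inner c).ncard := by
  classical
  have := G.finiteH
  have := Fintype.ofFinite G.H
  have hch : ∀ a : G.H, ∃ b, (∃ k, G.adj a k) → G.adj a b := fun a => by
    by_cases h : ∃ k, G.adj a k
    · exact h.imp fun _ h _ => h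
    · exact ⟨a, fun h' => absurd h' h⟩
  choose σ hσ using hch
  have hmem : ∀ a, a ∈ (G.inner c).toFinset ↔ G.comp (G.vert a) = c ∧ ∃ k, G.adj a k := fun a =>
    Set.mem_toFinset
  -- Sending a half-edge to its partner is a fixed-point-free involution.
  have hsum : ∑ a ∈ (G.inner c).toFinset, (1 : ZMod 2) = 0 := by
    refine Finset.sum_involution (fun a _ => σ a) (fun a _ => by decide) ?_ ?_ ?_
    · intro a ha _ he
      have := hσ a ((hmem a).1 ha).2
      rw [he] at this
      exact h2 a this
    · intro a ha
      have := hσ a ((hmem a).1 ha).2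
      exact (hmem _).2 ⟨(comp_of_adj this).symm.trans ((hmem a).1 ha).1, a, h1 _ _ this⟩
    · intro a ha
      have := hσ a ((hmem a).1 ha).2
      exact h3 _ _ _ (hσ _ ⟨a, h1 _ _ this⟩) (h1 _ _ this)
  rw [Set.ncard_eq_toFinset_card']
  simpa [ZMod.natCast_eq_zero_iff_even] using hsum

theorem ncard_legs_add_inner (h3 : ∀ v, {h | G.vert h = v}.ncard = 3) (c : G.Comp) :
    (G.legs c).ncard + (G.inner c).ncard = 3 * {v | G.comp v = c}.ncard := by
  classical
  have := G.finiteH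
  have := G.finiteV
  have := Fintype.ofFinite G.H
  have := Fintype.ofFinite G.V
  rw [← Set.ncard_union_eq]
  · have h : G.legs c ∪ G.inner c = {h | G.comp (G.vert h) = c} := by
      ext a
      simp only [legs, inner, Set.mem_union, Set.mem_ofPred_eq, ← and_or_left]
      refine and_iff_left ?_
      rw [← not_exists, or_comm]
      exact em _
    have h4 := Finset.sum_card_fiberwise_eq_card_filter Finset.univ
      ({v | G.comp v = c} : Set G.V).toFinset G.vert
    have h5 : ∀ v, (Finset.univ.filter fun a => G.vert a = v).card = 3 := fun v => by
      rw [← h3 v, Set.ncard_eq_toFinset_card', Set.toFinset_ofPred]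
    simp only [h5, Finset.sum_const, smul_eq_mul] at h4
    rw [h, Set.ncard_eq_toFinset_card', Set.ncard_eq_toFinset_card', mul_comm, h4]
    congr 1
    ext a
    simp
  · rw [Set.disjoint_left]
    rintro a ⟨_, h1⟩ ⟨_, k, h2⟩
    exact h1 k h2

namespace Models

variable (m : Models G X φ)
include m

/-- The diagram only records that each component has an internal edge; the positive Betti number is
recovered by counting. -/
theorem isFeynman (hX : X.Feynman) : G.IsFeynman :=
  have hsymm : ∀ h k, G.adj h k → G.adj k h := fun h k hk =>
    m.adj_iff.1 (hX.adj_symm (m.adj_iff.2 hk))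
  have hirr : ∀ h, ¬ G.adj h h := fun h hh => hX.adj_irrefl (m.adj_iff.2 hh)
  have huniq : ∀ h k l, G.adj h k → G.adj h l → k = l := fun h k l hk hl =>
    m.inj (hX.adj_unique (m.adj_iff.2 hk) (m.adj_iff.2 hl))
  have htri : ∀ v, {h | G.vert h = v}.ncard = 3 := by
    intro v
    obtain ⟨a, rfl⟩ := m.surj v
    rw [← Set.ncard_image_of_injective _ m.inj, ← m.vertex_eq]
    exact hX.trivalent (m.vr_self a)
  have hlegs : ∀ c, (G.legs c).ncard = 2 ∨ (G.legs c).ncard = 3 := by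
    intro c
    obtain ⟨v, rfl⟩ := Quot.mk_surjective c
    obtain ⟨a, rfl⟩ := m.surj v
    have := hX.legs_card (m.vr_self a)
    rwa [m.ncard_legs hX.toBasic] at this
  { adj_symm := hsymm
    adj_irrefl := hirr
    adj_unique := huniq
    trivalent := htri
    legs_card := hlegs
    loop := by
      intro c
      have h1 := even_ncard_inner hsymm hirr huniq c
      have h2 := ncard_legs_add_inner htri c
      have h3 := hlegs c
      have h4 : (G.inner c).ncard ≠ 0 := by
        obtain ⟨v, rfl⟩ := Quot.mk_surjective c
        obtain ⟨a, rfl⟩ := m.surj v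
        obtain ⟨k, l, hk, hl⟩ := hX.loop (m.vr_self a)
        obtain ⟨b, rfl, hb⟩ := m.exists_cn hk
        obtain ⟨d, hd⟩ := m.exists_adj_iff.1 ⟨l, hl⟩
        have := G.finiteH
        exact Set.ncard_ne_zero_of_mem (a := b) ⟨hb.symm, d, hd⟩
      -- With `V` vertices there are `3V - 2` or `3V - 3` internal half-edges. This number is even
      -- and nonzero, which rules out the values of `V` for which it is below `2V`.
      obtain ⟨r, hr⟩ := h1
      omega
    irreducible := by
      intro h k hk v w hvw
      -- The cut condition is applied to the half-edges whose vertices are still connected with that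
      -- of `h` after the deletion.
      have hends : (G.deleteEdge h k).comp (G.vert h) = (G.deleteEdge h k).comp (G.vert k) := by
        obtain ⟨b, hb, hbk⟩ := hX.irreducible
          {z | ∃ b, φ b = z ∧ (G.deleteEdge h k).comp (G.vert h) = (G.deleteEdge h k).comp (G.vert b)}
          (by
            rintro _ l hl ⟨b, rfl, hb⟩
            obtain ⟨_, d, rfl⟩ := m.vr_range hl
            exact ⟨d, rfl, hb.trans (congrArg _ (m.vr_iff.1 hl))⟩)
          (m.adj_iff.2 hk)
          (by
            rintro _ l hl h1 h2 ⟨b, rfl, hb⟩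
            obtain ⟨_, d, rfl⟩ := m.adj_range hl
            have hbd := m.adj_iff.1 hl
            refine ⟨d, rfl, hb.trans (comp_of_adj (G := G.deleteEdge h k)
              ⟨hbd, ⟨fun h => h1 (h ▸ rfl), fun h => h2 (h ▸ rfl)⟩, ?_, ?_⟩)⟩
            · rintro rfl
              exact h2 (congrArg φ (huniq _ _ _ (hsymm _ _ hbd) hk))
            · rintro rfl
              exact h1 (congrArg φ (huniq _ _ _ (hsymm _ _ hbd) (hsymm _ _ hk))))
          ⟨h, rfl, rfl⟩
        rwa [m.inj hb] at hbk
      have hcomp : ∀ x y, G.adj x y →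
          (G.deleteEdge h k).comp (G.vert x) = (G.deleteEdge h k).comp (G.vert y) := by
        intro x y hxy
        by_cases hxh : x = h
        · subst hxh
          rwa [huniq _ _ _ hxy hk]
        by_cases hxk : x = k
        · subst hxk
          rw [huniq _ _ _ hxy (hsymm _ _ hk)]
          exact hends.symm
        refine comp_of_adj (G := G.deleteEdge h k) ⟨hxy, ⟨hxh, hxk⟩, ?_, ?_⟩
        · rintro rfl
          exact hxk (huniq _ _ _ (hsymm _ _ hxy) hk)
        · rintro rfl
          exact hxh (huniq _ _ _ (hsymm _ _ hxy) (hsymm _ _ hk))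
      refine mem_of_comp_eq (G := G)
        (S := {w | (G.deleteEdge h k).comp v = (G.deleteEdge h k).comp w}) ?_ hvw rfl
      intro x y hxy
      rw [Set.mem_ofPred_eq, Set.mem_ofPred_eq, hcomp x y hxy] }

/-- Two graphs with the same diagram are isomorphic. -/
theorem iso {φ' : G'.H → H} (m' : Models G' X φ') : Graph.isoSetoid.r G G' := by
  have hex : ∀ a, ∃ b, φ' b = φ a := fun a => (m'.vr_range (m.vr_self a)).1
  have hex' : ∀ b, ∃ a, φ a = φ' b := fun b => (m.vr_range (m'.vr_self b)).1
  choose d hd using hex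
  choose d' hd' using hex'
  let D : G.H ≃ G'.H := ⟨d, d', fun a => m.inj ((hd' _).trans (hd a)),
    fun b => m'.inj ((hd _).trans (hd' b))⟩
  have hvert : ∀ a b, G'.vert (d a) = G'.vert (d b) ↔ G.vert a = G.vert b := fun a b => by
    rw [← m'.vr_iff, ← m.vr_iff, hd, hd]
  choose s hs using m.surj
  have hE : Function.Bijective fun v => G'.vert (d (s v)) := by
    constructor
    · intro v w h
      rw [← hs v, ← hs w]
      exact (hvert _ _).1 h
    · intro w
      obtain ⟨b, rfl⟩ := m'.surj w
      obtain ⟨a, rfl⟩ := D.surjective b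
      exact ⟨G.vert a, (hvert _ _).2 (hs _)⟩
  refine ⟨Equiv.ofBijective _ hE, D, fun a => (hvert _ _).2 (hs _).symm, fun a b => ?_⟩
  rw [← m'.adj_iff, ← m.adj_iff]
  exact iff_of_eq (congrArg₂ X.adj (hd a) (hd b))

omit m in
theorem of_iso {X : Diagram H} {φ' : G'.H → H} (m' : Models G' X φ')
    {e : G.V ≃ G'.V} {d : G.H ≃ G'.H} (h1 : ∀ h, G'.vert (d h) = e (G.vert h))
    (h2 : ∀ h k, G'.adj (d h) (d k) ↔ G.adj h k) : Models G X (φ' ∘ d) where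
  inj := m'.inj.comp d.injective
  surj := by
    intro v
    obtain ⟨b, hb⟩ := m'.surj (e v)
    refine ⟨d.symm b, e.injective ?_⟩
    rw [← h1, d.apply_symm_apply, hb]
  vr_iff := by
    intro a b
    rw [Function.comp, Function.comp, m'.vr_iff, h1, h1, e.apply_eq_iff_eq]
  adj_iff := by
    intro a b
    rw [Function.comp, Function.comp, m'.adj_iff, h2]
  vr_range := fun h => by
    obtain ⟨⟨a, rfl⟩, b, rfl⟩ := m'.vr_range h
    exact ⟨⟨d.symm a, by simp⟩, d.symm b, by simp⟩
  adj_range := fun h => by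
    obtain ⟨⟨a, rfl⟩, b, rfl⟩ := m'.adj_range h
    exact ⟨⟨d.symm a, by simp⟩, d.symm b, by simp⟩

theorem sum {K : Graph} {H' : Type} {X' : Diagram H'} {φ' : K.H → H'} (m' : Models K X' φ') :
    Models (G.sum K) (X.sum X') (Sum.map φ φ') where
  inj := m.inj.sumMap m'.inj
  surj := m.surj.sumMap m'.surj
  vr_iff := by
    rintro (a | a) (b | b) <;> simp [Diagram.sum, m.vr_iff, m'.vr_iff]
  adj_iff := by
    rintro (a | a) (b | b) <;> simp [Diagram.sum, m.adj_iff, m'.adj_iff]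
  vr_range := fun h => by
    cases h with
    | inl h =>
      obtain ⟨⟨a, rfl⟩, b, rfl⟩ := m.vr_range h
      exact ⟨⟨.inl a, rfl⟩, .inl b, rfl⟩
    | inr h =>
      obtain ⟨⟨a, rfl⟩, b, rfl⟩ := m'.vr_range h
      exact ⟨⟨.inr a, rfl⟩, .inr b, rfl⟩
  adj_range := fun h => by
    cases h with
    | inl h =>
      obtain ⟨⟨a, rfl⟩, b, rfl⟩ := m.adj_range h
      exact ⟨⟨.inl a, rfl⟩, .inl b, rfl⟩
    | inr h =>
      obtain ⟨⟨a, rfl⟩, b, rfl⟩ := m'.adj_range h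
      exact ⟨⟨.inr a, rfl⟩, .inr b, rfl⟩

end Models

end Graph

namespace Graph

variable {H : Type} {G : Graph} {X : Diagram H} {φ : G.H → H}

/-! ### The diagrams of subgraphs and contractions -/

namespace Part

/-- The diagram of a part of a graph. -/
def diagram (P : G.Part) (φ : G.H → H) : Diagram H where
  vr h k := ∃ a b, φ a = h ∧ φ b = k ∧ G.vert a = G.vert b ∧ G.vert a ∈ P.verts
  adj h k := ∃ a b, φ a = h ∧ φ b = k ∧ P.adj a b

end Part

namespace Models

variable (m : Models G X φ) (P : G.Part)
include m

theorem part_vr_iff {a b : G.H} : (P.diagram φ).vr (φ a) (φ b) ↔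
    G.vert a = G.vert b ∧ G.vert a ∈ P.verts := by
  constructor
  · rintro ⟨a', b', ha, hb, h⟩
    rwa [m.inj ha, m.inj hb] at h
  · exact fun h => ⟨a, b, rfl, rfl, h⟩

theorem part_vr_self_iff {a : G.H} : (P.diagram φ).vr (φ a) (φ a) ↔ G.vert a ∈ P.verts :=
  (m.part_vr_iff P).trans (and_iff_right rfl)

theorem part_adj_iff {a b : G.H} : (P.diagram φ).adj (φ a) (φ b) ↔ P.adj a b := by
  constructor
  · rintro ⟨a', b', ha, hb, h⟩
    rwa [m.inj ha, m.inj hb] at h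
  · exact fun h => ⟨a, b, rfl, rfl, h⟩

theorem toGraph : Models P.toGraph (P.diagram φ) fun a => φ a.1 where
  inj := m.inj.comp Subtype.val_injective
  surj := by
    rintro ⟨v, hv⟩
    obtain ⟨a, rfl⟩ := m.surj v
    exact ⟨⟨a, hv⟩, rfl⟩
  vr_iff := by
    intro a b
    rw [m.part_vr_iff, and_iff_left a.2, Subtype.ext_iff]
  adj_iff := m.part_adj_iff P
  vr_range := by
    rintro h k ⟨a, b, rfl, rfl, hab, ha⟩
    exact ⟨⟨⟨a, ha⟩, rfl⟩, ⟨b, hab ▸ ha⟩, rfl⟩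
  adj_range := by
    rintro h k ⟨a, b, rfl, rfl, hab⟩
    exact ⟨⟨⟨a, (P.adj_sub a b hab).2.1⟩, rfl⟩, ⟨b, (P.adj_sub a b hab).2.2⟩, rfl⟩

theorem part_isSub : (P.diagram φ).IsSub X where
  vr_le := by
    rintro h k ⟨a, b, rfl, rfl, hab, ha⟩
    exact m.vr_iff.2 hab
  vr_full := by
    rintro h k hh hk
    obtain ⟨⟨a, rfl⟩, b, rfl⟩ := m.vr_range hk
    exact (m.part_vr_iff P).2 ⟨m.vr_iff.1 hk, (m.part_vr_self_iff P).1 hh⟩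
  adj_le := by
    rintro h k ⟨a, b, rfl, rfl, hab⟩
    exact m.adj_iff.2 (P.adj_sub a b hab).1

theorem exists_mem_of_part_cn {a : P.toGraph.H} {k : H} (hk : (P.diagram φ).cn (φ a.1) k) :
    ∃ b : P.toGraph.H, φ b.1 = k :=
  ((m.toGraph P).exists_cn hk).imp fun _ => And.left

variable {P} (hZ : (P.diagram φ).Feynman)
include hZ

theorem part_pass_iff {x y : P.toGraph.H} : (P.diagram φ).Pass (φ x.1) (φ y.1) ↔
    (P.toGraph.legs (P.toGraph.comp (P.toGraph.vert x))).ncard = 2 ∧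
      x ∈ P.toGraph.legs (P.toGraph.comp (P.toGraph.vert x)) ∧
      y ∈ P.toGraph.legs (P.toGraph.comp (P.toGraph.vert x)) ∧ x ≠ y := by
  have n := m.toGraph P
  unfold Diagram.Pass
  rw [n.ncard_legs hZ.toBasic x, n.mem_legs_iff hZ.toBasic (a := x) (b := x),
    n.mem_legs_iff hZ.toBasic (a := x) (b := y), n.inj.ne_iff (x := x) (y := y)]

theorem thread_of_part {a b : G.H} (h : P.Thread a b) :
    Diagram.Thread X (P.diagram φ) (φ a) (φ b) := by
  induction h with
  | edge h => exact .edge (m.adj_iff.2 h)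
  | @through k c x y _ h1 h2 h3 h4 h5 ih =>
    obtain rfl := h2.1
    exact .through ih ((m.part_pass_iff hZ).2 ⟨h1, h2, h3, h4⟩) (m.adj_iff.2 h5)

theorem exists_thread {a : G.H} {k : H} (h : Diagram.Thread X (P.diagram φ) (φ a) k) :
    ∃ b, φ b = k ∧ P.Thread a b := by
  obtain ⟨a', ha⟩ : ∃ a', a' = φ a := ⟨_, rfl⟩
  rw [← ha] at h
  induction h with
  | edge h =>
    subst ha
    obtain ⟨_, b, rfl⟩ := m.adj_range h
    exact ⟨b, rfl, .edge (m.adj_iff.1 h)⟩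
  | @through x y k _ hp h ih =>
    obtain ⟨b, rfl, hb⟩ := ih
    obtain ⟨x', hx⟩ := ((m.toGraph P).vr_range hp.mem).1
    obtain rfl := m.inj hx
    obtain ⟨y', rfl⟩ := m.exists_mem_of_part_cn P hp.cn
    obtain ⟨_, d, rfl⟩ := m.adj_range h
    obtain ⟨h1, h2, h3, h4⟩ := (m.part_pass_iff hZ).1 hp
    exact ⟨d, rfl, .through _ x' y' hb h1 h2 h3 h4 (m.adj_iff.1 h)⟩

theorem thread_iff {a b : G.H} :
    Diagram.Thread X (P.diagram φ) (φ a) (φ b) ↔ P.Thread a b := by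
  refine ⟨fun h => ?_, m.thread_of_part hZ⟩
  obtain ⟨d, hd, h⟩ := m.exists_thread hZ h
  rwa [← m.inj hd]

theorem cMem_quotH (x : P.QuotH) : Diagram.CMem X (P.diagram φ) (φ x.val) := by
  have n := m.toGraph P
  rcases x with ⟨a, ha⟩ | ⟨⟨c, hc, k, hk, l, hl⟩, y, hy⟩
  · exact .inl ⟨m.vr_self a, fun h => ha ((m.part_vr_self_iff P).1 h)⟩
  · obtain rfl := hy.1
    refine .inr ⟨(n.mem_legs_iff hZ.toBasic).2 hy, (n.ncard_legs hZ.toBasic y).trans hc, φ k.1,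
      (n.mem_legs_iff hZ.toBasic (a := y)).2 hk, φ l, m.adj_iff.2 hl⟩

theorem exists_quotH {h : H} (hm : Diagram.CMem X (P.diagram φ) h) :
    ∃ x : P.QuotH, φ x.val = h := by
  have n := m.toGraph P
  rcases hm with ⟨h1, h2⟩ | ⟨h1, h2, k, hk, l, hl⟩
  · obtain ⟨a, rfl⟩ := m.vr_self_iff.1 h1
    exact ⟨.inl ⟨a, fun h => h2 ((m.part_vr_self_iff P).2 h)⟩, rfl⟩
  · obtain ⟨y, rfl⟩ := n.vr_self_iff.1 h1.1.1
    obtain ⟨z, rfl⟩ := m.exists_mem_of_part_cn P hk.1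
    obtain ⟨l', hl'⟩ := m.exists_adj_iff.1 ⟨l, hl⟩
    rw [n.ncard_legs hZ.toBasic y] at h2
    exact ⟨.inr ⟨⟨P.toGraph.comp (P.toGraph.vert y), h2, z,
      (n.mem_legs_iff hZ.toBasic (a := y)).1 hk, l', hl'⟩, y,
      (n.mem_legs_iff hZ.toBasic (a := y)).1 h1⟩, rfl⟩

/-- `QuotH.val` identifies the half-edges of the contracted graph with those satisfying `CMem`. It
is injective because a leg determines its component and does not sit at a vertex outside the part.
-/
theorem contract : Models P.contract (Diagram.contract X (P.diagram φ)) fun x => φ x.val := by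
  have n := m.toGraph P
  have hs := m.part_isSub P
  have hval : ∀ x y : P.QuotH, x.val = y.val → x = y := by
    rintro (⟨a, ha⟩ | ⟨c, y, hy⟩) (⟨b, hb⟩ | ⟨d, z, hz⟩) h
    · obtain rfl : a = b := h
      rfl
    · obtain rfl : a = z.1 := h
      exact absurd z.2 ha
    · obtain rfl : y.1 = b := h
      exact absurd y.2 hb
    · obtain rfl : y = z := Subtype.ext h
      obtain rfl : c = d := Subtype.ext (hy.1.symm.trans hz.1)
      rfl
  refine ⟨fun x y h => hval x y (m.inj h), ?_, ?_, ?_, ?_, ?_⟩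
  · rintro (⟨v, hv⟩ | c)
    · obtain ⟨a, rfl⟩ := m.surj v
      exact ⟨.inl ⟨a, hv⟩, rfl⟩
    · have h := c.2.1
      obtain ⟨y, hy⟩ := Set.nonempty_of_ncard_ne_zero (s := P.toGraph.legs c.1) (by omega)
      exact ⟨.inr ⟨c, y, hy⟩, rfl⟩
  · intro x y
    refine Iff.trans (b := X.vr (φ x.val) (φ y.val) ∨ (P.diagram φ).cn (φ x.val) (φ y.val))
      ⟨fun h => h.2.2, fun h => ⟨m.cMem_quotH hZ x, m.cMem_quotH hZ y, h⟩⟩ ?_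
    have hnot : ∀ (a : G.H) (k : H), G.vert a ∉ P.verts → ¬ (P.diagram φ).cn (φ a) k :=
      fun a k ha h => ha ((m.part_vr_self_iff P).1 h.1)
    rcases x with ⟨a, ha⟩ | ⟨c, x, hx⟩ <;> rcases y with ⟨b, hb⟩ | ⟨d, y, hy⟩
    · refine (or_iff_left (hnot a _ ha)).trans (m.vr_iff.trans ?_)
      exact Subtype.mk_eq_mk.symm.trans Sum.inl_injective.eq_iff.symm
    · refine iff_of_false ?_ (by simp)
      rintro (h | h)
      · refine ha ?_
        rw [show G.vert a = G.vert y.1 from m.vr_iff.1 h]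
        exact y.2
      · exact hnot a _ ha h
    · refine iff_of_false ?_ (by simp)
      rintro (h | h)
      · refine hb ?_
        rw [← show G.vert x.1 = G.vert b from m.vr_iff.1 h]
        exact x.2
      · exact hnot b _ hb (hZ.cn_symm h)
    · have h1 : (P.diagram φ).cn (φ x.1) (φ y.1) ↔ c = d := by
        rw [n.cn_iff hZ.toBasic (a := x) (b := y), hx.1, hy.1]
        exact Subtype.ext_iff.symm
      have h2 : X.vr (φ x.1) (φ y.1) → (P.diagram φ).cn (φ x.1) (φ y.1) := fun h =>
        hZ.cn_of_vr (hs.vr_full ((m.part_vr_self_iff P).2 x.2) h)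
      exact ((or_iff_right_of_imp h2).trans h1).trans Sum.inr_injective.eq_iff.symm
  · intro x y
    exact ⟨fun h => (m.thread_iff hZ).1 h.2.2, fun h =>
      ⟨m.cMem_quotH hZ x, m.cMem_quotH hZ y, (m.thread_iff hZ).2 h⟩⟩
  · exact fun h => ⟨m.exists_quotH hZ h.1, m.exists_quotH hZ h.2.1⟩
  · exact fun h => ⟨m.exists_quotH hZ h.1, m.exists_quotH hZ h.2.1⟩

omit hZ P

/-- The Feynman subgraphs of a graph are those of its diagram. -/
noncomputable def subs [Finite H] (hX : X.Feynman) : G.FeynmanSub ≃ X.Subs :=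
  Equiv.ofBijective
    (fun P => ⟨P.1.diagram φ, m.part_isSub P.1, (m.toGraph P.1).feynman P.2.1⟩) (by
    constructor
    · rintro ⟨P, hP⟩ ⟨Q, hQ⟩ h
      replace h : P.diagram φ = Q.diagram φ := congrArg Subtype.val h
      have h1 : P.verts = Q.verts := by
        ext v
        obtain ⟨a, rfl⟩ := m.surj v
        rw [← m.part_vr_self_iff P, ← m.part_vr_self_iff Q, h]
      have h2 : P.adj = Q.adj := by
        ext a b
        rw [← m.part_adj_iff P, ← m.part_adj_iff Q, h]
      refine Subtype.ext ?_
      obtain ⟨_, _, _⟩ := P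
      obtain ⟨_, _, _⟩ := Q
      obtain rfl := h1
      obtain rfl := h2
      rfl
    · rintro ⟨Z, hs, hZ⟩
      -- The vertices of the part are those with a half-edge present in `Z`; fullness of `Z` at its
      -- vertices makes its diagram equal to `Z`.
      let P : G.Part :=
        { verts := {v | ∃ a, G.vert a = v ∧ Z.vr (φ a) (φ a)}
          adj := fun a b => Z.adj (φ a) (φ b)
          adj_sub := fun a b h => ⟨m.adj_iff.1 (hs.adj_le h), ⟨a, rfl, hZ.adj_mem h⟩, b, rfl,
            hZ.adj_mem_right h⟩ }
      have hP : P.diagram φ = Z := by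
        refine Diagram.ext (fun h k => ?_) fun h k => ?_
        · constructor
          · rintro ⟨a, b, rfl, rfl, hab, c, hc, hcZ⟩
            exact hZ.vr_trans (hZ.vr_symm (hs.vr_full hcZ (m.vr_iff.2 hc)))
              (hs.vr_full hcZ (m.vr_iff.2 (hc.trans hab)))
          · intro hk
            obtain ⟨⟨a, rfl⟩, b, rfl⟩ := m.vr_range (hs.vr_le hk)
            exact ⟨a, b, rfl, rfl, m.vr_iff.1 (hs.vr_le hk), a, rfl, hZ.vr_left hk⟩
        · constructor
          · rintro ⟨a, b, rfl, rfl, hab⟩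
            exact hab
          · intro hk
            obtain ⟨⟨a, rfl⟩, b, rfl⟩ := m.adj_range (hs.adj_le hk)
            exact ⟨a, b, rfl, rfl, hk⟩
      have hZ' : (P.diagram φ).Feynman := hP ▸ hZ
      exact ⟨⟨P, (m.toGraph P).isFeynman hZ',
        (m.contract hZ').isFeynman (hX.contract hZ' (m.part_isSub P))⟩, Subtype.ext hP⟩)

theorem sub_models [Finite H] (hX : X.Feynman) (P : G.FeynmanSub) :
    Models P.1.toGraph (m.subs hX P).1 fun a => φ a.1 :=
  m.toGraph P.1

theorem quot_models [Finite H] (hX : X.Feynman) (P : G.FeynmanSub) :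
    Models P.1.contract (Diagram.contract X (m.subs hX P).1) fun x => φ x.val :=
  m.contract (m.subs hX P).2.2

omit m in
/-- The half-edges of a graph other than the external edges of components with three external
edges. -/
def _root_.HallCK.Graph.core (G : Graph) : Set G.H :=
  {h | ¬ (h ∈ G.legs (G.comp (G.vert h)) ∧ (G.legs (G.comp (G.vert h))).ncard = 3)}

theorem core_eq (hX : X.Basic) : X.core = φ '' G.core := by
  ext h
  constructor
  · rintro ⟨h1, h2⟩
    obtain ⟨a, rfl⟩ := m.vr_self_iff.1 h1
    rw [m.mem_legs_iff hX, m.ncard_legs hX] at h2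
    exact ⟨a, h2, rfl⟩
  · rintro ⟨a, h2, rfl⟩
    refine ⟨m.vr_self a, ?_⟩
    rwa [m.mem_legs_iff hX, m.ncard_legs hX]

theorem ncard_core (hX : X.Basic) : X.core.ncard = G.core.ncard := by
  rw [m.core_eq hX, Set.ncard_image_of_injective _ m.inj]

end Models

end Graph

open HallData Diagram

/-! ### Feynman graphs as graded Hall data -/

/-- The objects of `LFG`. -/
abbrev FeynmanGraph : Type 1 := {G : Graph // G.IsFeynman}

namespace FeynmanGraph

variable {H H' : Type} {X Y : Diagram H} {G K : FeynmanGraph} {φ : G.1.H → H} {ψ : K.1.H → H}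

/-- The isomorphism class of a Feynman graph. -/
def cls (G : FeynmanGraph) : LFG.Iso := LFG.cls G

/-- The disjoint union. -/
abbrev sum (G K : FeynmanGraph) : FeynmanGraph := ⟨G.1.sum K.1, Graph.sum_isFeynman G.2 K.2⟩

/-- A subgraph. -/
abbrev sub (G : FeynmanGraph) (P : G.1.FeynmanSub) : FeynmanGraph := ⟨P.1.toGraph, P.2.1⟩

/-- A contraction. -/
abbrev quot (G : FeynmanGraph) (P : G.1.FeynmanSub) : FeynmanGraph := ⟨P.1.contract, P.2.2⟩

/-- Isomorphisms of graphs are obtained from here on from equalities of diagrams. -/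
theorem cls_eq (m : G.1.Models X φ) (n : K.1.Models Y ψ) (h : X = Y) : G.cls = K.cls := by
  subst h
  exact Quotient.sound (s := LFG.iso) (m.iso n)

theorem exists_models (h : G.cls = K.cls) : ∃ φ : G.1.H → K.1.H, G.1.Models K.1.diagram φ := by
  have h' : LFG.iso.r G K := Quotient.exact (s := LFG.iso) h
  obtain ⟨e, d, h1, h2⟩ := h'
  exact ⟨_, (Graph.models_diagram K.2.surjective_vert).of_iso h1 h2⟩

theorem models (G : FeynmanGraph) : G.1.Models G.1.diagram id :=
  Graph.models_diagram G.2.surjective_vert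

theorem feynman (G : FeynmanGraph) : G.1.diagram.Feynman := G.models.feynman G.2

theorem cls_sum_congr {G' K' : FeynmanGraph} (h : G.cls = G'.cls) (h' : K.cls = K'.cls) :
    (G.sum K).cls = (G'.sum K').cls := by
  obtain ⟨φ, m⟩ := exists_models h
  obtain ⟨ψ, n⟩ := exists_models h'
  exact cls_eq (m.sum n) (G'.models.sum K'.models) rfl

noncomputable instance : Add LFG.Iso where
  add := Quotient.map₂ FeynmanGraph.sum fun _ _ h _ _ h' =>
    Quotient.exact (cls_sum_congr (Quotient.sound h) (Quotient.sound h'))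

noncomputable instance : Zero LFG.Iso where
  zero := cls ⟨Graph.empty, Graph.empty_isFeynman⟩

theorem cls_eq_of_equiv (e : G.1.V ≃ K.1.V) (d : G.1.H ≃ K.1.H)
    (h1 : ∀ h, K.1.vert (d h) = e (G.1.vert h)) (h2 : ∀ h k, K.1.adj (d h) (d k) ↔ G.1.adj h k) :
    G.cls = K.cls :=
  Quotient.sound (s := LFG.iso) ⟨e, d, h1, h2⟩

noncomputable instance : AddCommMonoid LFG.Iso where
  nsmul := nsmulRec
  add_assoc := by
    rintro ⟨G⟩ ⟨K⟩ ⟨L⟩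
    refine cls_eq_of_equiv (G := (FeynmanGraph.sum G K).sum L) (K := sum G (sum K L))
      (Equiv.sumAssoc _ _ _) (Equiv.sumAssoc _ _ _) ?_ ?_
    · rintro ((h | h) | h) <;> rfl
    · rintro ((h | h) | h) ((k | k) | k) <;> simp
  zero_add := by
    rintro ⟨G⟩
    refine cls_eq_of_equiv (G := sum ⟨Graph.empty, Graph.empty_isFeynman⟩ G) (K := G)
      (Equiv.emptySum _ _) (Equiv.emptySum _ _) ?_ ?_
    · rintro (h | h)
      · exact h.elim
      · rfl
    · rintro (h | h) (k | k)
      · exact h.elim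
      · exact h.elim
      · exact k.elim
      · simp
  add_zero := by
    rintro ⟨G⟩
    refine cls_eq_of_equiv (G := sum G ⟨Graph.empty, Graph.empty_isFeynman⟩) (K := G)
      (Equiv.sumEmpty _ _) (Equiv.sumEmpty _ _) ?_ ?_
    · rintro (h | h)
      · rfl
      · exact h.elim
    · rintro (h | h) (k | k)
      · simp
      · exact k.elim
      · exact h.elim
      · exact h.elim
  add_comm := by
    rintro ⟨G⟩ ⟨K⟩
    refine cls_eq_of_equiv (G := sum G K) (K := sum K G) (Equiv.sumComm _ _) (Equiv.sumComm _ _)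
      ?_ ?_
    · rintro (h | h) <;> rfl
    · rintro (h | h) (k | k) <;> simp

theorem cls_sum (G K : FeynmanGraph) : (G.sum K).cls = G.cls + K.cls := rfl

theorem core_sum (G K : Graph) : (G.sum K).core = Sum.inl '' G.core ∪ Sum.inr '' K.core := by
  ext (h | h)
  · change ¬ (Sum.inl h ∈ (G.sum K).legs ((G.sum K).comp (.inl (G.vert h))) ∧
      ((G.sum K).legs ((G.sum K).comp (.inl (G.vert h)))).ncard = 3) ↔ _
    rw [Graph.sum_legs_inl, Set.ncard_image_of_injective _ Sum.inl_injective]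
    simp [Graph.core]
  · change ¬ (Sum.inr h ∈ (G.sum K).legs ((G.sum K).comp (.inr (K.vert h))) ∧
      ((G.sum K).legs ((G.sum K).comp (.inr (K.vert h)))).ncard = 3) ↔ _
    rw [Graph.sum_legs_inr, Set.ncard_image_of_injective _ Sum.inr_injective]
    simp [Graph.core]

/-- The number of half-edges that are not external edges of components with three external edges. -/
noncomputable def deg : LFG.Iso →+ ℕ where
  toFun := Quotient.lift (fun G : FeynmanGraph => G.1.core.ncard) fun G K h => by
    obtain ⟨φ, m⟩ := exists_models (G := G) (K := K) (Quotient.sound h)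
    exact (m.ncard_core (feynman K).toBasic).symm.trans
      ((models K).ncard_core (feynman K).toBasic)
  map_zero' := by
    change Set.ncard (α := Empty) _ = 0
    exact (congrArg Set.ncard (Set.eq_empty_of_isEmpty (α := Empty) _)).trans (Set.ncard_empty _)
  map_add' := by
    rintro ⟨G⟩ ⟨K⟩
    change (G.1.sum K.1).core.ncard = G.1.core.ncard + K.1.core.ncard
    have := G.1.finiteH
    have := K.1.finiteH
    rw [core_sum, Set.ncard_union_eq, Set.ncard_image_of_injective _ Sum.inl_injective,
      Set.ncard_image_of_injective _ Sum.inr_injective]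
    rw [Set.disjoint_left]
    rintro _ ⟨a, _, rfl⟩ ⟨b, _, h⟩
    cases h

theorem deg_cls (m : G.1.Models X φ) : deg G.cls = X.core.ncard :=
  (m.ncard_core (m.basic G.2)).symm

theorem models_empty (hG : IsEmpty G.1.H) : G.1.Models (Diagram.empty H) fun a => hG.elim a where
  inj := fun a => hG.elim a
  surj := G.2.surjective_vert
  vr_iff := fun {a} => hG.elim a
  adj_iff := fun {a} => hG.elim a
  vr_range := False.elim
  adj_range := False.elim

theorem cls_eq_zero (m : G.1.Models (Diagram.empty H) φ) : G.cls = 0 :=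
  cls_eq (K := ⟨Graph.empty, Graph.empty_isFeynman⟩) m
    (models_empty (inferInstanceAs (IsEmpty Empty))) rfl

theorem eq_empty_of_cls_eq_zero (m : G.1.Models X φ) (h : G.cls = 0) : X = Diagram.empty H := by
  obtain ⟨ψ, _⟩ := exists_models (K := ⟨Graph.empty, Graph.empty_isFeynman⟩) h
  have hG : ∀ a : G.1.H, False := fun a => (ψ a : Empty).elim
  exact Diagram.ext (fun h k => ⟨fun hk => (m.vr_range hk).1.elim fun a _ => hG a, False.elim⟩)
    fun h k => ⟨fun hk => (m.adj_range hk).1.elim fun a _ => hG a, False.elim⟩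

theorem card_half_le (G : FeynmanGraph) : Nat.card G.1.H ≤ deg G.cls * 3 := by
  have := G.1.finiteH
  rw [deg_cls G.models, ← Set.ncard_univ]
  convert G.feynman.card_le
  exact (Set.eq_univ_of_forall fun a => G.models.vr_self a).symm

/-- Degree `d` allows at most `3d` half-edges, and every vertex carries one, so each class is
represented by incidence data on initial segments of bounded size. Data that are no Feynman graph
are sent to the class `0`. -/
theorem finite_deg (d : ℕ) : {A : LFG.Iso | deg A = d}.Finite := by
  classical
  let g : (Σ n m : Fin (d * 3 + 1), (Fin n → Fin m) × (Fin n → Fin n → Prop)) → LFG.Iso := fun p =>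
    if hp : (Graph.mk (Fin p.2.1) (Fin p.1) inferInstance inferInstance p.2.2.1 p.2.2.2).IsFeynman
      then cls ⟨_, hp⟩ else 0
  refine (Set.finite_range g).subset ?_
  rintro ⟨G⟩ hG
  have := G.1.finiteH
  have := G.1.finiteV
  have h1 : Nat.card G.1.H ≤ d * 3 := hG ▸ card_half_le G
  have h2 : Nat.card G.1.V ≤ d * 3 :=
    (Nat.card_le_card_of_surjective _ G.2.surjective_vert).trans h1
  let eH := Finite.equivFin G.1.H
  let eV := Finite.equivFin G.1.V
  refine ⟨⟨⟨_, Nat.lt_succ_of_le h1⟩, ⟨_, Nat.lt_succ_of_le h2⟩,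
    fun i => eV (G.1.vert (eH.symm i)), fun i j => G.1.adj (eH.symm i) (eH.symm j)⟩, ?_⟩
  have m := (models G).of_iso (G := Graph.mk (Fin (Nat.card G.1.V)) (Fin (Nat.card G.1.H))
      inferInstance inferInstance (fun i => eV (G.1.vert (eH.symm i)))
      fun i j => G.1.adj (eH.symm i) (eH.symm j)) (e := eV.symm) (d := eH.symm)
    (fun h => (eV.symm_apply_apply _).symm) fun _ _ => Iff.rfl
  have hp := m.isFeynman (feynman G)
  exact (dif_pos hp).trans (cls_eq (G := ⟨_, hp⟩) (K := G) m (models G) rfl)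

theorem eq_zero (G : FeynmanGraph) (h : deg G.cls = 0) : G.cls = 0 := by
  have := G.1.finiteH
  have h1 := card_half_le G
  rw [h] at h1
  exact cls_eq_zero (H := Empty) (models_empty (Finite.card_eq_zero_iff.1 (Nat.le_zero.1 h1)))

theorem deg_sub_add_deg_quot (G : FeynmanGraph) (P : G.1.FeynmanSub) :
    deg (G.sub P).cls + deg (G.quot P).cls = deg G.cls := by
  have := G.1.finiteH
  rw [deg_cls (G := G.sub P) (G.models.sub_models G.feynman P),
    deg_cls (G := G.quot P) (G.models.quot_models G.feynman P), deg_cls G.models]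
  exact (G.feynman.core_contract (G.models.subs G.feynman P).2.2
    (G.models.subs G.feynman P).2.1).symm

theorem exists_sub_equiv (h : G.cls = K.cls) : ∃ e : G.1.FeynmanSub ≃ K.1.FeynmanSub, ∀ P,
    (G.sub P).cls = (K.sub (e P)).cls ∧ (G.quot P).cls = (K.quot (e P)).cls := by
  have := K.1.finiteH
  obtain ⟨φ, m⟩ := exists_models h
  refine ⟨(m.subs K.feynman).trans (K.models.subs K.feynman).symm, fun P => ?_⟩
  have h1 : m.subs K.feynman P = K.models.subs K.feynman
      (((m.subs K.feynman).trans (K.models.subs K.feynman).symm) P) :=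
    ((K.models.subs K.feynman).apply_symm_apply _).symm
  exact ⟨cls_eq (G := G.sub P) (K := K.sub _) (m.sub_models K.feynman P)
      (K.models.sub_models K.feynman _) (congrArg Subtype.val h1),
    cls_eq (G := G.quot P) (K := K.quot _) (m.quot_models K.feynman P)
      (K.models.quot_models K.feynman _)
      (congrArg (fun Z => Diagram.contract K.1.diagram Z.1) h1)⟩

/-- The bijection `subsSubs` of diagrams is transported to graphs. The first two comparisons hold by
its construction, and the third is `contract_contract`. -/
theorem exists_sub_sub_equiv (G : FeynmanGraph) :
    ∃ e : (Σ P : G.1.FeynmanSub, (G.sub P).1.FeynmanSub) ≃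
        Σ P : G.1.FeynmanSub, (G.quot P).1.FeynmanSub, ∀ p,
      ((G.sub p.1).sub p.2).cls = (G.sub (e p).1).cls ∧
      ((G.sub p.1).quot p.2).cls = ((G.quot (e p).1).sub (e p).2).cls ∧
      (G.quot p.1).cls = ((G.quot (e p).1).quot (e p).2).cls := by
  have := G.1.finiteH
  have m := G.models
  have hX := G.feynman
  have hsub : ∀ P, (m.subs hX P).1.Feynman := fun P => (m.subs hX P).2.2
  have hquot : ∀ P, (contract G.1.diagram (m.subs hX P).1).Feynman := fun P =>
    hX.contract (hsub P) (m.subs hX P).2.1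
  let e₁ : (Σ P : G.1.FeynmanSub, (G.sub P).1.FeynmanSub) ≃ Σ Y : Subs G.1.diagram, Subs Y.1 :=
    Equiv.sigmaCongr (m.subs hX) fun P => (m.sub_models hX P).subs (hsub P)
  let e₂ : (Σ P : G.1.FeynmanSub, (G.quot P).1.FeynmanSub) ≃
      Σ Z : Subs G.1.diagram, Subs (contract G.1.diagram Z.1) :=
    Equiv.sigmaCongr (m.subs hX) fun P => (m.quot_models hX P).subs (hquot P)
  refine ⟨(e₁.trans (subsSubs hX)).trans e₂.symm, fun p => ?_⟩
  generalize hq : ((e₁.trans (subsSubs hX)).trans e₂.symm) p = q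
  have h1 : e₂ q = subsSubs hX (e₁ p) := by
    rw [← hq]
    exact e₂.apply_symm_apply _
  obtain ⟨P, Q⟩ := p
  obtain ⟨P', Q'⟩ := q
  have h2 : (m.subs hX P').1 = ((m.sub_models hX P).subs (hsub P) Q).1 :=
    congrArg (fun x => x.1.1) h1
  have h3 : ((m.quot_models hX P').subs (hquot P') Q').1 =
      contract (m.subs hX P).1 ((m.sub_models hX P).subs (hsub P) Q).1 :=
    congrArg (fun x => x.2.1) h1
  refine ⟨?_, ?_, ?_⟩
  · exact cls_eq (G := (G.sub P).sub Q) (K := G.sub P') ((m.sub_models hX P).sub_models (hsub P) Q)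
      (m.sub_models hX P') h2.symm
  · exact cls_eq (G := (G.sub P).quot Q) (K := (G.quot P').sub Q')
      ((m.sub_models hX P).quot_models (hsub P) Q)
      ((m.quot_models hX P').sub_models (hquot P') Q') h3.symm
  · refine cls_eq (G := G.quot P) (K := (G.quot P').quot Q') (m.quot_models hX P)
      ((m.quot_models hX P').quot_models (hquot P') Q') ?_
    refine (contract_contract hX (hsub P) ((m.sub_models hX P).subs (hsub P) Q).2.2
      ((m.sub_models hX P).subs (hsub P) Q).2.1 (m.subs hX P).2.1).symm.trans ?_
    exact congrArg₂ Diagram.contract (congrArg _ h2.symm) h3.symm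

theorem exists_sub_sum_equiv (G K : FeynmanGraph) :
    ∃ e : (G.sum K).1.FeynmanSub ≃ G.1.FeynmanSub × K.1.FeynmanSub, ∀ P,
      ((G.sum K).sub P).cls = (G.sub (e P).1).cls + (K.sub (e P).2).cls ∧
      ((G.sum K).quot P).cls = (G.quot (e P).1).cls + (K.quot (e P).2).cls := by
  have := G.1.finiteH
  have := K.1.finiteH
  have m := G.models
  have m' := K.models
  have hX := G.feynman
  have hX' := K.feynman
  have hs := sum_feynman hX hX'
  let e := ((m.sum m').subs hs).trans
    ((subsSum _ _).trans ((m.subs hX).prodCongr (m'.subs hX')).symm)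
  refine ⟨e, fun P => ?_⟩
  have h1 : subsSum _ _ ((m.sum m').subs hs P) = (m.subs hX (e P).1, m'.subs hX' (e P).2) :=
    (((m.subs hX).prodCongr (m'.subs hX')).apply_symm_apply _).symm
  have h2 := subsSum_eq ((m.sum m').subs hs P)
  rw [h1] at h2
  rw [← cls_sum, ← cls_sum]
  constructor
  · exact cls_eq (G := (G.sum K).sub P) (K := (G.sub (e P).1).sum (K.sub (e P).2))
      ((m.sum m').sub_models hs P) ((m.sub_models hX _).sum (m'.sub_models hX' _)) h2
  · refine cls_eq (G := (G.sum K).quot P) (K := (G.quot (e P).1).sum (K.quot (e P).2))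
      ((m.sum m').quot_models hs P) ((m.quot_models hX _).sum (m'.quot_models hX' _)) ?_
    rw [h2]
    exact contract_sum _ _ _ _

theorem exists_sub_empty (G : FeynmanGraph) : ∃ P₀ : G.1.FeynmanSub, (G.sub P₀).cls = 0 ∧
    (G.quot P₀).cls = G.cls ∧ ∀ P : G.1.FeynmanSub, (G.sub P).cls = 0 → P = P₀ := by
  have := G.1.finiteH
  have m := G.models
  have hX := G.feynman
  let E : Subs G.1.diagram := ⟨Diagram.empty _, empty_isSub, empty_feynman⟩
  have hE : m.subs hX ((m.subs hX).symm E) = E := (m.subs hX).apply_symm_apply E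
  refine ⟨(m.subs hX).symm E, ?_, ?_, fun P hP => ?_⟩
  · have h1 := m.sub_models hX ((m.subs hX).symm E)
    rw [hE] at h1
    exact cls_eq_zero (G := G.sub _) h1
  · refine cls_eq (G := G.quot _) (m.quot_models hX _) m ?_
    rw [hE]
    exact contract_empty hX.toBasic
  · rw [Equiv.eq_symm_apply]
    exact Subtype.ext (eq_empty_of_cls_eq_zero (G := G.sub P) (m.sub_models hX P) hP)

theorem exists_sub_full (G : FeynmanGraph) : ∃ P₀ : G.1.FeynmanSub, (G.quot P₀).cls = 0 ∧
    (G.sub P₀).cls = G.cls ∧ ∀ P : G.1.FeynmanSub, (G.quot P).cls = 0 → P = P₀ := by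
  have := G.1.finiteH
  have m := G.models
  have hX := G.feynman
  let E : Subs G.1.diagram := ⟨_, .refl _, hX⟩
  have hE : m.subs hX ((m.subs hX).symm E) = E := (m.subs hX).apply_symm_apply E
  refine ⟨(m.subs hX).symm E, ?_, ?_, fun P hP => ?_⟩
  · have h1 := m.quot_models hX ((m.subs hX).symm E)
    rw [hE, contract_self] at h1
    exact cls_eq_zero (G := G.quot _) h1
  · exact cls_eq (G := G.sub _) (m.sub_models hX _) m (congrArg Subtype.val hE)
  · rw [Equiv.eq_symm_apply]
    exact Subtype.ext (eq_of_contract_eq_empty hX (m.subs hX P).2.2 (m.subs hX P).2.1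
      (eq_empty_of_cls_eq_zero (G := G.quot P) (m.quot_models hX P) hP))

theorem isGraded : LFG.IsGraded deg where
  cls_zero := rfl
  cls_sum _ _ := rfl
  finite_deg := finite_deg
  eq_zero := by
    rintro ⟨G⟩ hG
    exact eq_zero G hG
  deg_sub := deg_sub_add_deg_quot
  sub_congr _ _ h := exists_sub_equiv h
  sub_sub := exists_sub_sub_equiv
  sub_sum := exists_sub_sum_equiv
  sub_bot := exists_sub_empty
  sub_top := exists_sub_full

end FeynmanGraph

end HallCK

open HallCK in
theorem mainTheorem6 (C : HallData) (hC : C = LRF ∨ C = LFG) :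
    -- the Ringel-Hall algebra `H_C` and its Lie algebra `n` of primitive elements
    ∃ (_ : Ring C.Hall) (_ : Algebra ℚ C.Hall) (n : LieSubalgebra ℚ C.Hall),
      C.IsHallAlgebra ∧ (∀ X : C.Hall, X ∈ n ↔ C.IsPrimitive X) ∧
      -- the canonical isomorphism `U(n) ≃ H_C`
      ∃ Φ : UniversalEnvelopingAlgebra ℚ n ≃ₐ[ℚ] C.Hall,
        (∀ X : n, Φ (UniversalEnvelopingAlgebra.ι ℚ X) = X) ∧
        -- the transpose is an isomorphism of `n`-modules from `H_ins` to `H_top-ins`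
        ∃ T : Ins n ≃ₗ⁅ℚ, n⁆ TopIns n,
          (∀ u : UniversalEnvelopingAlgebra ℚ n,
            T (toIns n (Φ u)) = toTopIns n (Φ (MulOpposite.unop (transpose n u)))) ∧
          -- the restricted duals of `H_ins` and `H_top-ins`, with the dual actions of `n`
          ∃ (elim : LieSubmodule ℚ n (Module.Dual ℚ (Ins n)))
            (topElim : LieSubmodule ℚ n (Module.Dual ℚ (TopIns n))),
            (∀ φ, φ ∈ elim ↔ φ ∘ₗ (toIns n).toLinearMap ∈ C.restrictedDual) ∧
            (∀ φ, φ ∈ topElim ↔ φ ∘ₗ (toTopIns n).toLinearMap ∈ C.restrictedDual) ∧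
            -- the isomorphism of `n`-modules from `H*_elim` to `H*_top-elim` induced by `T`
            ∃ S : elim ≃ₗ⁅ℚ, n⁆ topElim, ∀ (φ : elim) (f : Ins n),
              (S φ : Module.Dual ℚ (TopIns n)) (T f) = (φ : Module.Dual ℚ (Ins n)) f := by
  rcases hC with rfl | rfl
  · exact HallData.IsGraded.main Forest.isGraded
  · exact HallData.IsGraded.main FeynmanGraph.isGraded
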